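/- **Crystals.** For $N\ge 1$, $l\ge 1$ let $B_l=B_l^{(N)}$ be the set of nondecreasing sequences $(\nu_1\le\dots\le\nu_l)$ with letters in $\{1,\dots,N\}$ (the $U'_q(\widehat{\mathfrak{sl}}_N)$-crystal of one-row tableaux). For $1\le i\le N-1$, $e_i$ replaces a letter $i+1$ by $i$ and $f_i$ a letter $i$ by $i+1$; $e_0$ replaces a letter $1$ by $N$ and $f_0$ a letter $N$ by $1$ (rearranging the sequence; the result is $0$ if there is no such letter). Let $\varepsilon_i(b)$ be the number of letters $i+1$ in $b$, and $\varphi_i(b)$ the number of letters $i$ (letters $N$ if $i=0$). On $B_l\otimes B_{l'}=B_l\times B_{l'}$ put $e_i(b\otimes b')=e_ib\otimes b'$ if $\varphi_i(b)\ge\varepsilon_i(b')$ and $b\otimes e_ib'$ otherwise, and $f_i(b\otimes b')=f_ib\otimes b'$ if $\varphi_i(b)>\varepsilon_i(b')$ and $b\otimes f_ib'$ otherwise. Let $b\otimes b'\mapsto\tilde b'\otimes\tilde b$ be the unique bijection $B_l\otimes B_{l'}\to B_{l'}\otimes B_l$ commuting with all $e_i,f_i$ ($0\le i\le N-1$), and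 let $H:B_l\otimes B_{l'}\to\mathbf Z$ be the energy function: $H((N^l)\otimes(N^{l'}))=0$, and whenever $e_i(b\otimes b')\neq0$, $H(e_i(b\otimes b'))-H(b\otimes b')$ equals $1$ if $i=0$, $\varphi_0(b)\ge\varepsilon_0(b')$ and $\varphi_0(\tilde b')\ge\varepsilon_0(\tilde b)$; $-1$ if $i=0$, $\varphi_0(b)<\varepsilon_0(b')$ and $\varphi_0(\tilde b')<\varepsilon_0(\tilde b)$; and $0$ otherwise. (For $N=1$, $l\ne l'$, this just gives $H=0$.) Put $\mathrm{Aff}(B_l)=\{z^db\mid d\in\mathbf Z,\ b\in B_l\}$. **Box ball system.** Let $n\ge2$. A state is a sequence $p=b_1\otimes b_2\otimes\cdots$ of letters in $\{1,\dots,n\}$, all but finitely many equal to $n$. For $r\ge1$ put $u_0=(n^r)\in B_r^{(n)}$ and let $\tilde b_j\otimes u_j$ be the image of $u_{j-1}\otimes b_j$ under $B_r^{(n)}\otimes B_1^{(n)}\simeq B_1^{(n)}\otimes B_r^{(n)}$; then $T_r(p)=\tilde b_1\otimes\tilde b_2\otimes\cdots$. Let $T_\infty=T$ be $\lim_{r\to\infty}T_r$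 (on each state $T_r$ is independent of $r$ for large $r$). **Solitons.** A soliton of length $l$ is a maximal block of non-$n$ letters $n>\nu_1\ge\nu_2\ge\dots\ge\nu_l\ge1$ in consecutive components, preceded and followed by letters $n$ (except that it may begin in the first component). Under $T_r$, a soliton of length $l$ whose first letter is in component $\gamma(t)=\min(r,l)\,t+\gamma$ at time $t$ is labelled by $z^{-\gamma}(\nu_l,\dots,\nu_1)\in\mathrm{Aff}(B_l)$, $B_l=B_l^{(n-1)}$. For solitons of lengths $l_1>\dots>l_m$ we write $$z^{c_1}b_1\otimes\cdots\otimes z^{c_m}b_m\ \mapsto\ z^{c'_m}b'_m\otimes\cdots\otimes z^{c'_1}b'_1$$ (scattering under $T_r$ for initial gaps $\ge D$) if every state $p$ that at time $0$ consists exactly of the solitons $z^{c_1}b_1,\dots,z^{c_m}b_m$, in this order from left to right and with at least $D$ letters $n$ between any two neighbours, satisfies: for all sufficiently large $t$, $T_r^t(p)$ consists exactly of the solitons labelled $z^{c'_m}b'_m,\dots,z^{c'_1}b'_1$ at time $t$, in this order from left to right, and the gaps between them tend to infinity with $t$. **Theorem 4.6.** Let $n\ge 2$; below, $H$ and $\tilde{\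 }$ are those of the $\widehat{\mathfrak{sl}}_{n-1}$-crystals. (1) Let $l_1>l_2\ge1$. There is $D$ such that for all $r$ with $l_2<r\le\infty$ and all $z^{c_1}b_1\in\mathrm{Aff}(B_{l_1})$, $z^{c_2}b_2\in\mathrm{Aff}(B_{l_2})$, the scattering under $T_r$ for initial gaps $\ge D$ is $$z^{c_1}b_1\otimes z^{c_2}b_2\ \mapsto\ z^{c_2+\delta}\tilde b_2\otimes z^{c_1-\delta}\tilde b_1,\qquad \delta=2l_2+H(b_1\otimes b_2).$$ (2) Let $l_1>\dots>l_m\ge1$. There is $D$ such that for all $r$ with $1\le r\le\infty$ and $r>l_j$ for all $j\ge2$, and all $z^{c_j}b_j\in\mathrm{Aff}(B_{l_j})$, the scattering of $z^{c_1}b_1\otimes\cdots\otimes z^{c_m}b_m$ under $T_r$ for initial gaps $\ge D$ is factorized into two body scatterings: its result is obtained from $z^{c_1}b_1\otimes\cdots\otimes z^{c_m}b_m$ by repeatedly applying the map of (1) to two neighbouring factors of which the left one has the greater length, until the lengths are in increasing order. The result does not depend on the order in which these two body maps are applied. -/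

import Mathlib

namespace BoxBall

/-! ### The crystal `B_l`

The letters `1, …, N` are the elements `0, …, N - 1` of `Fin N` (so `⊤ : Fin N` is the letter `N`),
and the colours of the arrows are `0, …, N - 1`, again as elements of `Fin N`. -/

/-- The set `B_l` of the `U'_q(sl_N^)`-crystal: nondecreasing sequences of `l` letters.  Such a
sequence is determined by the multiset of its letters, which is how it is stored here. -/
abbrev Row (N l : ℕ) : Type := Sym (Fin N) l

/-- Replace one letter `a` of `b` by `a'`; `none` plays the role of `0`. -/
def replaceLetter {N l : ℕ} (a a' : Fin N) (b : Row N l) : Option (Row N l) :=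
  if h : a ∈ b.1 then
    some ⟨a' ::ₘ b.1.erase a, by
      rw [Multiset.card_cons, Multiset.card_erase_add_one h]; exact b.2⟩
  else none

/-- The row `(N, N, …, N)` of length `l`. -/
def topRow (N l : ℕ) [NeZero N] : Row N l := Sym.replicate l ⊤

/-- The Kashiwara operator `e_i`.  For `i ≠ 0` it replaces a letter `i + 1` (index `i`) by the letter
`i` (index `i - 1`); subtraction is cyclic, so `e_0` replaces a letter `1` by the letter `N`. -/
def rowE {N l : ℕ} [NeZero N] (i : Fin N) (b : Row N l) : Option (Row N l) :=
  replaceLetter i (i - 1) b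

/-- The Kashiwara operator `f_i`: a letter `i` becomes `i + 1`, and for `i = 0` a letter `N`
becomes `1`. -/
def rowF {N l : ℕ} [NeZero N] (i : Fin N) (b : Row N l) : Option (Row N l) :=
  replaceLetter (i - 1) i b

/-- `ε_i(b)`: the number of letters `i + 1` of `b` (letters `1` if `i = 0`), i.e. the number of times
that `e_i` can be applied. -/
def rowEps {N l : ℕ} (i : Fin N) (b : Row N l) : ℕ := b.1.count i

/-- `φ_i(b)`: the number of letters `i` of `b` (letters `N` if `i = 0`), i.e. the number of times
that `f_i` can be applied. -/
def rowPhi {N l : ℕ} [NeZero N] (i : Fin N) (b : Row N l) : ℕ := b.1.count (i - 1)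

/-! ### Tensor products, the crystal isomorphism and the energy function -/

/-- `e_i` on `B_l ⊗ B_{l'}`. -/
def tensorE {N l l' : ℕ} [NeZero N] (i : Fin N) (x : Row N l × Row N l') :
    Option (Row N l × Row N l') :=
  if rowEps i x.2 ≤ rowPhi i x.1 then (rowE i x.1).map fun b => (b, x.2)
  else (rowE i x.2).map fun b' => (x.1, b')

/-- `f_i` on `B_l ⊗ B_{l'}`. -/
def tensorF {N l l' : ℕ} [NeZero N] (i : Fin N) (x : Row N l × Row N l') :
    Option (Row N l × Row N l') :=
  if rowEps i x.2 < rowPhi i x.1 then (rowF i x.1).map fun b => (b, x.2)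
  else (rowF i x.2).map fun b' => (x.1, b')

/-- `σ` is an isomorphism of crystals `B_l ⊗ B_{l'} ≃ B_{l'} ⊗ B_l`. -/
def IsCrystalIso {N l l' : ℕ} [NeZero N]
    (σ : Row N l × Row N l' → Row N l' × Row N l) : Prop :=
  Function.Bijective σ ∧
    ∀ (i : Fin N) (x : Row N l × Row N l'),
      tensorE i (σ x) = (tensorE i x).map σ ∧ tensorF i (σ x) = (tensorF i x).map σ

/-- The crystal isomorphism `b ⊗ b' ↦ b̃' ⊗ b̃`, characterized as *the* isomorphism of crystals
`B_l ⊗ B_{l'} ≃ B_{l'} ⊗ B_l`. -/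
noncomputable def crystalIso {N l l' : ℕ} [NeZero N] :
    Row N l × Row N l' → Row N l' × Row N l :=
  Classical.epsilon IsCrystalIso

/-- `H` is an energy function on `B_l ⊗ B_{l'}`, normalized by `H((N^l) ⊗ (N^{l'})) = 0`. -/
def IsEnergy {N l l' : ℕ} [NeZero N] (H : Row N l × Row N l' → ℤ) : Prop :=
  H (topRow N l, topRow N l') = 0 ∧
    ∀ (i : Fin N) (x y : Row N l × Row N l'), tensorE i x = some y →
      (i = 0 ∧ rowEps 0 x.2 ≤ rowPhi 0 x.1 ∧
          rowEps 0 (crystalIso x).2 ≤ rowPhi 0 (crystalIso x).1 → H y = H x + 1) ∧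
      (i = 0 ∧ rowPhi 0 x.1 < rowEps 0 x.2 ∧
          rowPhi 0 (crystalIso x).1 < rowEps 0 (crystalIso x).2 → H y = H x - 1) ∧
      (¬ (i = 0 ∧ rowEps 0 x.2 ≤ rowPhi 0 x.1 ∧
          rowEps 0 (crystalIso x).2 ≤ rowPhi 0 (crystalIso x).1) →
        ¬ (i = 0 ∧ rowPhi 0 x.1 < rowEps 0 x.2 ∧
          rowPhi 0 (crystalIso x).1 < rowEps 0 (crystalIso x).2) → H y = H x)

/-- The energy function `H(b ⊗ b')`, characterized as *the* normalized energy function. -/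
noncomputable def energy {N l l' : ℕ} [NeZero N] : Row N l × Row N l' → ℤ :=
  Classical.epsilon IsEnergy

/-! ### The box ball system

A state `p : ℕ → Fin n` is an element of `B_1^{⊗ L}` for large `L`, padded by letters `n` on the
right; `p i` is the tensor component number `i + 1`. -/

/-- The carrier in `B_l` after it has passed the first `j` components of `p`; it starts as
`(n^l)`. -/
noncomputable def carrier {n : ℕ} [NeZero n] (l : ℕ) (p : ℕ → Fin n) : ℕ → Row n l
  | 0 => topRow n l
  | j + 1 => (crystalIso (carrier l p j, Sym.oneEquiv (p j))).2

/-- The time evolution `T_l`. -/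
noncomputable def evolFin {n : ℕ} [NeZero n] (l : ℕ) (p : ℕ → Fin n) : ℕ → Fin n :=
  fun j => Sym.oneEquiv.symm (crystalIso (carrier l p j, Sym.oneEquiv (p j))).1

/-- The time evolution `T = lim_{l → ∞} T_l`: on each state the value of `T_l` for all large `l`. -/
noncomputable def evolLim {n : ℕ} [NeZero n] (p : ℕ → Fin n) : ℕ → Fin n :=
  Classical.epsilon fun q : ℕ → Fin n => ∀ᶠ l in Filter.atTop, evolFin l p = q

/-- The time evolutions `T_r` for finite `r`, and `T` for `r = ∞`. -/
noncomputable def evol {n : ℕ} [NeZero n] (r : ℕ∞) (p : ℕ → Fin n) : ℕ → Fin n :=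
  match r with
  | (l : ℕ) => evolFin l p
  | ⊤ => evolLim p

/-! ### Solitons -/

/-- A soliton of the system with `n = N + 1` letters, labelled by the element `z^pow label` of
`Aff(B_len)` for `sl_N`. -/
structure Soliton (N : ℕ) where
  len : ℕ
  pow : ℤ
  label : Row N len

/-- The components `ν_1 ≥ ν_2 ≥ ⋯ ≥ ν_l` of the state that form a soliton with label
`z^{-γ}(ν_l, …, ν_1)`. -/
def Soliton.word {N : ℕ} (x : Soliton N) : List (Fin (N + 1)) :=
  (x.label.1.sort (· ≥ ·)).map Fin.castSucc

/-- The position `γ(t) = min(r, l) t + γ` of a free soliton `z^{-γ} b` of length `l` at time `t`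
under `T_r`. -/
noncomputable def Soliton.position {N : ℕ} (r : ℕ∞) (t : ℕ) (x : Soliton N) : ℤ :=
  ((min r (x.len : ℕ∞)).toNat : ℤ) * t - x.pow

/-- The state `p` consists precisely of the solitons `xs`, listed from left to right and located where
they are at time `t` of a free motion under `T_r`, with at least `g` letters `n` between
any two of them. -/
def Displays {N : ℕ} (r : ℕ∞) (t g : ℕ) (p : ℕ → Fin (N + 1)) (xs : List (Soliton N)) : Prop :=
  (∀ x ∈ xs, 1 ≤ x.position r t) ∧
  xs.Pairwise (fun x y : Soliton N =>
    x.position r t + (x.len : ℤ) + (g : ℤ) ≤ y.position r t) ∧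
  (∀ x ∈ xs, ∀ (j : ℕ) (a : Fin (N + 1)), x.word[j]? = some a →
    ∀ i : ℕ, (i : ℤ) + 1 = x.position r t + (j : ℤ) → p i = a) ∧
  (∀ i : ℕ, (∀ x ∈ xs, (i : ℤ) + 1 < x.position r t ∨ x.position r t + (x.len : ℤ) ≤ (i : ℤ) + 1) →
    p i = ⊤)

/-- Scattering `xs ↦ ys` under `T_r`: every state that consists at time `0` of the solitons `xs`, with
gaps at least `D`, consists after sufficiently long time of the solitons `ys`, moving
freely and with arbitrarily large gaps. -/
def Scatters {N : ℕ} (r : ℕ∞) (D : ℕ) (xs ys : List (Soliton N)) : Prop :=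
  ∀ p : ℕ → Fin (N + 1), Displays r 0 D p xs →
    ∀ g : ℕ, ∀ᶠ t : ℕ in Filter.atTop, Displays r t g ((evol r)^[t] p) ys

/-- The phase shift `δ = 2 l₂ + H(b₁ ⊗ b₂)`. -/
noncomputable def phaseShift {N l₁ l₂ : ℕ} [NeZero N] (b₁ : Row N l₁) (b₂ : Row N l₂) : ℤ :=
  2 * (l₂ : ℤ) + energy (b₁, b₂)

/-- The two body map
`z^{c₁} b₁ ⊗ z^{c₂} b₂ ↦ z^{c₂ + δ} b̃₂ ⊗ z^{c₁ - δ} b̃₁`. -/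
noncomputable def twoBody {N : ℕ} [NeZero N] (x y : Soliton N) : Soliton N × Soliton N :=
  (⟨y.len, y.pow + phaseShift x.label y.label, (crystalIso (x.label, y.label)).1⟩,
   ⟨x.len, x.pow - phaseShift x.label y.label, (crystalIso (x.label, y.label)).2⟩)

/-- One two body scattering in a list of solitons: two neighbours, the longer one on the left, are
replaced by their image under the two body map. -/
inductive TwoBodyStep {N : ℕ} [NeZero N] : List (Soliton N) → List (Soliton N) → Prop
  | step (u v : List (Soliton N)) (x y : Soliton N) (h : y.len < x.len) :
      TwoBodyStep (u ++ x :: y :: v) (u ++ (twoBody x y).1 :: (twoBody x y).2 :: v)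

end BoxBall

open BoxBall

/-! Three facts drive the proof. The time evolutions commute, by the Yang–Baxter equation, and are
injective on states with finitely many letters different from `n` (`yang_baxter`, `evolFin_comm`,
`evolFin_injective`). They commute with the operators `e_i` of `sl_{n-1}` acting on states
(`StateE.evolFin`), so that statements about solitons need only be checked for highest weight
labels. Well separated solitons of length `l` advance by `min k l` under `T_k` (`evolFin_stateOf`).

On the crystal side, the isomorphism is written down explicitly through piecewise linear functions
`Q_j` of the multiplicities. The operator `e_i` changes only the `Q_j` with `j = i - 1` cyclically,
and its change is exactly the one prescribed for the energy, so `H = -Q_N`. Uniqueness holds because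
`B_l ⊗ B_{l'}` is connected (`crystalIso_eq`, `energy_eq`). For `N = 1` the rows carry no
information and `H = 0`.

Two bodies: a highest weight pair of labels is `1^{l₁} ⊗ 1^e 2^k` with `e + k = l₂`, and `T_{l₂+1}`
can be followed by hand (`iterate_fiveBlocks`). The gap closes by one per step, then the left
soliton hands over its surplus of letters one at a time, then the gap opens again. The phase shift
is `2 l₂ - k`, while `H = -k`.

Many bodies: since `2 min(l,m) - min(l-1,m) - min(l+1,m)` is `1` for `m = l` and `0` otherwise, the
combination `T_l² T_{l-1}⁻¹ T_{l+1}⁻¹` moves only the solitons of length `l`. Hence any two well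
separated placements of the same list of solitons are related by evolutions and their inverses
(`linked_stateOf`). So any two neighbours can be made to collide far away from all others, and every
two body map is realized by evolutions and inverses (`TwoBodyStep.linked`).

A chain of two body maps from `xs` to a sorted list `ys` thus gives composites `F`, `E` of
evolutions with `F p = E q`, where `p`, `q` display `xs`, `ys`. Apply `T_r^t` and commute: for large
`t` the sorted solitons are so far apart that `E` and `F` act on them by free motion, and
injectivity of `F` identifies `T_r^t p` (`eventually_stateOf`). Independence of the order follows
from the dynamics, as a state determines its solitons (`stateOf_injective`); no Yang–Baxter equation
for the map with phases is needed. -/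

namespace BoxBall

/-! ### Crystals of one colour -/

/-- The data of a crystal for a single colour `i`. -/
structure ColorCrystal (B : Type*) where
  e : B → Option B
  f : B → Option B
  eps : B → ℕ
  phi : B → ℕ
  e_iff_f : ∀ b b', e b = some b' ↔ f b' = some b
  eps_of_e : ∀ b b', e b = some b' → eps b = eps b' + 1
  phi_of_e : ∀ b b', e b = some b' → phi b' = phi b + 1
  e_none : ∀ b, e b = none ↔ eps b = 0
  f_none : ∀ b, f b = none ↔ phi b = 0

namespace ColorCrystal

variable {A B C D : Type*}

theorem exists_e (X : ColorCrystal B) {b : B} (h : X.eps b ≠ 0) : ∃ b', X.e b = some b' := by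
  rw [← Option.isSome_iff_exists, Option.isSome_iff_ne_none]
  exact fun h' => h ((X.e_none b).1 h')

theorem exists_f (X : ColorCrystal B) {b : B} (h : X.phi b ≠ 0) : ∃ b', X.f b = some b' := by
  rw [← Option.isSome_iff_exists, Option.isSome_iff_ne_none]
  exact fun h' => h ((X.f_none b).1 h')

theorem eps_ne_zero (X : ColorCrystal B) {b b' : B} (h : X.e b = some b') : X.eps b ≠ 0 := by
  have := X.eps_of_e _ _ h
  omega

/-- The tensor product of two crystals. -/
def tensor (X : ColorCrystal A) (Y : ColorCrystal B) : ColorCrystal (A × B) where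
  e x := if Y.eps x.2 ≤ X.phi x.1 then (X.e x.1).map fun b => (b, x.2)
    else (Y.e x.2).map fun b' => (x.1, b')
  f x := if Y.eps x.2 < X.phi x.1 then (X.f x.1).map fun b => (b, x.2)
    else (Y.f x.2).map fun b' => (x.1, b')
  eps x := X.eps x.1 + (Y.eps x.2 - X.phi x.1)
  phi x := Y.phi x.2 + (X.phi x.1 - Y.eps x.2)
  e_iff_f := by
    rintro ⟨a, b⟩ ⟨a', b'⟩
    constructor
    · intro h
      split_ifs at h with h1
      · simp only [Option.map_eq_some_iff, Prod.mk.injEq] at h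
        obtain ⟨c, hc, rfl, rfl⟩ := h
        have := X.phi_of_e _ _ hc
        rw [if_pos (by simp only at h1 ⊢; omega)]
        simp [(X.e_iff_f _ _).1 hc]
      · simp only [Option.map_eq_some_iff, Prod.mk.injEq] at h
        obtain ⟨c, hc, rfl, rfl⟩ := h
        have := Y.eps_of_e _ _ hc
        rw [if_neg (by simp only at h1 ⊢; omega)]
        simp [(Y.e_iff_f _ _).1 hc]
    · intro h
      split_ifs at h with h1
      · simp only [Option.map_eq_some_iff, Prod.mk.injEq] at h
        obtain ⟨c, hc, rfl, rfl⟩ := h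
        have := X.phi_of_e _ _ ((X.e_iff_f _ _).2 hc)
        rw [if_pos (by simp only at h1 ⊢; omega)]
        simp [(X.e_iff_f _ _).2 hc]
      · simp only [Option.map_eq_some_iff, Prod.mk.injEq] at h
        obtain ⟨c, hc, rfl, rfl⟩ := h
        have := Y.eps_of_e _ _ ((Y.e_iff_f _ _).2 hc)
        rw [if_neg (by simp only at h1 ⊢; omega)]
        simp [(Y.e_iff_f _ _).2 hc]
  eps_of_e := by
    rintro ⟨a, b⟩ ⟨a', b'⟩ h
    split_ifs at h with h1
    · simp only [Option.map_eq_some_iff, Prod.mk.injEq] at h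
      obtain ⟨c, hc, rfl, rfl⟩ := h
      have := X.phi_of_e _ _ hc
      have := X.eps_of_e _ _ hc
      simp only at h1 ⊢; omega
    · simp only [Option.map_eq_some_iff, Prod.mk.injEq] at h
      obtain ⟨c, hc, rfl, rfl⟩ := h
      have := Y.eps_of_e _ _ hc
      simp only at h1 ⊢; omega
  phi_of_e := by
    rintro ⟨a, b⟩ ⟨a', b'⟩ h
    split_ifs at h with h1
    · simp only [Option.map_eq_some_iff, Prod.mk.injEq] at h
      obtain ⟨c, hc, rfl, rfl⟩ := h
      have := X.phi_of_e _ _ hc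
      have := X.eps_of_e _ _ hc
      simp only at h1 ⊢; omega
    · simp only [Option.map_eq_some_iff, Prod.mk.injEq] at h
      obtain ⟨c, hc, rfl, rfl⟩ := h
      have := Y.eps_of_e _ _ hc
      have := Y.phi_of_e _ _ hc
      simp only at h1 ⊢; omega
  e_none := by
    rintro ⟨a, b⟩
    split_ifs with h1
    · simp only [Option.map_eq_none_iff, X.e_none] at h1 ⊢; omega
    · simp only [Option.map_eq_none_iff, Y.e_none] at h1 ⊢; omega
  f_none := by
    rintro ⟨a, b⟩
    split_ifs with h1
    · simp only [Option.map_eq_none_iff, X.f_none] at h1 ⊢; omega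
    · simp only [Option.map_eq_none_iff, Y.f_none] at h1 ⊢; omega

theorem tensor_e_left {X : ColorCrystal A} {Y : ColorCrystal B} {a a' : A} {b : B}
    (h : Y.eps b ≤ X.phi a) (h' : X.e a = some a') : (tensor X Y).e (a, b) = some (a', b) := by
  simp [tensor, h, h']

theorem tensor_e_right {X : ColorCrystal A} {Y : ColorCrystal B} {a : A} {b b' : B}
    (h : X.phi a < Y.eps b) (h' : Y.e b = some b') : (tensor X Y).e (a, b) = some (a, b') := by
  simp [tensor, h, h']

theorem tensor_e_cases {X : ColorCrystal A} {Y : ColorCrystal B} {x y : A × B}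
    (h : (tensor X Y).e x = some y) :
    (Y.eps x.2 ≤ X.phi x.1 ∧ X.e x.1 = some y.1 ∧ y.2 = x.2) ∨
      (X.phi x.1 < Y.eps x.2 ∧ Y.e x.2 = some y.2 ∧ y.1 = x.1) := by
  obtain ⟨a, b⟩ := x
  simp only [tensor] at h
  split_ifs at h with h1 <;> simp only [Option.map_eq_some_iff] at h
  · obtain ⟨c, hc, rfl⟩ := h
    exact Or.inl ⟨h1, hc, rfl⟩
  · obtain ⟨c, hc, rfl⟩ := h
    exact Or.inr ⟨not_le.1 h1, hc, rfl⟩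

@[simp] theorem tensor_eps (X : ColorCrystal A) (Y : ColorCrystal B) (x : A × B) :
    (tensor X Y).eps x = X.eps x.1 + (Y.eps x.2 - X.phi x.1) := rfl

@[simp] theorem tensor_phi (X : ColorCrystal A) (Y : ColorCrystal B) (x : A × B) :
    (tensor X Y).phi x = Y.phi x.2 + (X.phi x.1 - Y.eps x.2) := rfl

/-- Morphisms of crystals (maps commuting with the operators and preserving `ε` and `φ`). -/
structure Hom (X : ColorCrystal A) (Y : ColorCrystal B) (σ : A → B) : Prop where
  e : ∀ b b', X.e b = some b' → Y.e (σ b) = some (σ b')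
  eps : ∀ b, Y.eps (σ b) = X.eps b
  phi : ∀ b, Y.phi (σ b) = X.phi b

namespace Hom

variable {X : ColorCrystal A} {Y : ColorCrystal B} {Z : ColorCrystal C} {W : ColorCrystal D}

theorem f {σ : A → B} (h : Hom X Y σ) (b b' : A) (hb : X.f b = some b') :
    Y.f (σ b) = some (σ b') :=
  (Y.e_iff_f _ _).1 (h.e _ _ ((X.e_iff_f _ _).2 hb))

theorem e_map {σ : A → B} (h : Hom X Y σ) (b : A) : Y.e (σ b) = (X.e b).map σ := by
  rcases hb : X.e b with _ | b'
  · rw [Option.map_none, Y.e_none, h.eps, ← X.e_none, hb]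
  · rw [h.e _ _ hb, Option.map_some]

theorem f_map {σ : A → B} (h : Hom X Y σ) (b : A) : Y.f (σ b) = (X.f b).map σ := by
  rcases hb : X.f b with _ | b'
  · rw [Option.map_none, Y.f_none, h.phi, ← X.f_none, hb]
  · rw [h.f _ _ hb, Option.map_some]

/-- `eps` and `phi` count how often `e` and `f` can be applied, and the equations in `Option`
include the value `none`. Commuting with both operators therefore forces both functions to be
preserved, which turns `IsCrystalIso` into a statement about morphisms. -/
theorem of_commute {σ : A → B} (he : ∀ b, Y.e (σ b) = (X.e b).map σ)
    (hf : ∀ b, Y.f (σ b) = (X.f b).map σ) : Hom X Y σ where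
  e b b' h := by rw [he, h, Option.map_some]
  eps b := by
    induction hn : X.eps b generalizing b with
    | zero => rw [← Y.e_none, he, (X.e_none b).2 hn, Option.map_none]
    | succ n ih =>
      obtain ⟨b', hb'⟩ := X.exists_e (b := b) (by omega)
      have h1 := X.eps_of_e _ _ hb'
      have h2 : Y.e (σ b) = some (σ b') := by rw [he, hb', Option.map_some]
      rw [Y.eps_of_e _ _ h2, ih b' (by omega)]
  phi b := by
    induction hn : X.phi b generalizing b with
    | zero => rw [← Y.f_none, hf, (X.f_none b).2 hn, Option.map_none]
    | succ n ih =>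
      obtain ⟨b', hb'⟩ := X.exists_f (b := b) (by omega)
      have h1 := X.phi_of_e _ _ ((X.e_iff_f _ _).2 hb')
      have h2 : Y.f (σ b) = some (σ b') := by rw [hf, hb', Option.map_some]
      rw [Y.phi_of_e _ _ ((Y.e_iff_f _ _).2 h2), ih b' (by omega)]

theorem id : Hom X X id := ⟨fun _ _ h => h, fun _ => rfl, fun _ => rfl⟩

theorem comp {σ : A → B} {τ : B → C} (h : Hom Y Z τ) (h' : Hom X Y σ) : Hom X Z (τ ∘ σ) where
  e b b' hb := h.e _ _ (h'.e _ _ hb)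
  eps b := by rw [Function.comp, h.eps, h'.eps]
  phi b := by rw [Function.comp, h.phi, h'.phi]

theorem prodMap {σ : A → B} {τ : C → D} (h : Hom X Y σ) (h' : Hom Z W τ) :
    Hom (tensor X Z) (tensor Y W) (Prod.map σ τ) where
  e b b' hb := by
    obtain ⟨a, c⟩ := b
    obtain ⟨a', c'⟩ := b'
    rcases tensor_e_cases hb with ⟨h1, h2, h3⟩ | ⟨h1, h2, h3⟩
    · simp only at h1 h2 h3
      subst h3
      exact tensor_e_left (by rwa [h.phi, h'.eps]) (h.e _ _ h2)
    · simp only at h1 h2 h3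
      subst h3
      exact tensor_e_right (by rwa [h.phi, h'.eps]) (h'.e _ _ h2)
  eps b := by simp [h.eps, h.phi, h'.eps]
  phi b := by simp [h.phi, h'.eps, h'.phi]

/-- In either bracketing the operator acts on the same one of the three factors; comparing the
conditions is arithmetic with the truncated subtractions in `tensor_eps` and `tensor_phi`. -/
theorem assoc (X : ColorCrystal A) (Y : ColorCrystal B) (Z : ColorCrystal C) :
    Hom (tensor (tensor X Y) Z) (tensor X (tensor Y Z)) (fun x => (x.1.1, x.1.2, x.2)) where
  e b b' hb := by
    obtain ⟨⟨x, y⟩, z⟩ := b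
    obtain ⟨⟨x', y'⟩, z'⟩ := b'
    rcases tensor_e_cases hb with ⟨h1, h2, h3⟩ | ⟨h1, h2, h3⟩
    · simp only [tensor_phi] at h1 h2 h3
      subst h3
      rcases tensor_e_cases h2 with ⟨h4, h5, h6⟩ | ⟨h4, h5, h6⟩
      · simp only at h4 h5 h6
        subst h6
        exact tensor_e_left (by simp only [tensor_eps]; omega) h5
      · simp only at h4 h5 h6
        subst h6
        exact tensor_e_right (by simp only [tensor_eps]; omega) (tensor_e_left (by dsimp only; omega) h5)
    · simp only [tensor_phi] at h1 h2 h3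
      cases h3
      exact tensor_e_right (by simp only [tensor_eps]; omega) (tensor_e_right (by dsimp only; omega) h2)
  eps b := by simp only [tensor_eps, tensor_phi]; omega
  phi b := by simp only [tensor_eps, tensor_phi]; omega

theorem assoc_symm (X : ColorCrystal A) (Y : ColorCrystal B) (Z : ColorCrystal C) :
    Hom (tensor X (tensor Y Z)) (tensor (tensor X Y) Z) (fun x => ((x.1, x.2.1), x.2.2)) where
  e b b' hb := by
    have h := (assoc X Y Z).e_map ((b.1, b.2.1), b.2.2)
    simp only at h
    rw [hb] at h
    symm at h
    rw [Option.map_eq_some_iff] at h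
    obtain ⟨c, hc, rfl⟩ := h
    exact hc
  eps b := by simp only [tensor_eps, tensor_phi]; omega
  phi b := by simp only [tensor_eps, tensor_phi]; omega

end Hom

end ColorCrystal

end BoxBall

namespace BoxBall
open ColorCrystal

/-! ### The crystal of rows -/

theorem replaceLetter_eq_some {N l : ℕ} {a a' : Fin N} {b b' : Row N l} :
    replaceLetter a a' b = some b' ↔ a ∈ b.1 ∧ b'.1 = a' ::ₘ b.1.erase a := by
  unfold replaceLetter
  by_cases h : a ∈ b.1
  · rw [dif_pos h]
    exact ⟨fun h' => ⟨h, congrArg Subtype.val (Option.some.inj h').symm⟩,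
      fun h' => congrArg some (Subtype.ext h'.2.symm)⟩
  · rw [dif_neg h]
    exact ⟨fun h' => absurd h' (Option.some_ne_none _).symm, fun h' => absurd h'.1 h⟩

theorem replaceLetter_eq_none {N l : ℕ} {a a' : Fin N} {b : Row N l} :
    replaceLetter a a' b = none ↔ b.1.count a = 0 := by
  rw [Multiset.count_eq_zero]
  unfold replaceLetter
  by_cases h : a ∈ b.1
  · rw [dif_pos h]
    exact ⟨fun h' => absurd h' (Option.some_ne_none _), fun h' => absurd h h'⟩
  · rw [dif_neg h]
    exact ⟨fun _ => h, fun _ => rfl⟩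

theorem replaceLetter_symm {N l : ℕ} {a a' : Fin N} {b b' : Row N l}
    (h : replaceLetter a a' b = some b') : replaceLetter a' a b' = some b := by
  rw [replaceLetter_eq_some] at h ⊢
  obtain ⟨h1, h2⟩ := h
  rw [h2, Multiset.erase_cons_head, Multiset.cons_erase h1]
  exact ⟨Multiset.mem_cons_self _ _, rfl⟩

/-- This is why `N = 1` is treated apart: there `e_0` replaces a letter by itself, and the axioms of
`ColorCrystal` fail for nonempty rows. -/
theorem sub_one_ne {N : ℕ} [NeZero N] (hN : 2 ≤ N) (i : Fin N) : i - 1 ≠ i := by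
  intro h
  have h1 : (1 : Fin N) = 0 := by
    have : i - 1 + 1 = i + 1 := by rw [h]
    rw [sub_add_cancel] at this
    exact (left_eq_add.1 this)
  have h2 := congrArg Fin.val h1
  rw [Fin.val_one', Fin.val_zero, Nat.mod_eq_of_lt (by omega)] at h2
  omega

/-- The correction terms are added on both sides, so that no truncated subtraction occurs. -/
theorem count_replaceLetter {N l : ℕ} {a a' : Fin N} (ha : a' ≠ a) {b b' : Row N l} :
    replaceLetter a a' b = some b' ↔
      (0 < b.1.count a ∧ ∀ j, b'.1.count j + (if j = a then 1 else 0) =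
        b.1.count j + (if j = a' then 1 else 0)) := by
  rw [replaceLetter_eq_some, ← Multiset.count_pos]
  refine and_congr_right fun h => ?_
  rw [Multiset.ext]
  refine forall_congr' fun j => ?_
  rw [Multiset.count_cons]
  by_cases h1 : j = a
  · subst h1
    rw [Multiset.count_erase_self, if_neg (Ne.symm ha), if_pos rfl]
    omega
  · rw [Multiset.count_erase_of_ne h1, if_neg h1]
    omega

/-- The part of the crystal `B_l` of colour `i`. -/
def rowCrystal {N : ℕ} [NeZero N] (hN : 2 ≤ N) (l : ℕ) (i : Fin N) : ColorCrystal (Row N l) where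
  e := rowE i
  f := rowF i
  eps := rowEps i
  phi := rowPhi i
  e_iff_f b b' := ⟨replaceLetter_symm, replaceLetter_symm⟩
  eps_of_e b b' h := by
    have h := ((count_replaceLetter (sub_one_ne hN i)).1 h).2 i
    rw [if_pos rfl, if_neg (sub_one_ne hN i).symm] at h
    exact h.symm
  phi_of_e b b' h := by
    have h := ((count_replaceLetter (sub_one_ne hN i)).1 h).2 (i - 1)
    rw [if_pos rfl, if_neg (sub_one_ne hN i)] at h
    exact h
  e_none _ := replaceLetter_eq_none
  f_none _ := replaceLetter_eq_none

/-- The part of the crystal `B_l ⊗ B_{l'}` of colour `i`. -/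
abbrev rowTensor {N : ℕ} [NeZero N] (hN : 2 ≤ N) (l l' : ℕ) (i : Fin N) :
    ColorCrystal (Row N l × Row N l') :=
  tensor (rowCrystal hN l i) (rowCrystal hN l' i)

theorem tensorE_eq {N l l' : ℕ} [NeZero N] (hN : 2 ≤ N) (i : Fin N) (x : Row N l × Row N l') :
    tensorE i x = (rowTensor hN l l' i).e x := rfl

/-! ### The piecewise linear formula -/

/-- The minimum over all `k` of `x_1 + ⋯ + x_{k-1} + y_{k+1} + ⋯ + y_m`. -/
def tropMin : List (ℕ × ℕ) → ℕ
  | [] => 0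
  | p :: w => min (w.map Prod.snd).sum (p.1 + tropMin w)

theorem tropMin_le_fst (w : List (ℕ × ℕ)) : tropMin w ≤ (w.map Prod.fst).sum := by
  induction w with
  | nil => simp [tropMin]
  | cons p w ih => simp only [tropMin, List.map_cons, List.sum_cons]; omega

theorem tropMin_le_snd (w : List (ℕ × ℕ)) : tropMin w ≤ (w.map Prod.snd).sum := by
  cases w with
  | nil => simp [tropMin]
  | cons p w => simp only [tropMin, List.map_cons, List.sum_cons]; omega

theorem tropMin_concat (w : List (ℕ × ℕ)) (p : ℕ × ℕ) :
    tropMin (w ++ [p]) = min (tropMin w + p.2) (w.map Prod.fst).sum := by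
  induction w with
  | nil => simp [tropMin]
  | cons q w ih =>
    rw [List.cons_append, tropMin, ih, tropMin]
    simp only [List.map_append, List.map_cons, List.map_nil, List.sum_append, List.sum_cons,
      List.sum_nil]
    omega

/-- The minimum for `u ++ w` sees `w` only through its own minimum and the sum of its second
entries. -/
theorem tropMin_append_congr (u : List (ℕ × ℕ)) {w w' : List (ℕ × ℕ)}
    (h : tropMin w = tropMin w') (h' : (w.map Prod.snd).sum = (w'.map Prod.snd).sum) :
    tropMin (u ++ w) = tropMin (u ++ w') := by
  induction u with
  | nil => exact h
  | cons p u ih => simp [tropMin, ih, h']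

section window

variable {N : ℕ} [NeZero N]

/-- The pairs `(x_j, y_j)` for `j = i + 1, …, i + m`. -/
def window (x y : Fin N → ℕ) (i : Fin N) (m : ℕ) : List (ℕ × ℕ) :=
  (List.range m).map fun t => (x (i + (t + 1) • 1), y (i + (t + 1) • 1))

theorem window_add (x y : Fin N → ℕ) (i : Fin N) (m k : ℕ) :
    window x y i (m + k) = window x y i m ++ window x y (i + m • 1) k := by
  simp only [window, List.range_add, List.map_append, List.map_map]
  congr 1
  refine List.map_congr_left fun t _ => ?_
  simp only [Function.comp, add_assoc, ← add_nsmul]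

theorem window_one (x y : Fin N → ℕ) (i : Fin N) : window x y i 1 = [(x (i + 1), y (i + 1))] := by
  simp [window]

theorem val_nsmul_one (t : ℕ) (h : t < N) : (t • (1 : Fin N)).val = t := by
  induction t with
  | zero => simp
  | succ t ih =>
    have h1 : (1 : Fin N).val = 1 := by rw [Fin.val_one', Nat.mod_eq_of_lt (by omega)]
    rw [succ_nsmul, Fin.val_add, ih (by omega), h1, Nat.mod_eq_of_lt h]

theorem nsmul_val_one (j : Fin N) : j.val • (1 : Fin N) = j :=
  Fin.ext (val_nsmul_one _ j.isLt)

theorem card_nsmul_one : N • (1 : Fin N) = 0 := by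
  obtain ⟨m, rfl⟩ : ∃ m, N = m + 1 := ⟨N - 1, by have := NeZero.pos N; omega⟩
  apply Fin.ext
  rw [succ_nsmul, Fin.val_add, val_nsmul_one _ (by omega), Fin.val_one', Fin.val_zero]
  simp

theorem nsmul_one_ne {s t : ℕ} (hs : s < N) (ht : t < N) (h : s ≠ t) :
    s • (1 : Fin N) ≠ t • (1 : Fin N) := by
  intro h'
  have := congrArg Fin.val h'
  rw [val_nsmul_one _ hs, val_nsmul_one _ ht] at this
  exact h this

theorem window_congr {x y x' y' : Fin N → ℕ} {i : Fin N} {m : ℕ}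
    (h : ∀ t < m, x (i + (t + 1) • 1) = x' (i + (t + 1) • 1) ∧
      y (i + (t + 1) • 1) = y' (i + (t + 1) • 1)) :
    window x y i m = window x' y' i m := by
  refine List.map_congr_left fun t ht => ?_
  obtain ⟨h1, h2⟩ := h t (List.mem_range.1 ht)
  rw [h1, h2]

/-- The function `Q_j`. -/
def tropQ (x y : Fin N → ℕ) (j : Fin N) : ℕ := tropMin (window x y j N)

/-- The cyclic windows of `Q_{j-1}` and `Q_j` share the `N - 1` pairs that follow `j`; the pair at
`j` comes first in one and last in the other. Comparing this with `tropQ_self` bounds the difference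
of neighbouring `Q`s, so that the subtractions in `imageFst` and `imageSnd` never truncate. -/
theorem tropQ_pred (x y : Fin N → ℕ) (j : Fin N) :
    tropQ x y (j - 1) = min ((window x y j (N - 1)).map Prod.snd).sum
      (x j + tropMin (window x y j (N - 1))) := by
  have h := window_add x y (j - 1) 1 (N - 1)
  rw [show 1 + (N - 1) = N by have := NeZero.pos N; omega, window_one, one_nsmul,
    sub_add_cancel] at h
  rw [tropQ, h]
  rfl

theorem tropQ_self (x y : Fin N → ℕ) (j : Fin N) :
    tropQ x y j = min (tropMin (window x y j (N - 1)) + y j)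
      ((window x y j (N - 1)).map Prod.fst).sum := by
  have h := window_add x y j (N - 1) 1
  have h1 : j + (N - 1) • 1 + 1 = j := by
    rw [add_assoc, ← succ_nsmul, show N - 1 + 1 = N by have := NeZero.pos N; omega,
      card_nsmul_one, add_zero]
  rw [show N - 1 + 1 = N by have := NeZero.pos N; omega, window_one, h1] at h
  rw [tropQ, h, tropMin_concat]

theorem tropQ_le (x y : Fin N → ℕ) (j : Fin N) : tropQ x y j ≤ y j + tropQ x y (j - 1) := by
  rw [tropQ_pred, tropQ_self]
  have := tropMin_le_snd (window x y j (N - 1))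
  omega

theorem tropQ_pred_le (x y : Fin N → ℕ) (j : Fin N) : tropQ x y (j - 1) ≤ x j + tropQ x y j := by
  rw [tropQ_pred, tropQ_self]
  have := tropMin_le_fst (window x y j (N - 1))
  omega

/-- The values of `Q` next to two neighbouring letters `z` and `a = z + 1`. -/
theorem tropQ_local (hN : 2 ≤ N) (x y : Fin N → ℕ) (z a : Fin N) (ha : z + 1 = a) :
    let M := window x y a (N - 2)
    tropQ x y z = min ((M.map Prod.snd).sum + y z)
        (x a + min (tropMin M + y z) (M.map Prod.fst).sum) ∧
      tropQ x y (z - 1) = min (y a + (M.map Prod.snd).sum)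
        (x z + min (M.map Prod.snd).sum (x a + tropMin M)) ∧
      tropQ x y a = min (min (tropMin M + y z) (M.map Prod.fst).sum + y a)
        ((M.map Prod.fst).sum + x z) := by
  intro M
  have e1 : N - 1 = 1 + (N - 2) := by omega
  have e2 : N - 1 = (N - 2) + 1 := by omega
  have h1 : window x y z (N - 1) = (x a, y a) :: M := by
    rw [e1, window_add, window_one, one_nsmul, ha]
    rfl
  have h2 : a + (N - 2) • 1 + 1 = z := by
    rw [← ha, add_assoc, ← succ_nsmul, add_assoc, ← succ_nsmul', show N - 2 + 1 + 1 = N by omega,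
      card_nsmul_one, add_zero]
  have h3 : window x y a (N - 1) = M ++ [(x z, y z)] := by
    rw [e2, window_add, window_one, h2]
  refine ⟨?_, ?_, ?_⟩
  · have := tropQ_pred x y a
    rw [← ha, add_sub_cancel_right, ha, h3, tropMin_concat] at this
    simpa using this
  · rw [tropQ_pred, h1]
    simp [tropMin]
  · rw [tropQ_self, h3, tropMin_concat]
    simp

/-- The elementary step `e_i` in terms of multiplicities: a letter `a` becomes `z`. -/
def MoveLetter (z a : Fin N) (x x' : Fin N → ℕ) : Prop :=
  0 < x a ∧ ∀ j, x' j + (if j = a then 1 else 0) = x j + (if j = z then 1 else 0)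

/-- The step `e_i` on a tensor product in terms of multiplicities. -/
def TensorMove (z a : Fin N) (x y x' y' : Fin N → ℕ) : Prop :=
  (y a ≤ x z ∧ MoveLetter z a x x' ∧ y' = y) ∨ (x z < y a ∧ MoveLetter z a y y' ∧ x' = x)

theorem MoveLetter.eq_of_ne {N : ℕ} {z a : Fin N} {x x' : Fin N → ℕ} (h : MoveLetter z a x x') {j : Fin N}
    (hz : j ≠ z) (ha : j ≠ a) : x' j = x j := by
  have := h.2 j
  rwa [if_neg hz, if_neg ha] at this

theorem MoveLetter.at_z {N : ℕ} {z a : Fin N} {x x' : Fin N → ℕ} (h : MoveLetter z a x x')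
    (hza : z ≠ a) : x' z = x z + 1 := by
  have := h.2 z
  rwa [if_neg hza, if_pos rfl] at this

theorem MoveLetter.at_a {N : ℕ} {z a : Fin N} {x x' : Fin N → ℕ} (h : MoveLetter z a x x')
    (hza : z ≠ a) : x' a + 1 = x a := by
  have := h.2 a
  rwa [if_neg hza.symm, if_pos rfl] at this

theorem TensorMove.window_eq {z a : Fin N} {x y x' y' : Fin N → ℕ}
    (h : TensorMove z a x y x' y') {i : Fin N} {m : ℕ}
    (hi : ∀ t < m, i + (t + 1) • 1 ≠ z ∧ i + (t + 1) • 1 ≠ a) :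
    window x' y' i m = window x y i m := by
  refine window_congr fun t ht => ?_
  obtain ⟨h1, h2⟩ := hi t ht
  rcases h with ⟨_, h, rfl⟩ | ⟨_, h, rfl⟩
  · exact ⟨h.eq_of_ne h1 h2, rfl⟩
  · exact ⟨rfl, h.eq_of_ne h1 h2⟩

/-- The step `e_i` changes only one of the `Q_j`. -/
theorem TensorMove.tropQ_eq (hN : 2 ≤ N) {z a : Fin N} {x y x' y' : Fin N → ℕ}
    (h : TensorMove z a x y x' y') (hza : z + 1 = a) (hne : z ≠ a) {j : Fin N} (hj : j ≠ z) :
    tropQ x' y' j = tropQ x y j := by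
  obtain ⟨t, ht, htN⟩ : ∃ t : ℕ, j + (t + 1) • 1 = z ∧ t + 1 < N := by
    refine ⟨(z - j).val - 1, ?_, ?_⟩
    · have : (z - j).val ≠ 0 := by
        intro h0
        exact hj (sub_eq_zero.1 (Fin.ext h0)).symm
      rw [show (z - j).val - 1 + 1 = (z - j).val by omega, nsmul_val_one]
      abel
    · have := (z - j).isLt
      omega
  -- Since `j ≠ z`, the pair at `z` is not the last one of the window, so the pairs at `z` and `a =
  -- z + 1` are adjacent inside it.
  have split : ∀ x y : Fin N → ℕ, window x y j N =
      window x y j t ++ ((x z, y z) :: (x a, y a) :: window x y a (N - t - 2)) := by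
    intro x y
    have hw : window x y j N = window x y j (t + (1 + (1 + (N - t - 2)))) := by
      congr 1; omega
    rw [hw, window_add, window_add, window_add, window_one, window_one, one_nsmul,
      show j + t • 1 + 1 = z by rw [← ht, succ_nsmul]; abel, hza]
    rfl
  have hz : z = j + (t + 1) • 1 := ht.symm
  have ha : a = j + (t + 2) • 1 := by rw [← hza, hz, succ_nsmul _ (t + 1)]; abel
  have w1 : window x' y' j t = window x y j t := by
    refine h.window_eq fun s hs => ⟨?_, ?_⟩
    · rw [hz]
      exact fun h' => nsmul_one_ne (by omega) (by omega) (by omega) (add_left_cancel h')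
    · rcases Nat.lt_or_ge (t + 2) N with hlt | hge
      · rw [ha]
        exact fun h' => nsmul_one_ne (by omega) (by omega) (by omega) (add_left_cancel h')
      · have : t + 2 = N := by omega
        rw [ha, this, card_nsmul_one, ← zero_nsmul (1 : Fin N)]
        exact fun h' => nsmul_one_ne (by omega) (by omega) (by omega) (add_left_cancel h')
  have w2 : window x' y' a (N - t - 2) = window x y a (N - t - 2) := by
    refine h.window_eq fun s hs => ⟨?_, ?_⟩
    · rw [show a + (s + 1) • 1 = z + (s + 2) • 1 by
        rw [← hza, succ_nsmul _ (s + 1)]; abel]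
      intro h'
      rw [add_eq_left, ← zero_nsmul (1 : Fin N)] at h'
      exact nsmul_one_ne (by omega) (by omega) (by omega) h'
    · intro h'
      rw [add_eq_left, ← zero_nsmul (1 : Fin N)] at h'
      exact nsmul_one_ne (by omega) (by omega) (by omega) h'
  rw [tropQ, tropQ, split, split, w1, w2]
  -- With `Y` the sum of the remaining `y`s, the terms that matter are `y a + Y` and `x z + Y`. The
  -- tensor rule says which of them is smaller, and the step changes only the other one, which stays
  -- at least as large.
  rcases h with ⟨h1, h, rfl⟩ | ⟨h1, h, rfl⟩
  · have e1 := h.at_z hne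
    have e2 := h.at_a hne
    apply tropMin_append_congr
    · simp only [tropMin, List.map_cons, List.sum_cons]
      omega
    · simp
  · have e1 := h.at_z hne
    have e2 := h.at_a hne
    apply tropMin_append_congr
    · simp only [tropMin, List.map_cons, List.sum_cons]
      omega
    · simp only [List.map_cons, List.sum_cons]
      omega

end window

end BoxBall

namespace BoxBall
open ColorCrystal

/-! ### The explicit isomorphism and energy function -/

section explicit

variable {N : ℕ} [NeZero N]

/-- Multiplicities of the first factor of the image of `b ⊗ b'`. -/
def imageFst (x y : Fin N → ℕ) (j : Fin N) : ℕ := y j + tropQ x y (j - 1) - tropQ x y j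

/-- Multiplicities of the second factor of the image of `b ⊗ b'`. -/
def imageSnd (x y : Fin N → ℕ) (j : Fin N) : ℕ := x j + tropQ x y j - tropQ x y (j - 1)

/-- The data needed to study the step `z = a - 1`, `a` in the image. -/
theorem image_local (hN : 2 ≤ N) (x y : Fin N → ℕ) {z a : Fin N} (hza : z + 1 = a) :
    imageFst x y a + (imageSnd x y a - imageFst x y z) = x a + (y a - x z) ∧
    imageSnd x y z + (imageFst x y z - imageSnd x y a) = y z + (x z - y a) := by
  obtain ⟨h1, h2, h3⟩ := tropQ_local hN x y z a hza
  have c1 := tropMin_le_fst (window x y a (N - 2))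
  have c2 := tropMin_le_snd (window x y a (N - 2))
  have ha : a - 1 = z := by rw [← hza, add_sub_cancel_right]
  simp only [imageFst, imageSnd, ha]
  constructor <;> omega

/-- The effect of a step `e_i` on `Q_i`, in terms of the neighbouring `Q`s. -/
theorem tropical_step {xz xa yz ya xz' xa' yz' ya' c X Y q q' r s : ℕ} (_hX : c ≤ X) (_hY : c ≤ Y)
    (hq : q = min (Y + yz) (xa + min (c + yz) X))
    (hr : r = min (ya + Y) (xz + min Y (xa + c)))
    (hs : s = min (min (c + yz) X + ya) (X + xz))
    (hq' : q' = min (Y + yz') (xa' + min (c + yz') X))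
    (h : (ya ≤ xz ∧ xz' = xz + 1 ∧ xa' + 1 = xa ∧ yz' = yz ∧ ya' = ya) ∨
      (xz < ya ∧ yz' = yz + 1 ∧ ya' + 1 = ya ∧ xz' = xz ∧ xa' = xa)) :
    (ya ≤ xz → (xa + s ≤ yz + r ∧ q' + 1 = q) ∨ (yz + r < xa + s ∧ q' = q)) ∧
    (xz < ya → (xa + s ≤ yz + r ∧ q' = q) ∨ (yz + r < xa + s ∧ q' = q + 1)) := by
  rcases h with ⟨h, rfl, rfl, rfl, rfl⟩ | ⟨h, rfl, rfl, rfl, rfl⟩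
  · refine ⟨fun _ => ?_, fun h' => by omega⟩
    have hr' : r = min (ya' + Y) (xz + (xa' + 1 + c)) := by omega
    have hs' : s = min (c + yz') X + ya' := by omega
    generalize hm : min (c + yz') X = m at *
    clear hr hs
    omega
  · refine ⟨fun h' => by omega, fun _ => ?_⟩
    have hr' : r = xz' + min Y (xa' + c) := by omega
    clear hr
    omega

/-- One computation serves both the isomorphism and the energy. Only `Q_z` moves; it drops by one if
the step acts on the left factor before and after the exchange, rises by one if it acts on the right
factor both times, and is unchanged otherwise. For `z = N` this is the recursion for `-H`. -/
theorem image_move (hN : 2 ≤ N) {x y x' y' : Fin N → ℕ} {z a : Fin N} (hza : z + 1 = a)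
    (hne : z ≠ a) (h : TensorMove z a x y x' y') :
    TensorMove z a (imageFst x y) (imageSnd x y) (imageFst x' y') (imageSnd x' y') ∧
    (y a ≤ x z → imageSnd x y a ≤ imageFst x y z → tropQ x' y' z + 1 = tropQ x y z) ∧
    (x z < y a → imageFst x y z < imageSnd x y a → tropQ x' y' z = tropQ x y z + 1) ∧
    (¬ (y a ≤ x z ∧ imageSnd x y a ≤ imageFst x y z) →
      ¬ (x z < y a ∧ imageFst x y z < imageSnd x y a) → tropQ x' y' z = tropQ x y z) := by
  obtain ⟨h1, h2, h3⟩ := tropQ_local hN x y z a hza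
  obtain ⟨h1', -, -⟩ := tropQ_local hN x' y' z a hza
  have hz1 : z - 1 ≠ z := sub_one_ne hN z
  have h2' := h.tropQ_eq hN hza hne hz1
  have h3' := h.tropQ_eq hN hza hne hne.symm
  have c1 := tropMin_le_fst (window x y a (N - 2))
  have c2 := tropMin_le_snd (window x y a (N - 2))
  have ha : a - 1 = z := by rw [← hza, add_sub_cancel_right]
  have hw : window x' y' a (N - 2) = window x y a (N - 2) := by
    refine h.window_eq fun s hs => ⟨?_, ?_⟩
    · intro h'
      rw [← hza, add_assoc, ← succ_nsmul', add_eq_left, ← zero_nsmul (1 : Fin N)] at h'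
      exact nsmul_one_ne (by omega) (by omega) (by omega) h'
    · intro h'
      rw [add_eq_left, ← zero_nsmul (1 : Fin N)] at h'
      exact nsmul_one_ne (by omega) (by omega) (by omega) h'
  rw [hw] at h1'
  have other : ∀ j, j ≠ z → j ≠ a → imageFst x' y' j = imageFst x y j ∧
      imageSnd x' y' j = imageSnd x y j := by
    intro j hjz hja
    have hj1 : j - 1 ≠ z := fun h' => hja (by rw [← hza, ← h', sub_add_cancel])
    simp only [imageFst, imageSnd, h.tropQ_eq hN hza hne hjz, h.tropQ_eq hN hza hne hj1]
    rcases h with ⟨_, h, rfl⟩ | ⟨_, h, rfl⟩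
    · exact ⟨rfl, by rw [h.eq_of_ne hjz hja]⟩
    · exact ⟨by rw [h.eq_of_ne hjz hja], rfl⟩
  have f1 : imageFst x y z = y z + tropQ x y (z - 1) - tropQ x y z := rfl
  have f2 : imageFst x' y' z = y' z + tropQ x y (z - 1) - tropQ x' y' z := by rw [← h2']; rfl
  have f3 : imageSnd x y z = x z + tropQ x y z - tropQ x y (z - 1) := rfl
  have f4 : imageSnd x' y' z = x' z + tropQ x' y' z - tropQ x y (z - 1) := by rw [← h2']; rfl
  have f5 : imageFst x y a = y a + tropQ x y z - tropQ x y a := by rw [imageFst, ha]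
  have f6 : imageFst x' y' a = y' a + tropQ x' y' z - tropQ x y a := by rw [imageFst, ha, h3']
  have f7 : imageSnd x y a = x a + tropQ x y a - tropQ x y z := by rw [imageSnd, ha]
  have f8 : imageSnd x' y' a = x' a + tropQ x y a - tropQ x' y' z := by rw [imageSnd, ha, h3']
  have build : ∀ u u' : Fin N → ℕ, (∀ j, j ≠ z → j ≠ a → u' j = u j) → u' z = u z + 1 →
      u' a + 1 = u a → MoveLetter z a u u' := by
    intro u u' g1 g2 g3
    refine ⟨by omega, fun j => ?_⟩
    by_cases hjz : j = z
    · rw [hjz, if_neg hne, if_pos rfl, g2]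
    · by_cases hja : j = a
      · rw [hja, if_neg hne.symm, if_pos rfl, g3, add_zero]
      · rw [if_neg hjz, if_neg hja, g1 j hjz hja]
  have same : ∀ u u' : Fin N → ℕ, (∀ j, j ≠ z → j ≠ a → u' j = u j) → u' z = u z →
      u' a = u a → u' = u := by
    intro u u' g1 g2 g3
    funext j
    by_cases hjz : j = z
    · rw [hjz, g2]
    · by_cases hja : j = a
      · rw [hja, g3]
      · exact g1 j hjz hja
  have nums : (y a ≤ x z ∧ x' z = x z + 1 ∧ x' a + 1 = x a ∧ y' z = y z ∧ y' a = y a) ∨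
      (x z < y a ∧ y' z = y z + 1 ∧ y' a + 1 = y a ∧ x' z = x z ∧ x' a = x a) := by
    rcases h with ⟨g, h, rfl⟩ | ⟨g, h, rfl⟩
    · exact Or.inl ⟨g, h.at_z hne, h.at_a hne, rfl, rfl⟩
    · exact Or.inr ⟨g, h.at_z hne, h.at_a hne, rfl, rfl⟩
  -- The tensor rule on the image compares `imageSnd` at `a` with `imageFst` at `z`. Both contain
  -- `-Q_z`; after cancelling it the comparison is between `x a + Q_a` and `y z + Q_{z-1}`, as in
  -- `tropical_step`.
  obtain ⟨sl, sr⟩ := tropical_step c1 c2 h1 h2 h3 h1' nums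
  have b1 := tropQ_le x y z
  have b2 := tropQ_pred_le x y z
  have b3 := tropQ_le x y a
  have b4 := tropQ_pred_le x y a
  have b1' := tropQ_le x' y' z
  have b2' := tropQ_pred_le x' y' z
  have b3' := tropQ_le x' y' a
  have b4' := tropQ_pred_le x' y' a
  rw [ha] at b3 b4 b3' b4'
  rw [h2'] at b1' b2'
  rw [h3'] at b3' b4'
  clear h1 h2 h3 h1' h2' h3' c1 c2 hw
  generalize tropQ x y z = q at *
  generalize tropQ x' y' z = q' at *
  generalize tropQ x y (z - 1) = r at *
  generalize tropQ x y a = s at *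
  refine ⟨?_, ?_, ?_, ?_⟩
  · by_cases hc : imageSnd x y a ≤ imageFst x y z
    · exact Or.inl ⟨hc, build _ _ (fun j g g' => (other j g g').1) (by omega) (by omega),
        same _ _ (fun j g g' => (other j g g').2) (by omega) (by omega)⟩
    · exact Or.inr ⟨by omega, build _ _ (fun j g g' => (other j g g').2) (by omega) (by omega),
        same _ _ (fun j g g' => (other j g g').1) (by omega) (by omega)⟩
  · omega
  · omega
  · omega

/-- The row with given multiplicities. -/
def rowOfCount {N l : ℕ} (c : Fin N → ℕ) (h : ∑ j, c j = l) : Row N l :=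
  ⟨∑ j, Multiset.replicate (c j) j, by simp [h]⟩

theorem count_rowOfCount {N l : ℕ} (c : Fin N → ℕ) (h : ∑ j, c j = l) (j : Fin N) :
    (rowOfCount c h).1.count j = c j := by
  simp only [rowOfCount, Multiset.count_sum', Multiset.count_replicate]
  rw [Finset.sum_ite_eq' Finset.univ j c]
  simp

theorem row_ext {N l : ℕ} {b b' : Row N l} (h : ∀ j, b.1.count j = b'.1.count j) : b = b' :=
  Subtype.ext (Multiset.ext.2 h)

theorem sum_count {N l : ℕ} (b : Row N l) : ∑ j, b.1.count j = l := by
  have := Multiset.toFinset_sum_count_eq b.1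
  refine Eq.trans ?_ (this.trans b.2)
  refine (Finset.sum_subset (Finset.subset_univ _) fun j _ hj => ?_).symm
  exact Multiset.count_eq_zero.2 fun h => hj (Multiset.mem_toFinset.2 h)

theorem sum_pred (q : Fin N → ℕ) : ∑ j, q (j - 1) = ∑ j, q j :=
  Equiv.sum_comp (Equiv.subRight (1 : Fin N)) q

/-- The differences `Q_{j-1} - Q_j` cancel around the cycle. -/
theorem sum_imageFst (x y : Fin N → ℕ) : ∑ j, imageFst x y j = ∑ j, y j := by
  have h : ∑ j, imageFst x y j + ∑ j, tropQ x y j = ∑ j, y j + ∑ j, tropQ x y j := by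
    conv_rhs => rw [← sum_pred (tropQ x y)]
    rw [← Finset.sum_add_distrib, ← Finset.sum_add_distrib]
    refine Finset.sum_congr rfl fun j _ => ?_
    have := tropQ_le x y j
    simp only [imageFst]
    omega
  omega

theorem image_weight (x y : Fin N → ℕ) (j : Fin N) :
    imageFst x y j + imageSnd x y j = x j + y j := by
  have := tropQ_le x y j
  have := tropQ_pred_le x y j
  simp only [imageFst, imageSnd]
  omega

theorem sum_imageSnd (x y : Fin N → ℕ) : ∑ j, imageSnd x y j = ∑ j, x j := by
  have h : ∑ j, imageFst x y j + ∑ j, imageSnd x y j = ∑ j, x j + ∑ j, y j := by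
    rw [← Finset.sum_add_distrib, ← Finset.sum_add_distrib]
    exact Finset.sum_congr rfl fun j _ => image_weight x y j
  rw [sum_imageFst] at h
  omega

/-- The multiplicities of a row. -/
def mult {N l : ℕ} (b : Row N l) (j : Fin N) : ℕ := b.1.count j

/-- The piecewise linear formula for the crystal isomorphism. -/
def rowSwap {l l' : ℕ} (b : Row N l × Row N l') : Row N l' × Row N l :=
  (rowOfCount (imageFst (mult b.1) (mult b.2)) (by rw [sum_imageFst]; exact sum_count b.2),
    rowOfCount (imageSnd (mult b.1) (mult b.2)) (by rw [sum_imageSnd]; exact sum_count b.1))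

theorem mult_rowOfCount {N l : ℕ} (c : Fin N → ℕ) (h : ∑ j, c j = l) : mult (rowOfCount c h) = c :=
  funext fun j => count_rowOfCount c h j

theorem mult_rowSwap_fst {l l' : ℕ} (b : Row N l × Row N l') :
    mult (rowSwap b).1 = imageFst (mult b.1) (mult b.2) := by
  exact mult_rowOfCount _ (by rw [sum_imageFst]; exact sum_count b.2)

theorem mult_rowSwap_snd {l l' : ℕ} (b : Row N l × Row N l') :
    mult (rowSwap b).2 = imageSnd (mult b.1) (mult b.2) := by
  exact mult_rowOfCount _ (by rw [sum_imageSnd]; exact sum_count b.1)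

theorem mult_injective {N l : ℕ} {b b' : Row N l} (h : mult b = mult b') : b = b' :=
  row_ext fun j => congrFun h j

theorem rowSwap_weight {l l' : ℕ} (b : Row N l × Row N l') (j : Fin N) :
    mult (rowSwap b).1 j + mult (rowSwap b).2 j = mult b.1 j + mult b.2 j := by
  rw [mult_rowSwap_fst, mult_rowSwap_snd, image_weight]

theorem rowCrystal_e_iff (hN : 2 ≤ N) {l : ℕ} (i : Fin N) (b b' : Row N l) :
    (rowCrystal hN l i).e b = some b' ↔ MoveLetter (i - 1) i (mult b) (mult b') :=
  count_replaceLetter (sub_one_ne hN i)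

theorem rowTensor_e_iff (hN : 2 ≤ N) {l l' : ℕ} (i : Fin N) (b b' : Row N l × Row N l') :
    (rowTensor hN l l' i).e b = some b' ↔
      TensorMove (i - 1) i (mult b.1) (mult b.2) (mult b'.1) (mult b'.2) := by
  obtain ⟨b1, b2⟩ := b
  obtain ⟨c1, c2⟩ := b'
  constructor
  · intro h
    rcases tensor_e_cases h with ⟨h1, h2, h3⟩ | ⟨h1, h2, h3⟩
    · exact Or.inl ⟨h1, (rowCrystal_e_iff hN i _ _).1 h2, by rw [h3]⟩
    · exact Or.inr ⟨h1, (rowCrystal_e_iff hN i _ _).1 h2, by rw [h3]⟩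
  · rintro (⟨h1, h2, h3⟩ | ⟨h1, h2, h3⟩)
    · obtain rfl := mult_injective h3
      exact tensor_e_left h1 ((rowCrystal_e_iff hN i _ _).2 h2)
    · obtain rfl := mult_injective h3
      exact tensor_e_right h1 ((rowCrystal_e_iff hN i _ _).2 h2)

theorem rowSwap_hom (hN : 2 ≤ N) (l l' : ℕ) (i : Fin N) :
    Hom (rowTensor hN l l' i) (rowTensor hN l' l i) rowSwap where
  e b b' h := by
    rw [rowTensor_e_iff] at h ⊢
    rw [mult_rowSwap_fst, mult_rowSwap_snd, mult_rowSwap_fst, mult_rowSwap_snd]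
    exact (image_move hN (sub_add_cancel i 1) (sub_one_ne hN i) h).1
  eps b := by
    have := (image_local hN (mult b.1) (mult b.2) (sub_add_cancel i 1)).1
    rw [← mult_rowSwap_fst, ← mult_rowSwap_snd] at this
    exact this
  phi b := by
    have := (image_local hN (mult b.1) (mult b.2) (sub_add_cancel i 1)).2
    rw [← mult_rowSwap_fst, ← mult_rowSwap_snd] at this
    exact this

end explicit

end BoxBall

namespace BoxBall
open ColorCrystal

/-! ### Connectedness and uniqueness -/

section connected

variable {N : ℕ} [NeZero N]

theorem val_top : (⊤ : Fin N).val = N - 1 := rfl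

theorem zero_sub_one : (0 : Fin N) - 1 = ⊤ := by
  rw [sub_eq_iff_eq_add]
  apply Fin.ext
  rw [Fin.val_zero, Fin.val_add, val_top, Fin.val_one']
  have := NeZero.pos N
  rcases Nat.lt_or_ge 1 N with h | h
  · rw [Nat.mod_eq_of_lt h, Nat.sub_add_cancel this, Nat.mod_self]
  · obtain rfl : N = 1 := by omega
    rfl

theorem top_add_one : (⊤ : Fin N) + 1 = 0 := by
  rw [← zero_sub_one, sub_add_cancel]

theorem val_add_one_of_ne {j : Fin N} (h : j ≠ ⊤) : (j + 1).val = j.val + 1 := by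
  have h1 : j.val ≠ N - 1 := fun h' => h (Fin.ext h')
  have := j.isLt
  rw [Fin.val_add, Fin.val_one', Nat.mod_eq_of_lt (by omega : 1 < N), Nat.mod_eq_of_lt (by omega)]

theorem val_sub_one_of_ne {j : Fin N} (h : j ≠ 0) : (j - 1).val + 1 = j.val := by
  have : j - 1 ≠ ⊤ := by
    intro h'
    rw [← zero_sub_one, sub_left_inj] at h'
    exact h h'
  rw [← val_add_one_of_ne this, sub_add_cancel]

theorem zero_ne_top (hN : 2 ≤ N) : (0 : Fin N) ≠ ⊤ := by
  intro h
  have := congrArg Fin.val h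
  rw [val_top, Fin.val_zero] at this
  omega

theorem mult_topRow (l : ℕ) (j : Fin N) : mult (topRow N l) j = if j = ⊤ then l else 0 := by
  have : mult (topRow N l) j = (Multiset.replicate l (⊤ : Fin N)).count j := rfl
  rw [this, Multiset.count_replicate]
  simp only [eq_comm]

theorem sum_mult {N l : ℕ} (b : Row N l) : ∑ j, mult b j = l := sum_count b

theorem eq_topRow {l : ℕ} {b : Row N l} (h : ∀ j, j ≠ ⊤ → mult b j = 0) : b = topRow N l := by
  refine mult_injective (funext fun j => ?_)
  rw [mult_topRow]
  split_ifs with hj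
  · subst hj
    refine Eq.trans ?_ (sum_mult b)
    exact (Finset.sum_eq_single _ (fun j _ hj => h j hj) (by simp)).symm
  · exact h j hj

/-- The weight of a row for a given weight of the letters. -/
def weightSum {l : ℕ} (ω : Fin N → ℕ) (b : Row N l) : ℕ := ∑ j, mult b j * ω j

theorem weightSum_e (hN : 2 ≤ N) {l : ℕ} (ω : Fin N → ℕ) {i : Fin N} {b b' : Row N l}
    (h : (rowCrystal hN l i).e b = some b') : weightSum ω b' + ω i = weightSum ω b + ω (i - 1) := by
  have h2 := ((rowCrystal_e_iff hN i b b').1 h).2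
  have : ∑ j, (mult b' j + if j = i then 1 else 0) * ω j =
      ∑ j, (mult b j + if j = i - 1 then 1 else 0) * ω j :=
    Finset.sum_congr rfl fun j _ => by rw [h2]
  simp only [add_mul, Finset.sum_add_distrib, ite_mul, one_mul, zero_mul, Finset.sum_ite_eq',
    Finset.mem_univ, if_true] at this
  exact this

theorem weightSum_tensor_e (hN : 2 ≤ N) {l l' : ℕ} (ω : Fin N → ℕ) {i : Fin N}
    {b b' : Row N l × Row N l'} (h : (rowTensor hN l l' i).e b = some b') :
    weightSum ω b'.1 + weightSum ω b'.2 + ω i = weightSum ω b.1 + weightSum ω b.2 + ω (i - 1) := by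
  rcases tensor_e_cases h with ⟨_, h2, h3⟩ | ⟨_, h2, h3⟩
  · have := weightSum_e hN ω h2
    rw [h3]
    omega
  · have := weightSum_e hN ω h2
    rw [h3]
    omega

/-- Induction along the operators `e_i` with colours in a set. -/
theorem e_induction {B I : Type*} (X : I → ColorCrystal B) (S : Set I) (μ : B → ℕ)
    (hμ : ∀ i ∈ S, ∀ b b', (X i).e b = some b' → μ b' < μ b) {P : B → Prop}
    (base : ∀ b, (∀ i ∈ S, (X i).eps b = 0) → P b)
    (step : ∀ i ∈ S, ∀ b b', (X i).e b = some b' → P b' → P b) (b : B) : P b := by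
  induction hn : μ b using Nat.strong_induction_on generalizing b with
  | _ n ih =>
    subst hn
    by_cases h : ∀ i ∈ S, (X i).eps b = 0
    · exact base b h
    · push Not at h
      obtain ⟨i, hi, h⟩ := h
      obtain ⟨b', hb'⟩ := (X i).exists_e h
      exact step i hi b b' hb' (ih _ (hμ i hi b b' hb') b' rfl)

/-- Induction along the operators `f_i` with colours in a set. -/
theorem f_induction {B I : Type*} (X : I → ColorCrystal B) (S : Set I) (μ : B → ℕ)
    (hμ : ∀ i ∈ S, ∀ b b', (X i).e b' = some b → μ b' < μ b) {P : B → Prop}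
    (base : ∀ b, (∀ i ∈ S, (X i).phi b = 0) → P b)
    (step : ∀ i ∈ S, ∀ b b', (X i).e b' = some b → P b' → P b) (b : B) : P b := by
  induction hn : μ b using Nat.strong_induction_on generalizing b with
  | _ n ih =>
    subst hn
    by_cases h : ∀ i ∈ S, (X i).phi b = 0
    · exact base b h
    · push Not at h
      obtain ⟨i, hi, h⟩ := h
      obtain ⟨b', hb'⟩ := (X i).exists_f h
      have hb := ((X i).e_iff_f _ _).2 hb'
      exact step i hi b b' hb (ih _ (hμ i hi b b' hb) b' rfl)

/-- The function `(j + 1).val` gives the letter `N` the lowest rank `0`. Hence the `e_i` with `i ≠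
⊤` lower the total rank of a row, and the rows on which they all vanish are `N^l`. -/
theorem rank_lt {i : Fin N} (hi : i ≠ ⊤) : (i - 1 + 1).val < (i + 1).val := by
  rw [sub_add_cancel, val_add_one_of_ne hi]
  omega

theorem corank_lt {i : Fin N} (hi : i ≠ 0) : N - i.val < N - (i - 1).val := by
  have := val_sub_one_of_ne hi
  have := i.isLt
  omega

/-- `B_l ⊗ B_{l'}` is connected. -/
theorem rowTensor_connected (hN : 2 ≤ N) {l l' : ℕ} {P : Row N l × Row N l' → Prop}
    (h : ∀ i x y, (rowTensor hN l l' i).e x = some y → (P x ↔ P y))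
    (h0 : P (topRow N l, topRow N l')) (x : Row N l × Row N l') : P x := by
  -- The `f_i` with `i ≠ 0` push the letters up until none of these operators applies; this forces
  -- the second factor to be `N^{l'}`.
  refine f_induction (rowTensor hN l l') {0}ᶜ
    (fun b => weightSum (fun j => N - j.val) b.1 + weightSum (fun j => N - j.val) b.2)
    ?_ ?_ (fun i _ b b' hb hP => (h i _ _ hb).1 hP) x
  · intro i hi b b' hb
    have := weightSum_tensor_e hN (fun j => N - j.val) hb
    have := corank_lt hi
    omega
  · rintro ⟨b1, b2⟩ hb
    obtain rfl : b2 = topRow N l' := by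
      refine eq_topRow fun j hj => ?_
      have := hb (j + 1) (by
        intro h'
        rw [Set.mem_singleton_iff, ← top_add_one] at h'
        exact hj (add_right_cancel h'))
      have : (rowCrystal hN l' (j + 1)).phi b2 = 0 := Nat.eq_zero_of_add_eq_zero_right this
      rw [← add_sub_cancel_right j 1]
      exact this
    clear hb
    -- Next to `N^{l'}`, which has `ε_i = 0` for `i ≠ ⊤`, these `e_i` act on the first factor alone
    -- and carry it to `N^l`.
    refine e_induction (rowCrystal hN l) {⊤}ᶜ (weightSum fun j => (j + 1).val)
      (P := fun b => P (b, topRow N l')) ?_ ?_ ?_ b1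
    · intro i hi b b' hb
      have := weightSum_e hN (fun j => (j + 1).val) hb
      have := rank_lt hi
      omega
    · intro b hb
      obtain rfl : b = topRow N l := eq_topRow fun j hj => hb j hj
      exact h0
    · intro i hi b b' hb hP
      refine (h i _ _ (tensor_e_left ?_ hb)).2 hP
      have : (rowCrystal hN l' i).eps (topRow N l') = 0 := by
        have := mult_topRow (N := N) l' i
        rwa [if_neg (show ¬ i = ⊤ from fun h => hi h)] at this
      omega

theorem rowHom_unique (hN : 2 ≤ N) {l l' : ℕ} {B : Type*} {X : Fin N → ColorCrystal B}
    {σ τ : Row N l × Row N l' → B} (hσ : ∀ i, Hom (rowTensor hN l l' i) (X i) σ)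
    (hτ : ∀ i, Hom (rowTensor hN l l' i) (X i) τ)
    (h0 : σ (topRow N l, topRow N l') = τ (topRow N l, topRow N l')) : σ = τ := by
  funext x
  refine rowTensor_connected hN (P := fun x => σ x = τ x) (fun i x y h => ⟨fun h' => ?_, fun h' => ?_⟩)
    h0 x
  · have h1 := (hσ i).e _ _ h
    rw [h', (hτ i).e _ _ h] at h1
    exact (Option.some.inj h1).symm
  · have h1 := (hσ i).f _ _ (((rowTensor hN l l' i).e_iff_f _ _).1 h)
    rw [h', (hτ i).f _ _ (((rowTensor hN l l' i).e_iff_f _ _).1 h)] at h1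
    exact (Option.some.inj h1).symm

/-- The pair of top rows is recognized by its `ε` and `φ` alone: `ε_i = 0` for `i ≠ ⊤`, and `φ_0` is
the total number of letters. -/
theorem rowHom_top (hN : 2 ≤ N) {l l' : ℕ} {σ : Row N l × Row N l' → Row N l' × Row N l}
    (hσ : ∀ i, Hom (rowTensor hN l l' i) (rowTensor hN l' l i) σ) :
    σ (topRow N l, topRow N l') = (topRow N l', topRow N l) := by
  have heps : ∀ i, i ≠ ⊤ → mult (σ (topRow N l, topRow N l')).1 i +
      (mult (σ (topRow N l, topRow N l')).2 i -
        mult (σ (topRow N l, topRow N l')).1 (i - 1)) = 0 := by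
    intro i hi
    refine ((hσ i).eps (topRow N l, topRow N l')).trans ?_
    change mult (topRow N l) i + (mult (topRow N l') i - mult (topRow N l) (i - 1)) = 0
    rw [mult_topRow, mult_topRow, if_neg hi, if_neg hi, Nat.zero_sub]
  have hphi : mult (σ (topRow N l, topRow N l')).2 ⊤ +
      (mult (σ (topRow N l, topRow N l')).1 ⊤ -
        mult (σ (topRow N l, topRow N l')).2 0) = l' + l := by
    have := (hσ 0).phi (topRow N l, topRow N l')
    change mult (σ (topRow N l, topRow N l')).2 (0 - 1) +
      (mult (σ (topRow N l, topRow N l')).1 (0 - 1) -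
        mult (σ (topRow N l, topRow N l')).2 0) =
      mult (topRow N l') (0 - 1) + (mult (topRow N l) (0 - 1) - mult (topRow N l') 0) at this
    rw [zero_sub_one, mult_topRow, mult_topRow, mult_topRow, if_pos rfl, if_pos rfl,
      if_neg (zero_ne_top hN)] at this
    exact this
  generalize σ (topRow N l, topRow N l') = y at *
  obtain ⟨c, d⟩ := y
  dsimp only at heps hphi
  obtain rfl : c = topRow N l' := eq_topRow fun j hj => by
    have := heps j hj
    omega
  rw [mult_topRow, if_pos rfl] at hphi
  have hs : mult d 0 + mult d ⊤ ≤ l := by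
    refine le_trans ?_ (sum_mult d).le
    rw [← Finset.sum_pair (zero_ne_top hN)]
    exact Finset.sum_le_sum_of_subset (Finset.subset_univ _)
  obtain rfl : d = topRow N l := eq_topRow fun j hj => by
    by_cases hj0 : j = 0
    · rw [hj0]; omega
    · have := heps j hj
      have hj1 : j - 1 ≠ ⊤ := by
        rw [← zero_sub_one]
        exact fun h => hj0 (sub_left_inj.1 h)
      rw [mult_topRow, mult_topRow, if_neg hj1] at this
      omega
  rfl

theorem rowSwap_top (hN : 2 ≤ N) (l l' : ℕ) :
    rowSwap (topRow N l, topRow N l') = (topRow N l', topRow N l) :=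
  rowHom_top hN (rowSwap_hom hN l l')

/-- No computation with the piecewise linear formula is needed: the composite is an endomorphism of
a connected crystal that fixes the top element. -/
theorem rowSwap_rowSwap (hN : 2 ≤ N) {l l' : ℕ} (x : Row N l × Row N l') :
    rowSwap (rowSwap x) = x := by
  have := rowHom_unique hN (σ := rowSwap ∘ rowSwap) (τ := id)
    (fun i => (rowSwap_hom hN l' l i).comp (rowSwap_hom hN l l' i)) (fun i => Hom.id)
    (by simp [rowSwap_top hN])
  exact congrFun this x

theorem rowSwap_isCrystalIso (hN : 2 ≤ N) (l l' : ℕ) :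
    IsCrystalIso (rowSwap : Row N l × Row N l' → Row N l' × Row N l) := by
  refine ⟨Function.bijective_iff_has_inverse.2 ⟨rowSwap, rowSwap_rowSwap hN, rowSwap_rowSwap hN⟩,
    fun i x => ⟨(rowSwap_hom hN l l' i).e_map x, (rowSwap_hom hN l l' i).f_map x⟩⟩

theorem crystalIso_eq (hN : 2 ≤ N) (l l' : ℕ) :
    (crystalIso : Row N l × Row N l' → Row N l' × Row N l) = rowSwap := by
  have h : IsCrystalIso (crystalIso : Row N l × Row N l' → Row N l' × Row N l) :=
    Classical.epsilon_spec (p := IsCrystalIso) ⟨_, rowSwap_isCrystalIso hN l l'⟩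
  have hom : ∀ i, Hom (rowTensor hN l l' i) (rowTensor hN l' l i) crystalIso :=
    fun i => Hom.of_commute (fun x => (h.2 i x).1) (fun x => (h.2 i x).2)
  exact rowHom_unique hN hom (rowSwap_hom hN l l') (by rw [rowHom_top hN hom, rowSwap_top hN])

/-- The explicit energy function. -/
def rowEnergy {l l' : ℕ} (x : Row N l × Row N l') : ℤ := -(tropQ (mult x.1) (mult x.2) ⊤ : ℤ)

theorem rowEnergy_top (l l' : ℕ) : rowEnergy (topRow N l, topRow N l') = 0 := by
  have h : ((window (mult (topRow N l)) (mult (topRow N l')) ⊤ (N - 1)).map Prod.fst).sum = 0 := by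
    refine List.sum_eq_zero fun a ha => ?_
    rw [window, List.map_map] at ha
    obtain ⟨t, ht, rfl⟩ := List.mem_map.1 ha
    rw [List.mem_range] at ht
    simp only [Function.comp]
    rw [mult_topRow, if_neg]
    intro h'
    rw [add_eq_left, ← zero_nsmul (1 : Fin N)] at h'
    exact nsmul_one_ne (by omega) (by omega) (by omega) h'
  simp only [rowEnergy]
  rw [tropQ_self, h]
  simp

theorem rowEnergy_of_ne_zero (hN : 2 ≤ N) {l l' : ℕ} {i : Fin N} (hi : i ≠ 0)
    {x y : Row N l × Row N l'} (h : (rowTensor hN l l' i).e x = some y) :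
    rowEnergy y = rowEnergy x := by
  rw [rowTensor_e_iff] at h
  simp only [rowEnergy]
  rw [h.tropQ_eq hN (sub_add_cancel i 1) (sub_one_ne hN i)]
  rw [← zero_sub_one]
  exact fun h => hi (sub_left_inj.1 h).symm

theorem rowEnergy_isEnergy (hN : 2 ≤ N) (l l' : ℕ) :
    IsEnergy (rowEnergy : Row N l × Row N l' → ℤ) := by
  refine ⟨rowEnergy_top l l', fun i x y hxy => ?_⟩
  rw [crystalIso_eq hN]
  rw [tensorE_eq hN] at hxy
  by_cases hi : i = 0
  · subst hi
    have := image_move hN (sub_add_cancel 0 1) (sub_one_ne hN 0) ((rowTensor_e_iff hN 0 x y).1 hxy)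
    obtain ⟨-, h1, h2, h3⟩ := this
    rw [zero_sub_one] at h1 h2 h3
    rw [← mult_rowSwap_fst, ← mult_rowSwap_snd] at h1 h2 h3
    have e1 : ∀ {m : ℕ} (b : Row N m), rowPhi 0 b = mult b ⊤ := fun b => by
      rw [← zero_sub_one]; rfl
    have e2 : ∀ {m : ℕ} (b : Row N m), rowEps 0 b = mult b 0 := fun b => rfl
    simp only [rowEnergy, e1, e2, true_and]
    refine ⟨fun h => ?_, fun h => ?_, fun h h' => ?_⟩
    · have := h1 h.1 h.2
      omega
    · have := h2 h.1 h.2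
      omega
    · rw [h3 h h']
  · refine ⟨fun h => absurd h.1 hi, fun h => absurd h.1 hi, fun _ _ => ?_⟩
    exact rowEnergy_of_ne_zero hN hi hxy

theorem energy_eq (hN : 2 ≤ N) (l l' : ℕ) :
    (energy : Row N l × Row N l' → ℤ) = rowEnergy := by
  have h : IsEnergy (energy : Row N l × Row N l' → ℤ) :=
    Classical.epsilon_spec (p := IsEnergy) ⟨_, rowEnergy_isEnergy hN l l'⟩
  have h' := rowEnergy_isEnergy hN l l'
  funext x
  refine rowTensor_connected hN (P := fun x => energy x = rowEnergy x) (fun i x y hxy => ?_)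
    (h.1.trans h'.1.symm) x
  obtain ⟨a1, a2, a3⟩ := h.2 i x y hxy
  obtain ⟨b1, b2, b3⟩ := h'.2 i x y hxy
  by_cases c1 : i = 0 ∧ rowEps 0 x.2 ≤ rowPhi 0 x.1 ∧
      rowEps 0 (crystalIso x).2 ≤ rowPhi 0 (crystalIso x).1
  · rw [a1 c1, b1 c1]; omega
  · by_cases c2 : i = 0 ∧ rowPhi 0 x.1 < rowEps 0 x.2 ∧
      rowPhi 0 (crystalIso x).1 < rowEps 0 (crystalIso x).2
    · rw [a2 c2, b2 c2]; omega
    · rw [a3 c1 c2, b3 c1 c2]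

end connected

/-- For `N = 1` and different lengths the energy vanishes. -/
theorem energy_eq_zero_of_one {l l' : ℕ} (h : l' < l) (x : Row 1 l × Row 1 l') : energy x = 0 := by
  have sub : ∀ {m : ℕ} (b b' : Row 1 m), b = b' := fun b b' =>
    row_ext fun j => by
      have h1 := sum_count b
      have h2 := sum_count b'
      rw [Fin.sum_univ_one] at h1 h2
      rw [Subsingleton.elim j 0, h1, h2]
  have cnt : ∀ {m : ℕ} (b : Row 1 m) (j : Fin 1), b.1.count j = m := fun b j => by
    have h1 := sum_count b
    rw [Fin.sum_univ_one] at h1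
    rw [Subsingleton.elim j 0, h1]
  have hE : IsEnergy (energy : Row 1 l × Row 1 l' → ℤ) := by
    -- With a single letter every count is the full length, whatever `crystalIso` is. The two
    -- exceptional cases would need `l ≤ l'` and `l < l'` respectively, so the zero function
    -- qualifies.
    refine Classical.epsilon_spec (p := IsEnergy) ⟨fun _ => 0, rfl, fun i x y _ => ⟨?_, ?_, ?_⟩⟩
    · rintro ⟨-, -, h3⟩
      rw [rowEps, rowPhi, cnt, cnt] at h3
      omega
    · rintro ⟨-, h3, -⟩
      rw [rowEps, rowPhi, cnt, cnt] at h3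
      omega
    · exact fun _ _ => rfl
  rw [← hE.1]
  exact congrArg _ (Prod.ext (sub _ _) (sub _ _))

end BoxBall

namespace BoxBall
open ColorCrystal

/-! ### The isomorphism `B_l ⊗ B_1 ≃ B_1 ⊗ B_l` -/

section letters

variable {N : ℕ} [NeZero N]

theorem mult_one {N : ℕ} (a j : Fin N) : mult (Sym.oneEquiv a) j = if j = a then 1 else 0 := by
  have : mult (Sym.oneEquiv a) j = ({a} : Multiset (Fin N)).count j := rfl
  rw [this, Multiset.count_singleton]

theorem eq_one_of_mult {N : ℕ} {c : Row N 1} {a : Fin N} (h : 0 < mult c a) : c = Sym.oneEquiv a := by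
  obtain ⟨d, rfl⟩ := Sym.oneEquiv.surjective c
  rw [mult_one] at h
  split_ifs at h with h1
  · rw [h1]
  · omega

theorem topRow_one : topRow N 1 = Sym.oneEquiv ⊤ :=
  eq_one_of_mult (by rw [mult_topRow, if_pos rfl]; omega)

/-- The letter leaving the carrier `u` when `b` enters. -/
noncomputable def outLetter {l : ℕ} (u : Row N l) (b : Fin N) : Fin N :=
  Sym.oneEquiv.symm (crystalIso (u, Sym.oneEquiv b)).1

/-- The carrier `u` after `b` has entered. -/
noncomputable def nextRow {l : ℕ} (u : Row N l) (b : Fin N) : Row N l :=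
  (crystalIso (u, Sym.oneEquiv b)).2

theorem rowSwap_one (hN : 2 ≤ N) {l : ℕ} (u : Row N l) (b : Fin N) :
    rowSwap (u, Sym.oneEquiv b) = (Sym.oneEquiv (outLetter u b), nextRow u b) := by
  rw [outLetter, nextRow, crystalIso_eq hN, Equiv.apply_symm_apply]

theorem mult_nextRow (hN : 2 ≤ N) {l : ℕ} (u : Row N l) (b j : Fin N) :
    mult (nextRow u b) j + (if j = outLetter u b then 1 else 0) =
      mult u j + (if j = b then 1 else 0) := by
  have := rowSwap_weight (u, Sym.oneEquiv b) j
  rw [rowSwap_one hN] at this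
  simp only [mult_one] at this
  omega

/-- The leaving letter is the first letter of the carrier met on going cyclically down from `b - 1`,
with `b` itself tried last. Down to that letter `Q` stays zero, as it is zero at `b - 1` and can
grow only where the carrier has letters. So the first factor of the image has a positive
multiplicity there, and it consists of one letter. -/
theorem outLetter_eq (hN : 2 ≤ N) {l : ℕ} {u : Row N l} {b : Fin N} {T : ℕ} (hT : T < N)
    (h0 : ∀ t < T, mult u (b - (t + 1) • 1) = 0) (h1 : 0 < mult u (b - (T + 1) • 1)) :
    outLetter u b = b - (T + 1) • 1 := by
  set x := mult u
  set y := mult (Sym.oneEquiv b : Row N 1)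
  have hy : ∀ j, y j = if j = b then 1 else 0 := mult_one b
  have hQ : ∀ t ≤ T, tropQ x y (b - (t + 1) • 1) = 0 := by
    intro t ht
    induction t with
    | zero =>
      rw [zero_add, one_nsmul, tropQ_pred]
      have : ((window x y b (N - 1)).map Prod.snd).sum = 0 := by
        refine List.sum_eq_zero fun a ha => ?_
        rw [window, List.map_map] at ha
        obtain ⟨t, ht, rfl⟩ := List.mem_map.1 ha
        rw [List.mem_range] at ht
        simp only [Function.comp]
        rw [hy, if_neg]
        intro h'
        rw [add_eq_left, ← zero_nsmul (1 : Fin N)] at h'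
        exact nsmul_one_ne (by omega) (by omega) (by omega) h'
      omega
    | succ t ih =>
      have := tropQ_pred_le x y (b - (t + 1) • 1)
      rw [ih (by omega), h0 t (by omega)] at this
      rw [succ_nsmul _ (t + 1), ← sub_sub]
      omega
  set a := b - (T + 1) • (1 : Fin N) with ha
  have hba : a + (T + 1) • 1 = b := sub_add_cancel _ _
  have key : 0 < imageFst x y a := by
    rw [imageFst, hQ T le_rfl]
    by_cases hab : a = b
    · rw [hy, if_pos hab]
      omega
    · have hT' : T + 1 < N := by
        by_contra hcon
        have : T + 1 = N := by omega
        rw [this, card_nsmul_one, add_zero] at hba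
        exact hab hba
      have hs : 0 < ((window x y a (N - 1)).map Prod.snd).sum := by
        refine Nat.lt_of_lt_of_le Nat.one_pos (List.le_sum_of_mem ?_)
        rw [window, List.map_map, List.mem_map]
        refine ⟨T, List.mem_range.2 (by omega), ?_⟩
        simp only [Function.comp]
        rw [hba, hy, if_pos rfl]
      rw [tropQ_pred]
      omega
  have h2 := mult_rowSwap_fst (u, Sym.oneEquiv b)
  rw [rowSwap_one hN] at h2
  have h3 := congrFun h2 a
  change mult (Sym.oneEquiv (outLetter u b)) a = imageFst x y a at h3
  rw [mult_one] at h3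
  split_ifs at h3 with h4
  · exact h4.symm
  · omega

theorem val_sub_nsmul {b : Fin N} {t : ℕ} (h : t ≤ b.val) :
    (b - t • (1 : Fin N)).val = b.val - t := by
  have : b - t • (1 : Fin N) = (b.val - t) • 1 := by
    rw [sub_eq_iff_eq_add, ← add_nsmul, Nat.sub_add_cancel h, nsmul_val_one]
  rw [this, val_nsmul_one _ (by have := b.isLt; omega)]

theorem val_sub_nsmul' {b : Fin N} {t : ℕ} (h : b.val < t) (ht : t ≤ N) :
    (b - t • (1 : Fin N)).val = b.val + N - t := by
  have : b - t • (1 : Fin N) = (b.val + N - t) • 1 := by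
    rw [sub_eq_iff_eq_add, ← add_nsmul, Nat.sub_add_cancel (by omega), add_nsmul, card_nsmul_one,
      add_zero, nsmul_val_one]
  rw [this, val_nsmul_one _ (by omega)]

/-- If the carrier contains a letter below `b`, the largest such letter leaves. -/
theorem outLetter_of_lt (hN : 2 ≤ N) {l : ℕ} {u : Row N l} {a b : Fin N} (hab : a < b)
    (ha : 0 < mult u a) (h : ∀ c, a < c → c < b → mult u c = 0) : outLetter u b = a := by
  have hab' : a.val < b.val := hab
  have hb := b.isLt
  have e : b - (b.val - a.val - 1 + 1) • (1 : Fin N) = a := by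
    apply Fin.ext
    rw [val_sub_nsmul (by omega)]
    omega
  rw [outLetter_eq hN (T := b.val - a.val - 1) (by omega), e]
  · intro t ht
    apply h
    · rw [Fin.lt_def, val_sub_nsmul (by omega)]; omega
    · rw [Fin.lt_def, val_sub_nsmul (by omega)]; omega
  · rwa [e]

/-- If the carrier contains no letter below `b`, its largest letter leaves. -/
theorem outLetter_of_le (hN : 2 ≤ N) {l : ℕ} {u : Row N l} {a b : Fin N} 
    (ha : 0 < mult u a) (hb : ∀ c, c < b → mult u c = 0) (h : ∀ c, a < c → mult u c = 0) :
    outLetter u b = a := by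
  have hab : b.val ≤ a.val := by
    by_contra hcon
    have := hb a (by rw [Fin.lt_def]; omega)
    omega
  have ha' := a.isLt
  have e : b - (b.val + N - a.val - 1 + 1) • (1 : Fin N) = a := by
    apply Fin.ext
    rcases Nat.lt_or_ge b.val (b.val + N - a.val - 1 + 1) with h1 | h1
    · rw [val_sub_nsmul' h1 (by omega)]; omega
    · omega
  rw [outLetter_eq hN (T := b.val + N - a.val - 1) (by omega), e]
  · intro t ht
    rcases Nat.lt_or_ge b.val (t + 1) with h1 | h1
    · apply h
      rw [Fin.lt_def, val_sub_nsmul' h1 (by omega)]; omega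
    · apply hb
      rw [Fin.lt_def, val_sub_nsmul h1]; omega
  · rwa [e]

end letters

/-! ### The Yang–Baxter equation -/

section yangBaxter

variable {N : ℕ} [NeZero N]

/-- Rows consisting of `c` letters `1` and otherwise letters `N`. -/
def IsLow {l : ℕ} (c : ℕ) (b : Row N l) : Prop :=
  mult b 0 = c ∧ ∀ j, j ≠ 0 → j ≠ ⊤ → mult b j = 0

theorem IsLow.mult_top (hN : 2 ≤ N) {l c : ℕ} {b : Row N l} (h : IsLow c b) :
    mult b ⊤ + c = l := by
  rw [← h.1]
  refine Eq.trans ?_ (sum_mult b)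
  rw [add_comm, ← Finset.sum_pair (zero_ne_top hN)]
  refine Finset.sum_subset (Finset.subset_univ _) fun j _ hj => ?_
  simp only [Finset.mem_insert, Finset.mem_singleton, not_or] at hj
  exact h.2 j hj.1 hj.2

theorem IsLow.unique (hN : 2 ≤ N) {l c : ℕ} {b b' : Row N l} (h : IsLow c b) (h' : IsLow c b') :
    b = b' := by
  refine mult_injective (funext fun j => ?_)
  by_cases h0 : j = 0
  · rw [h0, h.1, h'.1]
  · by_cases h1 : j = ⊤
    · have := h.mult_top hN
      have := h'.mult_top hN
      rw [h1]
      omega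
    · rw [h.2 j h0 h1, h'.2 j h0 h1]

theorem isLow_topRow (hN : 2 ≤ N) (l : ℕ) : IsLow 0 (topRow N l) :=
  ⟨by rw [mult_topRow, if_neg (zero_ne_top hN)], fun j _ h => by rw [mult_topRow, if_neg h]⟩

/-- For `c ≤ a` the product has `ε_i = 0` for all `i ≠ ⊤`. So does its image, whose first factor is
then a top row; conservation of letters gives the second. -/
theorem rowSwap_top_low (hN : 2 ≤ N) {a l c : ℕ} {b : Row N l} (h : IsLow c b) (hc : c ≤ a) :
    (rowSwap (topRow N a, b)).1 = topRow N l ∧ IsLow c (rowSwap (topRow N a, b)).2 := by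
  have h1 : (rowSwap (topRow N a, b)).1 = topRow N l := by
    refine eq_topRow fun i hi => ?_
    have h2 := (rowSwap_hom hN a l i).eps (topRow N a, b)
    have h3 : (rowTensor hN a l i).eps (topRow N a, b) = 0 := by
      change mult (topRow N a) i + (mult b i - mult (topRow N a) (i - 1)) = 0
      rw [mult_topRow, if_neg hi]
      by_cases h0 : i = 0
      · rw [h0, zero_sub_one, mult_topRow, if_pos rfl, h.1]
        omega
      · rw [h.2 i h0 hi]
        omega
    rw [h3] at h2
    exact Nat.eq_zero_of_add_eq_zero_right h2
  have h2 : ∀ j, j ≠ ⊤ → mult (rowSwap (topRow N a, b)).2 j = mult b j := by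
    intro j hj
    have := rowSwap_weight (topRow N a, b) j
    rw [h1] at this
    simp only [mult_topRow, if_neg hj, zero_add] at this
    exact this
  exact ⟨h1, by rw [h2 0 (zero_ne_top hN), h.1], fun j h0 ht => by rw [h2 j ht, h.2 j h0 ht]⟩

theorem move_low_iff (hN : 2 ≤ N) {l c : ℕ} {b b' : Row N l} (h : IsLow (c + 1) b)
    (h' : IsLow c b') : (rowCrystal hN l 0).e b = some b' := by
  rw [rowCrystal_e_iff, zero_sub_one]
  have := h.mult_top hN
  have := h'.mult_top hN
  refine ⟨by rw [h.1]; omega, fun j => ?_⟩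
  by_cases h0 : j = 0
  · rw [h0, if_pos rfl, if_neg (zero_ne_top hN), h.1, h'.1]
  · rw [if_neg h0]
    by_cases h1 : j = ⊤
    · rw [h1, if_pos rfl]
      omega
    · rw [if_neg h1, h.2 j h0 h1, h'.2 j h0 h1]

theorem exists_low (hN : 2 ≤ N) {l c : ℕ} (hc : c ≤ l) : ∃ b : Row N l, IsLow c b := by
  induction c with
  | zero => exact ⟨_, isLow_topRow hN l⟩
  | succ c ih =>
    obtain ⟨b, hb⟩ := ih (by omega)
    have h1 := hb.mult_top hN
    have h2 : (rowCrystal hN l 0).phi b ≠ 0 := by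
      change mult b (0 - 1) ≠ 0
      rw [zero_sub_one]
      omega
    obtain ⟨b', hb'⟩ := (rowCrystal hN l 0).exists_f h2
    refine ⟨b', ?_, ?_⟩
    · have h3 := ((rowCrystal_e_iff hN 0 _ _).1 (((rowCrystal hN l 0).e_iff_f _ _).2 hb')).2 0
      rw [zero_sub_one, if_pos rfl, if_neg (zero_ne_top hN), hb.1] at h3
      omega
    · intro j h0 ht
      have h3 := ((rowCrystal_e_iff hN 0 _ _).1 (((rowCrystal hN l 0).e_iff_f _ _).2 hb')).2 j
      rw [zero_sub_one, if_neg ht, if_neg h0, hb.2 j h0 ht] at h3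
      omega

/-- One application of `e_0` turns the left row into a top row, where the image is known from
`rowSwap_top_low`; `f_0` leads back. -/
theorem rowSwap_low_low (hN : 2 ≤ N) {a l c : ℕ} {u : Row N a} {b : Row N l} (hu : IsLow 1 u)
    (hb : IsLow c b) (ha : c + 1 ≤ a) (hl : c + 1 ≤ l) :
    IsLow 1 (rowSwap (u, b)).1 ∧ IsLow c (rowSwap (u, b)).2 := by
  have e1 : (rowTensor hN a l 0).e (u, b) = some (topRow N a, b) := by
    refine tensor_e_left ?_ (move_low_iff hN hu (isLow_topRow hN a))
    change mult b 0 ≤ mult u (0 - 1)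
    have := hu.mult_top hN
    rw [zero_sub_one, hb.1]
    omega
  have e2 := (rowSwap_hom hN a l 0).e _ _ e1
  obtain ⟨h1, h2⟩ := rowSwap_top_low hN hb (by omega : c ≤ a)
  obtain ⟨w, hw⟩ := exists_low (l := l) hN (by omega : 1 ≤ l)
  have e3 : (rowTensor hN l a 0).e (w, (rowSwap (topRow N a, b)).2) =
      some (rowSwap (topRow N a, b)) := by
    have : rowSwap (topRow N a, b) = (topRow N l, (rowSwap (topRow N a, b)).2) :=
      Prod.ext h1 rfl
    rw [this]
    refine tensor_e_left ?_ (move_low_iff hN hw (isLow_topRow hN l))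
    change mult (rowSwap (topRow N a, b)).2 0 ≤ mult w (0 - 1)
    have := hw.mult_top hN
    rw [zero_sub_one, h2.1]
    omega
  have e4 := ((rowTensor hN l a 0).e_iff_f _ _).1 e2
  rw [((rowTensor hN l a 0).e_iff_f _ _).1 e3] at e4
  rw [← Option.some.inj e4]
  exact ⟨hw, h2⟩

theorem low_carrier_top (hN : 2 ≤ N) {l c : ℕ} {b : Row N l} (hb : IsLow (c + 1) b) :
    outLetter b ⊤ = 0 ∧ IsLow c (nextRow b ⊤) := by
  have h : outLetter b ⊤ = 0 :=
    outLetter_of_lt hN (lt_of_le_of_ne (Fin.zero_le _) (zero_ne_top hN)) (by rw [hb.1]; omega)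
      fun d h1 h2 => hb.2 d (ne_of_gt h1) (ne_of_lt h2)
  refine ⟨h, ?_, fun j h0 ht => ?_⟩
  · have := mult_nextRow hN b ⊤ 0
    rw [h, if_pos rfl, if_neg (zero_ne_top hN), hb.1] at this
    omega
  · have := mult_nextRow hN b ⊤ j
    rw [h, if_neg h0, if_neg ht, hb.2 j h0 ht] at this
    omega

theorem top_carrier_zero (hN : 2 ≤ N) {l : ℕ} (hl : 0 < l) :
    outLetter (topRow N l) 0 = ⊤ ∧ IsLow 1 (nextRow (topRow N l) 0) := by
  have h : outLetter (topRow N l) 0 = ⊤ :=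
    outLetter_of_le hN (by rw [mult_topRow, if_pos rfl]; exact hl)
      (fun c hc => absurd hc (not_lt.2 (Fin.zero_le _))) (fun c hc => absurd hc not_top_lt)
  refine ⟨h, ?_, fun j h0 ht => ?_⟩
  · have := mult_nextRow hN (topRow N l) 0 0
    rw [h, if_pos rfl, if_neg (zero_ne_top hN), (isLow_topRow hN l).1] at this
    omega
  · have := mult_nextRow hN (topRow N l) 0 j
    rw [h, if_neg h0, if_neg ht, (isLow_topRow hN l).2 j h0 ht] at this
    omega

/-- The tensor product of three rows. -/
abbrev rowTriple (hN : 2 ≤ N) (l₁ l₂ l₃ : ℕ) (i : Fin N) :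
    ColorCrystal (Row N l₁ × (Row N l₂ × Row N l₃)) :=
  tensor (rowCrystal hN l₁ i) (rowTensor hN l₂ l₃ i)

/-- Exchange of the first two factors. -/
def swapFst {l₁ l₂ l₃ : ℕ} (x : Row N l₁ × (Row N l₂ × Row N l₃)) :
    Row N l₂ × (Row N l₁ × Row N l₃) :=
  ((rowSwap (x.1, x.2.1)).1, ((rowSwap (x.1, x.2.1)).2, x.2.2))

/-- Exchange of the last two factors. -/
def swapSnd {l₁ l₂ l₃ : ℕ} (x : Row N l₁ × (Row N l₂ × Row N l₃)) :
    Row N l₁ × (Row N l₃ × Row N l₂) :=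
  (x.1, rowSwap x.2)

theorem swapSnd_hom (hN : 2 ≤ N) (l₁ l₂ l₃ : ℕ) (i : Fin N) :
    Hom (rowTriple hN l₁ l₂ l₃ i) (rowTriple hN l₁ l₃ l₂ i) swapSnd :=
  Hom.id.prodMap (rowSwap_hom hN l₂ l₃ i)

theorem swapFst_hom (hN : 2 ≤ N) (l₁ l₂ l₃ : ℕ) (i : Fin N) :
    Hom (rowTriple hN l₁ l₂ l₃ i) (rowTriple hN l₂ l₁ l₃ i) swapFst :=
  ((Hom.assoc _ _ _).comp ((rowSwap_hom hN l₁ l₂ i).prodMap Hom.id)).comp (Hom.assoc_symm _ _ _)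

/-- The same two sweeps as for two factors: the `f_i`, `i ≠ 0`, make the third factor a top row, and
then the `e_i`, `i ≠ ⊤`, act on the first two. They stop at `N^{l₁}` next to a row made of `1`s and
`N`s only, and these elements are left as base cases. -/
theorem rowTriple_connected (hN : 2 ≤ N) {l₁ l₂ l₃ : ℕ}
    {P : Row N l₁ × (Row N l₂ × Row N l₃) → Prop}
    (h : ∀ i x y, (rowTriple hN l₁ l₂ l₃ i).e x = some y → (P x ↔ P y))
    (h0 : ∀ c ≤ l₁, ∀ b, IsLow c b → P (topRow N l₁, (b, topRow N l₃)))
    (x : Row N l₁ × (Row N l₂ × Row N l₃)) : P x := by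
  refine f_induction (rowTriple hN l₁ l₂ l₃) {0}ᶜ
    (fun b => weightSum (fun j => N - j.val) b.1 +
      (weightSum (fun j => N - j.val) b.2.1 + weightSum (fun j => N - j.val) b.2.2))
    ?_ ?_ (fun i _ b b' hb hP => (h i _ _ hb).1 hP) x
  · intro i hi b b' hb
    have h3 := corank_lt hi
    rcases tensor_e_cases hb with ⟨_, h1, h2⟩ | ⟨_, h1, h2⟩
    · have := weightSum_e hN (fun j => N - j.val) h1
      rw [h2]
      omega
    · have := weightSum_tensor_e hN (fun j => N - j.val) h1
      rw [h2]
      omega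
  · rintro ⟨b1, b2, b3⟩ hb
    obtain rfl : b3 = topRow N l₃ := by
      refine eq_topRow fun j hj => ?_
      have := hb (j + 1) (by
        intro h'
        rw [Set.mem_singleton_iff, ← top_add_one] at h'
        exact hj (add_right_cancel h'))
      have : (rowCrystal hN l₃ (j + 1)).phi b3 = 0 :=
        Nat.eq_zero_of_add_eq_zero_right (Nat.eq_zero_of_add_eq_zero_right this)
      rw [← add_sub_cancel_right j 1]
      exact this
    clear hb
    refine e_induction (rowTensor hN l₁ l₂) {⊤}ᶜ
      (fun b => weightSum (fun j => (j + 1).val) b.1 + weightSum (fun j => (j + 1).val) b.2)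
      (P := fun b => P (b.1, (b.2, topRow N l₃))) ?_ ?_ ?_ (b1, b2)
    · intro i hi b b' hb
      have := weightSum_tensor_e hN (fun j => (j + 1).val) hb
      have := rank_lt hi
      omega
    · rintro ⟨b, b'⟩ hb
      have hb' : ∀ j, j ≠ ⊤ → mult b j + (mult b' j - mult b (j - 1)) = 0 := fun j hj => hb j hj
      obtain rfl : b = topRow N l₁ := eq_topRow fun j hj => by
        have := hb' j hj
        omega
      refine h0 (mult b' 0) ?_ b' ⟨rfl, fun j hj0 hj => ?_⟩
      · have := hb' 0 (zero_ne_top hN)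
        rw [zero_sub_one, mult_topRow, mult_topRow, if_pos rfl] at this
        omega
      · have := hb' j hj
        have hj1 : j - 1 ≠ ⊤ := fun h' => hj0 (sub_left_inj.1 (h'.trans zero_sub_one.symm))
        rw [mult_topRow, mult_topRow, if_neg hj, if_neg hj1] at this
        omega
    · intro i hi b b' hb hP
      refine (h i _ _ ((Hom.assoc _ _ _).e (b, topRow N l₃) (b', topRow N l₃)
        (tensor_e_left ?_ hb))).2 hP
      have : (rowCrystal hN l₃ i).eps (topRow N l₃) = 0 := by
        have := mult_topRow (N := N) l₃ i
        rwa [if_neg (show ¬ i = ⊤ from fun h => hi h)] at this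
      omega

/-- Both sides are morphisms of crystals, so it is enough to compare them on the base cases of
`rowTriple_connected`, where every exchange is explicit. A third factor of length one suffices,
because the states consist of single letters. -/
theorem yang_baxter (hN : 2 ≤ N) {l₁ l₂ : ℕ} (x : Row N l₁ × (Row N l₂ × Row N 1)) :
    swapFst (swapSnd (swapFst x)) = swapSnd (swapFst (swapSnd x)) := by
  have g1 : ∀ i, Hom (rowTriple hN l₁ l₂ 1 i) (rowTriple hN 1 l₂ l₁ i)
      (swapFst ∘ (swapSnd ∘ swapFst)) := fun i =>
    (swapFst_hom hN l₂ 1 l₁ i).comp ((swapSnd_hom hN l₂ l₁ 1 i).comp (swapFst_hom hN l₁ l₂ 1 i))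
  have g2 : ∀ i, Hom (rowTriple hN l₁ l₂ 1 i) (rowTriple hN 1 l₂ l₁ i)
      (swapSnd ∘ (swapFst ∘ swapSnd)) := fun i =>
    (swapSnd_hom hN 1 l₁ l₂ i).comp ((swapFst_hom hN l₁ 1 l₂ i).comp (swapSnd_hom hN l₁ l₂ 1 i))
  change (swapFst ∘ (swapSnd ∘ swapFst)) x = (swapSnd ∘ (swapFst ∘ swapSnd)) x
  refine rowTriple_connected hN
    (P := fun x => (swapFst ∘ (swapSnd ∘ swapFst)) x = (swapSnd ∘ (swapFst ∘ swapSnd)) x)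
    (fun i x y h => ⟨fun h' => ?_, fun h' => ?_⟩) ?_ x
  · have h1 := (g1 i).e _ _ h
    rw [h', (g2 i).e _ _ h] at h1
    exact (Option.some.inj h1).symm
  · have h := (ColorCrystal.e_iff_f _ _ _).1 h
    have h1 := (g1 i).f _ _ h
    rw [h', (g2 i).f _ _ h] at h1
    exact (Option.some.inj h1).symm
  · intro c hc b hb
    rcases c with _ | c
    · obtain rfl := hb.unique hN (isLow_topRow hN l₂)
      simp only [Function.comp, swapFst, swapSnd, rowSwap_top hN]
    · have hl : c + 1 ≤ l₂ := by
        have := hb.mult_top hN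
        omega
      obtain ⟨a1, a2⟩ := rowSwap_top_low hN hb hc
      have a3 : rowSwap (topRow N l₁, b) = (topRow N l₂, (rowSwap (topRow N l₁, b)).2) :=
        Prod.ext a1 rfl
      generalize (rowSwap (topRow N l₁, b)).2 = w at a2 a3
      obtain ⟨b1, b2⟩ := low_carrier_top hN a2
      obtain ⟨d1, d2⟩ := top_carrier_zero hN (by omega : 0 < l₂)
      obtain ⟨e1, e2⟩ := low_carrier_top hN hb
      obtain ⟨f1, f2⟩ := top_carrier_zero hN (by omega : 0 < l₁)
      obtain ⟨k1, k2⟩ := rowSwap_low_low hN f2 e2 hc hl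
      simp only [Function.comp, swapFst, swapSnd, topRow_one, a3, rowSwap_one hN, b1, d1, e1, f1]
      rw [← k1.unique hN d2, ← k2.unique hN b2]

end yangBaxter

end BoxBall

namespace BoxBall
open ColorCrystal

/-! ### The time evolutions -/

section evolution

variable {n : ℕ} [NeZero n]

theorem carrier_succ (l : ℕ) (p : ℕ → Fin n) (j : ℕ) :
    carrier l p (j + 1) = nextRow (carrier l p j) (p j) := rfl

theorem evolFin_apply (l : ℕ) (p : ℕ → Fin n) (j : ℕ) :
    evolFin l p j = outLetter (carrier l p j) (p j) := rfl

theorem rowSwap_carrier (hn : 2 ≤ n) (l : ℕ) (p : ℕ → Fin n) (j : ℕ) :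
    rowSwap (carrier l p j, Sym.oneEquiv (p j)) =
      (Sym.oneEquiv (evolFin l p j), carrier l p (j + 1)) :=
  rowSwap_one hn _ _

/-- Two carriers travel along the state one behind the other. At the left end both are top rows and
can be exchanged; the Yang–Baxter equation moves the exchange past each component, and there it
yields the same output letter. -/
theorem carrier_exchange (hn : 2 ≤ n) (k r : ℕ) (p : ℕ → Fin n) (j : ℕ) :
    rowSwap (carrier k (evolFin r p) j, carrier r p j) =
      (carrier r (evolFin k p) j, carrier k p j) ∧
    ∀ i < j, evolFin k (evolFin r p) i = evolFin r (evolFin k p) i := by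
  induction j with
  | zero => exact ⟨rowSwap_top hn k r, fun i hi => absurd hi (Nat.not_lt_zero i)⟩
  | succ j ih =>
    have h := yang_baxter hn
      (carrier k (evolFin r p) j, (carrier r p j, Sym.oneEquiv (p j)))
    simp only [swapFst, swapSnd, ih.1, rowSwap_carrier hn, Prod.mk.injEq,
      EmbeddingLike.apply_eq_iff_eq] at h
    refine ⟨h.2.symm, fun i hi => ?_⟩
    rcases Nat.lt_succ_iff_lt_or_eq.1 hi with hi | rfl
    · exact ih.2 i hi
    · exact h.1.symm

/-- The time evolutions commute. -/
theorem evolFin_comm (hn : 2 ≤ n) (k r : ℕ) (p : ℕ → Fin n) :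
    evolFin k (evolFin r p) = evolFin r (evolFin k p) :=
  funext fun j => (carrier_exchange hn k r p (j + 1)).2 j (Nat.lt_succ_self j)

theorem mult_le {n l : ℕ} (u : Row n l) (j : Fin n) : mult u j ≤ l :=
  (Finset.single_le_sum (f := mult u) (fun _ _ => Nat.zero_le _) (Finset.mem_univ j)).trans
    (sum_mult u).le

theorem eq_topRow_iff {l : ℕ} {u : Row n l} : u = topRow n l ↔ mult u ⊤ = l := by
  constructor
  · rintro rfl
    rw [mult_topRow, if_pos rfl]
  · intro h
    refine eq_topRow fun j hj => ?_
    have h1 : mult u j + mult u ⊤ ≤ l := by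
      refine le_trans ?_ (sum_mult u).le
      rw [← Finset.sum_pair hj]
      exact Finset.sum_le_sum_of_subset (Finset.subset_univ _)
    omega

theorem top_top (hn : 2 ≤ n) (l : ℕ) :
    outLetter (topRow n l) ⊤ = ⊤ ∧ nextRow (topRow n l) ⊤ = topRow n l := by
  have h := rowSwap_one hn (topRow n l) ⊤
  rw [← topRow_one, rowSwap_top hn, Prod.mk.injEq, topRow_one] at h
  exact ⟨(Sym.oneEquiv.injective h.1).symm, h.2.symm⟩

theorem exists_outLetter_lt {n l : ℕ} (u : Row n l) {b : Fin n}
    (h : ∃ c, c < b ∧ 0 < mult u c) :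
    ∃ a < b, 0 < mult u a ∧ (∀ c, a < c → c < b → mult u c = 0) := by
  classical
  obtain ⟨c, hc⟩ := h
  have hne : (Finset.univ.filter fun c => c < b ∧ 0 < mult u c).Nonempty :=
    ⟨c, Finset.mem_filter.2 ⟨Finset.mem_univ _, hc⟩⟩
  obtain ⟨h1, h2⟩ := (Finset.mem_filter.1 (Finset.max'_mem _ hne)).2
  refine ⟨_, h1, h2, fun c hc hcb => ?_⟩
  by_contra h0
  have hmem : c ∈ Finset.univ.filter fun c => c < b ∧ 0 < mult u c :=
    Finset.mem_filter.2 ⟨Finset.mem_univ _, hcb, Nat.pos_of_ne_zero h0⟩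
  have := Finset.le_max' _ c hmem
  exact absurd hc (not_lt.2 this)

theorem mult_top_nextRow_top (hn : 2 ≤ n) {l : ℕ} (u : Row n l) :
    mult (nextRow u ⊤) ⊤ = min l (mult u ⊤ + 1) := by
  by_cases h : u = topRow n l
  · rw [h, (top_top hn l).2, mult_topRow, if_pos rfl]
    omega
  · have h1 : mult u ⊤ ≠ l := fun h' => h (eq_topRow_iff.2 h')
    have h2 := mult_le u ⊤
    have h3 : ∃ c, c < ⊤ ∧ 0 < mult u c := by
      by_contra hcon
      push Not at hcon
      exact h (eq_topRow fun j hj => Nat.le_zero.1 (hcon j (lt_top_iff_ne_top.2 hj)))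
    obtain ⟨a, ha, ha', hmax⟩ := exists_outLetter_lt u h3
    have h4 := mult_nextRow hn u ⊤ ⊤
    rw [outLetter_of_lt hn ha ha' hmax, if_neg ha.ne', if_pos rfl] at h4
    omega

theorem mult_top_carrier (hn : 2 ≤ n) {l : ℕ} {p : ℕ → Fin n} {R : ℕ} (m : ℕ)
    (h : ∀ i, R ≤ i → i < R + m → p i = ⊤) :
    mult (carrier l p (R + m)) ⊤ = min l (mult (carrier l p R) ⊤ + m) := by
  induction m with
  | zero =>
    have := mult_le (carrier l p R) ⊤
    rw [add_zero]
    omega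
  | succ m ih =>
    rw [← add_assoc, carrier_succ, h (R + m) (by omega) (by omega), mult_top_nextRow_top hn,
      ih (fun i h1 h2 => h i h1 (by omega))]
    omega

theorem carrier_eq_top (hn : 2 ≤ n) {l : ℕ} {p : ℕ → Fin n} {R : ℕ} (h : ∀ i, R ≤ i → p i = ⊤)
    {j : ℕ} (hj : R + l ≤ j) : carrier l p j = topRow n l := by
  obtain ⟨m, rfl⟩ : ∃ m, j = R + m := ⟨j - R, by omega⟩
  rw [eq_topRow_iff, mult_top_carrier hn m fun i h1 _ => h i h1]
  omega

theorem carrier_eq_top_left (hn : 2 ≤ n) {l : ℕ} {p : ℕ → Fin n} {L : ℕ} (h : ∀ i < L, p i = ⊤)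
    {j : ℕ} (hj : j ≤ L) : carrier l p j = topRow n l := by
  induction j with
  | zero => rfl
  | succ j ih => rw [carrier_succ, ih (by omega), h j (by omega), (top_top hn l).2]

theorem evolFin_eq_top (hn : 2 ≤ n) {l : ℕ} {p : ℕ → Fin n} {R : ℕ} (h : ∀ i, R ≤ i → p i = ⊤)
    {j : ℕ} (hj : R + l ≤ j) : evolFin l p j = ⊤ := by
  rw [evolFin_apply, carrier_eq_top hn h hj, h j (by omega), (top_top hn l).1]

theorem evolFin_eq_top_left (hn : 2 ≤ n) {l : ℕ} {p : ℕ → Fin n} {L : ℕ} (h : ∀ i < L, p i = ⊤)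
    {j : ℕ} (hj : j < L) : evolFin l p j = ⊤ := by
  rw [evolFin_apply, carrier_eq_top_left hn h hj.le, h j hj, (top_top hn l).1]

/-- States with finitely many letters different from `n`. -/
def FinState (p : ℕ → Fin n) : Prop := ∃ R, ∀ i, R ≤ i → p i = ⊤

theorem FinState.evolFin (hn : 2 ≤ n) (l : ℕ) {p : ℕ → Fin n} (h : FinState p) :
    FinState (evolFin l p) := by
  obtain ⟨R, hR⟩ := h
  exact ⟨R + l, fun i hi => evolFin_eq_top hn hR hi⟩

/-- Far to the right both carriers are top rows again. From there the state is recovered component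
by component towards the left by inverting `rowSwap`. -/
theorem evolFin_injective (hn : 2 ≤ n) {l : ℕ} {p q : ℕ → Fin n} (hp : FinState p)
    (hq : FinState q) (h : evolFin l p = evolFin l q) : p = q := by
  obtain ⟨R, hR⟩ := hp
  obtain ⟨R', hR'⟩ := hq
  set J := max R R' + l
  have key : ∀ d ≤ J, carrier l p (J - d) = carrier l q (J - d) ∧
      ∀ i, J - d ≤ i → p i = q i := by
    intro d hd
    induction d with
    | zero =>
      refine ⟨?_, fun i hi => ?_⟩
      · rw [carrier_eq_top hn hR (by omega), carrier_eq_top hn hR' (by omega)]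
      · rw [hR i (by omega), hR' i (by omega)]
    | succ d ih =>
      obtain ⟨h1, h2⟩ := ih (by omega)
      have e : J - d = J - (d + 1) + 1 := by omega
      rw [e] at h1
      have h3 := rowSwap_carrier hn l p (J - (d + 1))
      rw [h1, h, ← rowSwap_carrier hn l q (J - (d + 1))] at h3
      have h4 := congrArg rowSwap h3
      rw [rowSwap_rowSwap hn, rowSwap_rowSwap hn, Prod.mk.injEq] at h4
      refine ⟨h4.1, fun i hi => ?_⟩
      rcases Nat.lt_or_ge i (J - d) with h5 | h5
      · obtain rfl : i = J - (d + 1) := by omega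
        exact Sym.oneEquiv.injective h4.2
      · exact h2 i h5
  funext i
  exact (key J le_rfl).2 i (by omega)

/-- The state that agrees with `p` before the component `a` and with `q` from there on. -/
def glue (a : ℕ) (p q : ℕ → Fin n) : ℕ → Fin n := fun i => if i < a then p i else q i

theorem carrier_congr {l : ℕ} {p q : ℕ → Fin n} {j : ℕ} (h : ∀ i < j, p i = q i) :
    carrier l p j = carrier l q j := by
  induction j with
  | zero => rfl
  | succ j ih => rw [carrier_succ, carrier_succ, ih fun i hi => h i (by omega), h j (by omega)]

/-- A carrier that is a top row at the cut is indistinguishable from a fresh one, so the two pieces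
evolve independently. -/
theorem evolFin_glue (hn : 2 ≤ n) {l a : ℕ} {p q : ℕ → Fin n} (hp : carrier l p a = topRow n l)
    (hq : ∀ i < a, q i = ⊤) : evolFin l (glue a p q) = glue a (evolFin l p) (evolFin l q) := by
  have h1 : ∀ j ≤ a, carrier l (glue a p q) j = carrier l p j := fun j hj =>
    carrier_congr fun i hi => if_pos (by omega)
  have h2 : ∀ m, carrier l (glue a p q) (a + m) = carrier l q (a + m) := by
    intro m
    induction m with
    | zero => rw [add_zero, h1 a le_rfl, hp, carrier_eq_top_left hn hq le_rfl]
    | succ m ih =>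
      have : glue a p q (a + m) = q (a + m) := if_neg (by omega)
      rw [← add_assoc, carrier_succ, carrier_succ, ih, this]
  funext j
  rcases Nat.lt_or_ge j a with h | h
  · have e1 : glue a p q j = p j := if_pos h
    have e2 : glue a (evolFin l p) (evolFin l q) j = evolFin l p j := if_pos h
    rw [e2, evolFin_apply, evolFin_apply, h1 j h.le, e1]
  · have e1 : glue a p q j = q j := if_neg (by omega)
    have e2 : glue a (evolFin l p) (evolFin l q) j = evolFin l q j := if_neg (by omega)
    obtain ⟨m, rfl⟩ : ∃ m, j = a + m := ⟨j - a, by omega⟩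
    rw [e2, evolFin_apply, evolFin_apply, h2 m, e1]

/-- Iterated evolution of a state composed of two pieces that stay apart. -/
theorem iterate_evolFin_glue (hn : 2 ≤ n) {l a R : ℕ} {p q : ℕ → Fin n}
    (hp : ∀ i, R ≤ i → p i = ⊤) (hq : ∀ i < a, q i = ⊤) (t : ℕ) (ha : R + t * l ≤ a) :
    (evolFin l)^[t] (glue a p q) = glue a ((evolFin l)^[t] p) ((evolFin l)^[t] q) ∧
      (∀ i, R + t * l ≤ i → (evolFin l)^[t] p i = ⊤) ∧ (∀ i < a, (evolFin l)^[t] q i = ⊤) := by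
  induction t with
  | zero => exact ⟨rfl, fun i hi => hp i (by omega), hq⟩
  | succ t ih =>
    rw [Nat.succ_mul] at ha
    obtain ⟨h1, h2, h3⟩ := ih (by omega)
    rw [Function.iterate_succ_apply', Function.iterate_succ_apply', Function.iterate_succ_apply',
      h1]
    refine ⟨evolFin_glue hn (carrier_eq_top hn h2 (by omega)) h3, fun i hi => ?_, fun i hi => ?_⟩
    · rw [Nat.succ_mul] at hi
      exact evolFin_eq_top hn h2 (by omega)
    · exact evolFin_eq_top_left hn h3 hi

/-- The number of letters different from `n` in the first `J` components. -/
def ballCount (p : ℕ → Fin n) (J : ℕ) : ℕ := ∑ i ∈ Finset.range J, if p i = ⊤ then 0 else 1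

/-- Conservation of letters: those that have been picked up but not yet put down are the `l - mult
(carrier l p J) ⊤` letters in the carrier. -/
theorem ballCount_evolFin (hn : 2 ≤ n) (l : ℕ) (p : ℕ → Fin n) (J : ℕ) :
    ballCount (evolFin l p) J + l = ballCount p J + mult (carrier l p J) ⊤ := by
  induction J with
  | zero =>
    have : mult (carrier l p 0) ⊤ = l := eq_topRow_iff.1 rfl
    rw [this]
    rfl
  | succ J ih =>
    have h := mult_nextRow hn (carrier l p J) (p J) ⊤
    rw [← carrier_succ, ← evolFin_apply] at h
    simp only [eq_comm (a := (⊤ : Fin n))] at h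
    simp only [ballCount, Finset.sum_range_succ] at ih ⊢
    split_ifs at h ⊢ <;> omega

theorem ballCount_evolFin_le (hn : 2 ≤ n) (l : ℕ) (p : ℕ → Fin n) (J : ℕ) :
    ballCount (evolFin l p) J ≤ ballCount p J := by
  have := ballCount_evolFin hn l p J
  have := mult_le (carrier l p J) ⊤
  omega

/-- Only the presence of a letter matters for the rule, not its multiplicity, so a further letter
`n` has no effect if there is one already. -/
theorem outLetter_add_top (hn : 2 ≤ n) {l : ℕ} {u : Row n l} {u' : Row n (l + 1)}
    (h : ∀ j, mult u' j = mult u j + if j = ⊤ then 1 else 0) (hu : 0 < mult u ⊤) (b : Fin n) :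
    outLetter u' b = outLetter u b := by
  by_cases hc : ∃ c, c < b ∧ 0 < mult u c
  · obtain ⟨a, hab, ha, hmax⟩ := exists_outLetter_lt u hc
    rw [outLetter_of_lt hn hab ha hmax]
    refine outLetter_of_lt hn hab (by rw [h]; omega) fun c h1 h2 => ?_
    rw [h, if_neg (ne_top_of_lt h2), hmax c h1 h2]
  · push Not at hc
    have hc' : ∀ c, c < b → mult u c = 0 := fun c hcb => Nat.le_zero.1 (hc c hcb)
    rw [outLetter_of_le hn hu hc' fun c hc => absurd hc not_top_lt]
    refine outLetter_of_le hn (by rw [h]; omega) (fun c hcb => ?_) fun c hc => absurd hc not_top_lt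
    rw [h, if_neg (ne_top_of_lt hcb), hc' c hcb]

/-- A carrier with more places than there are letters different from `n` always retains a letter
`n`; an additional place then holds a letter `n` forever. -/
theorem evolFin_succ_eq (hn : 2 ≤ n) {p : ℕ → Fin n} {m l : ℕ} (hp : ∀ J, ballCount p J ≤ m)
    (hl : m < l) : evolFin (l + 1) p = evolFin l p := by
  have load : ∀ J, 0 < mult (carrier l p J) ⊤ := by
    intro J
    have := ballCount_evolFin hn l p J
    have := hp J
    omega
  have key : ∀ J j, mult (carrier (l + 1) p J) j =
      mult (carrier l p J) j + if j = ⊤ then 1 else 0 := by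
    intro J
    induction J with
    | zero =>
      intro j
      change mult (topRow n (l + 1)) j = mult (topRow n l) j + _
      rw [mult_topRow, mult_topRow]
      split_ifs <;> rfl
    | succ J ih =>
      intro j
      have h1 := mult_nextRow hn (carrier l p J) (p J) j
      have h2 := mult_nextRow hn (carrier (l + 1) p J) (p J) j
      rw [outLetter_add_top hn ih (load J), ih] at h2
      rw [carrier_succ, carrier_succ]
      omega
  funext J
  exact outLetter_add_top hn (key J) (load J) (p J)

theorem evolLim_eq (hn : 2 ≤ n) {p : ℕ → Fin n} {m l : ℕ} (hp : ∀ J, ballCount p J ≤ m)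
    (hl : m < l) : evolLim p = evolFin l p := by
  have h : ∀ d, evolFin (m + 1 + d) p = evolFin (m + 1) p := by
    intro d
    induction d with
    | zero => rfl
    | succ d ih => rw [← add_assoc, evolFin_succ_eq hn hp (by omega), ih]
  have h' : ∀ k, m < k → evolFin k p = evolFin (m + 1) p := fun k hk => by
    obtain ⟨d, rfl⟩ : ∃ d, k = m + 1 + d := ⟨k - (m + 1), by omega⟩
    exact h d
  have hex : ∃ q : ℕ → Fin n, ∀ᶠ l in Filter.atTop, evolFin l p = q :=
    ⟨_, Filter.eventually_atTop.2 ⟨m + 1, fun k hk => h' k hk⟩⟩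
  have hs : ∀ᶠ l in Filter.atTop, evolFin l p = evolLim p := Classical.epsilon_spec hex
  obtain ⟨k, hk⟩ := Filter.eventually_atTop.1 hs
  rw [← hk (max k l) (le_max_left _ _), h' l hl, h' _ (lt_of_lt_of_le hl (le_max_right _ _))]

/-- The prefix counts do not increase in time, so one finite capacity replaces `r = ∞` at all times.
-/
theorem iterate_evol_top (hn : 2 ≤ n) {p : ℕ → Fin n} {m l : ℕ} (hp : ∀ J, ballCount p J ≤ m)
    (hl : m < l) (t : ℕ) : (evol ⊤)^[t] p = (evolFin l)^[t] p := by
  induction t generalizing p with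
  | zero => rfl
  | succ t ih =>
    rw [Function.iterate_succ_apply, Function.iterate_succ_apply]
    have : evol ⊤ p = evolFin l p := evolLim_eq hn hp hl
    rw [this, ih fun J => (ballCount_evolFin_le hn l p J).trans (hp J)]

theorem FinState.exists_ballCount_le {p : ℕ → Fin n} (h : FinState p) :
    ∃ m, ∀ J, ballCount p J ≤ m := by
  obtain ⟨R, hR⟩ := h
  refine ⟨R, fun J => ?_⟩
  have h1 : ballCount p J ≤ ∑ i ∈ Finset.range J, if i < R then 1 else 0 :=
    Finset.sum_le_sum fun i _ => by
      by_cases h : i < R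
      · rw [if_pos h]; split_ifs <;> omega
      · rw [hR i (by omega), if_pos rfl]; exact Nat.zero_le _
  refine h1.trans ?_
  rw [Finset.sum_boole, Nat.cast_id]
  refine (Finset.card_le_card (t := Finset.range R) fun i hi => ?_).trans (Finset.card_range R).le
  exact Finset.mem_range.2 (Finset.mem_filter.1 hi).2

end evolution

end BoxBall

namespace BoxBall
open ColorCrystal

/-! ### Crystals of words -/

namespace ColorCrystal

variable {A : Type*}

/-- `ε` of a word. -/
def listEps (X : ColorCrystal A) : List A → ℕ
  | [] => 0
  | a :: w => X.eps a + (listEps X w - X.phi a)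

/-- `φ` of a word. -/
def listPhi (X : ColorCrystal A) : List A → ℕ
  | [] => 0
  | a :: w => listPhi X w + (X.phi a - listEps X w)

/-- The operator `e` on words. -/
def listE (X : ColorCrystal A) : List A → Option (List A)
  | [] => none
  | a :: w => if listEps X w ≤ X.phi a then (X.e a).map fun a' => a' :: w
    else (listE X w).map fun w' => a :: w'

/-- The operator `f` on words. -/
def listF (X : ColorCrystal A) : List A → Option (List A)
  | [] => none
  | a :: w => if listEps X w < X.phi a then (X.f a).map fun a' => a' :: w
    else (listF X w).map fun w' => a :: w'

theorem listE_cases {X : ColorCrystal A} {a : A} {w v : List A} (h : listE X (a :: w) = some v) :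
    (listEps X w ≤ X.phi a ∧ ∃ a', X.e a = some a' ∧ v = a' :: w) ∨
      (X.phi a < listEps X w ∧ ∃ w', listE X w = some w' ∧ v = a :: w') := by
  rw [listE] at h
  split_ifs at h with h1 <;> simp only [Option.map_eq_some_iff] at h
  · obtain ⟨c, hc, rfl⟩ := h
    exact Or.inl ⟨h1, c, hc, rfl⟩
  · obtain ⟨c, hc, rfl⟩ := h
    exact Or.inr ⟨not_le.1 h1, c, hc, rfl⟩

theorem listE_left {X : ColorCrystal A} {a a' : A} {w : List A} (h : listEps X w ≤ X.phi a)
    (h' : X.e a = some a') : listE X (a :: w) = some (a' :: w) := by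
  rw [listE, if_pos h, h']; rfl

theorem listE_right {X : ColorCrystal A} {a : A} {w w' : List A} (h : X.phi a < listEps X w)
    (h' : listE X w = some w') : listE X (a :: w) = some (a :: w') := by
  rw [listE, if_neg (not_le.2 h), h']; rfl

theorem listE_eps_phi (X : ColorCrystal A) {w w' : List A} (h : listE X w = some w') :
    listEps X w = listEps X w' + 1 ∧ listPhi X w' = listPhi X w + 1 := by
  induction w generalizing w' with
  | nil => exact absurd h (Option.some_ne_none _).symm
  | cons a w ih =>
    rcases listE_cases h with ⟨h1, a', h2, rfl⟩ | ⟨h1, v, h2, rfl⟩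
    · have := X.eps_of_e _ _ h2
      have := X.phi_of_e _ _ h2
      simp only [listEps, listPhi]
      omega
    · have := ih h2
      simp only [listEps, listPhi]
      omega

theorem listE_iff_listF (X : ColorCrystal A) (w w' : List A) :
    listE X w = some w' ↔ listF X w' = some w := by
  induction w generalizing w' with
  | nil =>
    refine ⟨fun h => absurd h (Option.some_ne_none _).symm, fun h => ?_⟩
    cases w' with
    | nil => exact absurd h (Option.some_ne_none _).symm
    | cons a w => rw [listF] at h; split_ifs at h <;> simp at h
  | cons a w ih =>
    constructor
    · intro h
      rcases listE_cases h with ⟨h1, a', h2, rfl⟩ | ⟨h1, v, h2, rfl⟩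
      · have := X.phi_of_e _ _ h2
        rw [listF, if_pos (by omega), (X.e_iff_f _ _).1 h2]
        rfl
      · have := listE_eps_phi X h2
        rw [listF, if_neg (by omega), (ih v).1 h2]
        rfl
    · intro h
      cases w' with
      | nil => exact absurd h (Option.some_ne_none _).symm
      | cons a' v =>
        rw [listF] at h
        split_ifs at h with h1
        · simp only [Option.map_eq_some_iff, List.cons.injEq] at h
          obtain ⟨c, hc, rfl, rfl⟩ := h
          have h2 := (X.e_iff_f _ _).2 hc
          have := X.phi_of_e _ _ h2
          exact listE_left (by omega) h2
        · simp only [Option.map_eq_some_iff, List.cons.injEq] at h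
          obtain ⟨c, hc, rfl, rfl⟩ := h
          have h2 := (ih v).2 hc
          have := listE_eps_phi X h2
          exact listE_right (by omega) h2

/-- The crystal of words. -/
def list (X : ColorCrystal A) : ColorCrystal (List A) where
  e := listE X
  f := listF X
  eps := listEps X
  phi := listPhi X
  e_iff_f := listE_iff_listF X
  eps_of_e _ _ h := (listE_eps_phi X h).1
  phi_of_e _ _ h := (listE_eps_phi X h).2
  e_none w := by
    induction w with
    | nil => simp [listE, listEps]
    | cons a w ih =>
      simp only [listE, listEps]
      split_ifs with h
      · rw [Option.map_eq_none_iff, X.e_none]; omega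
      · rw [Option.map_eq_none_iff, ih]; omega
  f_none w := by
    induction w with
    | nil => simp [listF, listPhi]
    | cons a w ih =>
      simp only [listF, listPhi]
      split_ifs with h
      · rw [Option.map_eq_none_iff, X.f_none]; omega
      · rw [Option.map_eq_none_iff, ih]; omega

theorem listE_length (X : ColorCrystal A) {w w' : List A} (h : listE X w = some w') :
    w'.length = w.length := by
  induction w generalizing w' with
  | nil => exact absurd h (Option.some_ne_none _).symm
  | cons a w ih =>
    rcases listE_cases h with ⟨h1, a', h2, rfl⟩ | ⟨h1, v, h2, rfl⟩
    · rfl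
    · rw [List.length_cons, List.length_cons, ih h2]

theorem list_append (X : ColorCrystal A) (u w : List A) :
    listEps X (u ++ w) = listEps X u + (listEps X w - listPhi X u) ∧
      listPhi X (u ++ w) = listPhi X w + (listPhi X u - listEps X w) := by
  induction u with
  | nil => simp [listEps, listPhi]
  | cons a u ih =>
    simp only [List.cons_append, listEps, listPhi, ih.1, ih.2]
    omega

theorem listE_append_left (X : ColorCrystal A) {u u' w : List A} (h : listEps X w ≤ listPhi X u)
    (h' : listE X u = some u') : listE X (u ++ w) = some (u' ++ w) := by
  induction u generalizing u' with
  | nil => exact absurd h' (Option.some_ne_none _).symm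
  | cons a u ih =>
    have ha := list_append X u w
    simp only [listPhi] at h
    rcases listE_cases h' with ⟨h1, a', h2, rfl⟩ | ⟨h1, v, h2, rfl⟩
    · exact listE_left (w := u ++ w) (by omega) h2
    · exact listE_right (w := u ++ w) (by omega) (ih (by omega) h2)

theorem listE_append_right (X : ColorCrystal A) {u w w' : List A} (h : listPhi X u < listEps X w)
    (h' : listE X w = some w') : listE X (u ++ w) = some (u ++ w') := by
  induction u with
  | nil => exact h'
  | cons a u ih =>
    have ha := list_append X u w
    simp only [listPhi] at h
    exact listE_right (w := u ++ w) (by omega) (ih (by omega))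

end ColorCrystal

section words

variable {n : ℕ} [NeZero n]

/-- The crystal of letters. -/
def letterCrystal (hn : 2 ≤ n) (i : Fin n) : ColorCrystal (Fin n) where
  e a := if a = i then some (i - 1) else none
  f a := if a = i - 1 then some i else none
  eps a := if a = i then 1 else 0
  phi a := if a = i - 1 then 1 else 0
  e_iff_f a b := by
    split_ifs <;> simp_all [eq_comm]
  eps_of_e a b := by
    have := sub_one_ne hn i
    intro h
    split_ifs at h with h1
    rw [if_pos h1, ← Option.some.inj h, if_neg this]
  phi_of_e a b := by
    have := sub_one_ne hn i
    intro h
    split_ifs at h with h1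
    rw [h1, if_neg this.symm, ← Option.some.inj h, if_pos rfl]
  e_none a := by split_ifs <;> simp_all
  f_none a := by split_ifs <;> simp_all

theorem oneEquiv_hom (hn : 2 ≤ n) (i : Fin n) :
    Hom (letterCrystal hn i) (rowCrystal hn 1 i) Sym.oneEquiv where
  e a b h := by
    change (if a = i then some (i - 1) else none) = some b at h
    split_ifs at h with ha
    rw [← Option.some.inj h, ha, rowCrystal_e_iff]
    have := sub_one_ne hn i
    refine ⟨by rw [mult_one, if_pos rfl]; omega, fun j => ?_⟩
    rw [mult_one, mult_one]
    omega
  eps a := (mult_one a i).trans (by simp [letterCrystal, eq_comm])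
  phi a := (mult_one a (i - 1)).trans (by simp [letterCrystal, eq_comm])

theorem oneEquiv_symm_hom (hn : 2 ≤ n) (i : Fin n) :
    Hom (rowCrystal hn 1 i) (letterCrystal hn i) Sym.oneEquiv.symm where
  e b b' h := by
    obtain ⟨a, rfl⟩ := Sym.oneEquiv.surjective b
    rw [(oneEquiv_hom hn i).e_map, Option.map_eq_some_iff] at h
    obtain ⟨a', h1, rfl⟩ := h
    rwa [Equiv.symm_apply_apply, Equiv.symm_apply_apply]
  eps b := by
    obtain ⟨a, rfl⟩ := Sym.oneEquiv.surjective b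
    rw [Equiv.symm_apply_apply, (oneEquiv_hom hn i).eps]
  phi b := by
    obtain ⟨a, rfl⟩ := Sym.oneEquiv.surjective b
    rw [Equiv.symm_apply_apply, (oneEquiv_hom hn i).phi]

theorem outLetter_hom (hn : 2 ≤ n) (l : ℕ) (i : Fin n) :
    Hom (tensor (rowCrystal hn l i) (letterCrystal hn i))
      (tensor (letterCrystal hn i) (rowCrystal hn l i))
      (fun x => (outLetter x.1 x.2, nextRow x.1 x.2)) := by
  have h := ((oneEquiv_symm_hom hn i).prodMap (Hom.id (X := rowCrystal hn l i))).comp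
    ((rowSwap_hom hn l 1 i).comp ((Hom.id (X := rowCrystal hn l i)).prodMap (oneEquiv_hom hn i)))
  convert h using 1
  funext x
  simp only [Function.comp, Prod.map, id, rowSwap_one hn, Equiv.symm_apply_apply]

/-- The carrier `u` passes through the word `w`. -/
noncomputable def passWord {l : ℕ} : Row n l → List (Fin n) → List (Fin n) × Row n l
  | u, [] => ([], u)
  | u, a :: w => (outLetter u a :: (passWord (nextRow u a) w).1, (passWord (nextRow u a) w).2)

/-- Together with `passWord_e` this says that passing a whole word is a morphism of crystals, being
a composite of exchanges with single letters. The induction is on the word, viewed as an iterated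
tensor product. -/
theorem passWord_eps_phi (hn : 2 ≤ n) {l : ℕ} (i : Fin n) (u : Row n l) (w : List (Fin n)) :
    (tensor (letterCrystal hn i).list (rowCrystal hn l i)).eps (passWord u w) =
      (tensor (rowCrystal hn l i) (letterCrystal hn i).list).eps (u, w) ∧
    (tensor (letterCrystal hn i).list (rowCrystal hn l i)).phi (passWord u w) =
      (tensor (rowCrystal hn l i) (letterCrystal hn i).list).phi (u, w) := by
  induction w generalizing u with
  | nil =>
    simp only [tensor_eps, tensor_phi, passWord, ColorCrystal.list, listEps, listPhi]
    omega
  | cons a w ih =>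
    have h1 := (outLetter_hom hn l i).eps (u, a)
    have h2 := (outLetter_hom hn l i).phi (u, a)
    obtain ⟨h3, h4⟩ := ih (nextRow u a)
    simp only [tensor_eps, tensor_phi, passWord, ColorCrystal.list, listEps, listPhi] at *
    -- Associativity of the tensor formulas for `ε` and `φ`: regroup, replace the first two factors,
    -- regroup back.
    have eps_assoc : ∀ x y z p q : ℕ,
        (x + (y - p)) + (z - (q + (p - y))) = x + ((y + (z - q)) - p) := by omega
    have phi_assoc : ∀ y z p q r : ℕ,
        r + ((q + (p - y)) - z) = (r + (q - z)) + (p - (y + (z - q))) := by omega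
    constructor
    · rw [eps_assoc, h3, ← eps_assoc, h1, h2, eps_assoc]
    · rw [phi_assoc, h3, h4, ← phi_assoc, h2, phi_assoc]

theorem passWord_e (hn : 2 ≤ n) {l : ℕ} (i : Fin n) {u u' : Row n l} {w w' : List (Fin n)}
    (h : (tensor (rowCrystal hn l i) (letterCrystal hn i).list).e (u, w) = some (u', w')) :
    (tensor (letterCrystal hn i).list (rowCrystal hn l i)).e (passWord u w) =
      some (passWord u' w') := by
  induction w generalizing u u' w' with
  | nil =>
    rcases tensor_e_cases h with ⟨_, h2, h3⟩ | ⟨_, h2, _⟩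
    · cases h3
      refine tensor_e_right ?_ h2
      exact Nat.pos_of_ne_zero (ColorCrystal.eps_ne_zero _ h2)
    · exact absurd h2 (Option.some_ne_none _).symm
  | cons a w ih =>
    obtain ⟨a', v, rfl⟩ : ∃ a' v, w' = a' :: v := by
      cases w' with
      | cons a' v => exact ⟨a', v, rfl⟩
      | nil =>
        rcases tensor_e_cases h with ⟨_, _, h3⟩ | ⟨_, h2, _⟩
        · exact absurd h3.symm (List.cons_ne_nil _ _)
        · exact absurd (listE_length _ h2) (by simp)
    have h1 : (tensor (rowCrystal hn l i) (tensor (letterCrystal hn i) (letterCrystal hn i).list)).e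
        (u, (a, w)) = some (u', (a', v)) := by
      rcases tensor_e_cases h with ⟨h1, h2, h3⟩ | ⟨h1, h2, h3⟩
      · cases h3
        exact tensor_e_left h1 h2
      · cases h3
        refine tensor_e_right h1 ?_
        rcases listE_cases h2 with ⟨h4, c, h5, h6⟩ | ⟨h4, c, h5, h6⟩
        · cases h6
          exact tensor_e_left h4 h5
        · cases h6
          exact tensor_e_right h4 h5
    have h2 := (((Hom.assoc _ _ _).comp ((outLetter_hom hn l i).prodMap
      (Hom.id (X := (letterCrystal hn i).list)))).comp (Hom.assoc_symm _ _ _)).e _ _ h1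
    have h3 := (passWord_eps_phi hn i (nextRow u a) w).1
    change (tensor (letterCrystal hn i) (tensor (rowCrystal hn l i) (letterCrystal hn i).list)).e
      (outLetter u a, (nextRow u a, w)) = some (outLetter u' a', (nextRow u' a', v)) at h2
    have h4 : (tensor (letterCrystal hn i) (tensor (letterCrystal hn i).list (rowCrystal hn l i))).e
        (outLetter u a, passWord (nextRow u a) w) =
          some (outLetter u' a', passWord (nextRow u' a') v) := by
      rcases tensor_e_cases h2 with ⟨h4, h5, h6⟩ | ⟨h4, h5, h6⟩
      · simp only [Prod.mk.injEq] at h6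
        rw [h6.1, h6.2]
        refine tensor_e_left ?_ h5
        rw [h3]
        exact h4
      · simp only at h6
        rw [h6]
        refine tensor_e_right ?_ (ih h5)
        rw [h3]
        exact h4
    have h5 := (Hom.assoc_symm _ _ _).e _ _ h4
    rcases tensor_e_cases h5 with ⟨h6, h7, h8⟩ | ⟨h6, h7, h8⟩
    · simp only at h8
      simp only [passWord]
      rw [h8]
      refine tensor_e_left h6 ?_
      rcases tensor_e_cases h7 with ⟨g1, g2, g3⟩ | ⟨g1, g2, g3⟩
      · simp only at g3
        rw [g3]
        exact listE_left g1 g2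
      · simp only at g3
        rw [g3]
        exact listE_right g1 g2
    · simp only [Prod.mk.injEq] at h8
      simp only [passWord]
      rw [h8.1, h8.2]
      exact tensor_e_right h6 h7

theorem passWord_append {l : ℕ} (u : Row n l) (w v : List (Fin n)) :
    passWord u (w ++ v) = ((passWord u w).1 ++ (passWord (passWord u w).2 v).1,
      (passWord (passWord u w).2 v).2) := by
  induction w generalizing u with
  | nil => rfl
  | cons a w ih => simp only [List.cons_append, passWord, ih]

/-- The first `J` letters of a state. -/
def statePrefix (p : ℕ → Fin n) (J : ℕ) : List (Fin n) := (List.range J).map p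

theorem passWord_statePrefix (l : ℕ) (p : ℕ → Fin n) (J : ℕ) :
    passWord (topRow n l) (statePrefix p J) = (statePrefix (evolFin l p) J, carrier l p J) := by
  induction J with
  | zero => rfl
  | succ J ih =>
    have : ∀ p : ℕ → Fin n, statePrefix p (J + 1) = statePrefix p J ++ [p J] := fun p => by
      simp [statePrefix, List.range_succ]
    rw [this, passWord_append, ih, this]
    rfl

/-- The operator `e_i` on states. -/
def StateE (hn : 2 ≤ n) (i : Fin n) (p p' : ℕ → Fin n) : Prop :=
  ∃ J₀, ∀ J, J₀ ≤ J → (letterCrystal hn i).listE (statePrefix p J) = some (statePrefix p' J)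

theorem statePrefix_injective {n : ℕ} {p p' : ℕ → Fin n} {J₀ : ℕ}
    (h : ∀ J, J₀ ≤ J → statePrefix p J = statePrefix p' J) : p = p' := by
  funext i
  have := h (max J₀ (i + 1)) (le_max_left _ _)
  exact List.map_inj_left.1 this i (List.mem_range.2 (by omega))

/-- The inverse `f_i` recovers a state from its image. This is how an evolution known for `e_i b` is
transferred back to `b`. -/
theorem StateE.left_unique {hn : 2 ≤ n} {i : Fin n} {p q p' : ℕ → Fin n} (h : StateE hn i p p')
    (h' : StateE hn i q p') : p = q := by
  obtain ⟨J, hJ⟩ := h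
  obtain ⟨J', hJ'⟩ := h'
  refine statePrefix_injective (J₀ := max J J') fun K hK => ?_
  have h1 := (listE_iff_listF _ _ _).1 (hJ K (by omega))
  rw [(listE_iff_listF _ _ _).1 (hJ' K (by omega))] at h1
  exact (Option.some.inj h1).symm

/-- The time evolution commutes with the operators of `sl_{n-1}`. -/
theorem StateE.evolFin {hn : 2 ≤ n} {i : Fin n} (h0 : i ≠ 0) (ht : i ≠ ⊤) {p p' : ℕ → Fin n}
    (h : StateE hn i p p') (hp : FinState p) (hp' : FinState p') (l : ℕ) :
    StateE hn i (evolFin l p) (evolFin l p') := by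
  obtain ⟨J, hJ⟩ := h
  obtain ⟨R, hR⟩ := hp
  obtain ⟨R', hR'⟩ := hp'
  -- For these colours neither letter involved is `n`, so a top row has `ε_i = φ_i = 0`. Vanishing
  -- `φ_i` makes `e_i` act on the word when the carrier enters; vanishing `ε_i` rules out that it
  -- acts on the carrier when it leaves.
  have heps : (rowCrystal hn l i).eps (topRow n l) = 0 := by
    have := mult_topRow (N := n) l i
    rwa [if_neg ht] at this
  have hphi : (rowCrystal hn l i).phi (topRow n l) = 0 := by
    have := mult_topRow (N := n) l (i - 1)
    rwa [if_neg (fun h' => h0 (sub_left_inj.1 (h'.trans zero_sub_one.symm)))] at this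
  refine ⟨max J (max (R + l) (R' + l)), fun K hK => ?_⟩
  have h1 := hJ K (by omega)
  have h2 : (tensor (rowCrystal hn l i) (letterCrystal hn i).list).e
      (topRow n l, statePrefix p K) = some (topRow n l, statePrefix p' K) := by
    refine tensor_e_right ?_ h1
    rw [hphi]
    exact Nat.pos_of_ne_zero ((letterCrystal hn i).list.eps_ne_zero h1)
  have h3 := passWord_e hn i h2
  rw [passWord_statePrefix, passWord_statePrefix, carrier_eq_top hn hR (by omega),
    carrier_eq_top hn hR' (by omega)] at h3
  rcases tensor_e_cases h3 with ⟨_, h4, _⟩ | ⟨_, h4, _⟩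
  · exact h4
  · exact absurd heps (ColorCrystal.eps_ne_zero _ h4)

theorem StateE.iterate {hn : 2 ≤ n} {i : Fin n} (h0 : i ≠ 0) (ht : i ≠ ⊤) {p p' : ℕ → Fin n}
    (h : StateE hn i p p') (hp : FinState p) (hp' : FinState p') (l t : ℕ) :
    StateE hn i ((BoxBall.evolFin l)^[t] p) ((BoxBall.evolFin l)^[t] p') := by
  induction t generalizing p p' with
  | zero => exact h
  | succ t ih => exact ih (h.evolFin h0 ht hp hp' l) (hp.evolFin hn l) (hp'.evolFin hn l)

/-- The state that starts with the word `w`. -/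
def ofWord (w : List (Fin n)) : ℕ → Fin n := fun i => w.getD i ⊤

theorem ofWord_finState (w : List (Fin n)) : FinState (ofWord w) :=
  ⟨w.length, fun _ hi => List.getD_eq_default _ _ hi⟩

theorem statePrefix_ofWord (w : List (Fin n)) {J : ℕ} (hJ : w.length ≤ J) :
    statePrefix (ofWord w) J = w ++ List.replicate (J - w.length) ⊤ := by
  refine List.ext_getElem (by simp [statePrefix]; omega) fun i h1 h2 => ?_
  simp only [statePrefix, List.getElem_map, List.getElem_range, ofWord]
  rcases Nat.lt_or_ge i w.length with h | h
  · rw [List.getElem_append_left h, List.getD_eq_getElem _ _ h]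
  · rw [List.getElem_append_right h, List.getElem_replicate, List.getD_eq_default _ _ h]

theorem list_eps_phi_replicate_top (hn : 2 ≤ n) {i : Fin n} (h0 : i ≠ 0) (ht : i ≠ ⊤) (m : ℕ) :
    (letterCrystal hn i).listEps (List.replicate m ⊤) = 0 ∧
      (letterCrystal hn i).listPhi (List.replicate m ⊤) = 0 := by
  have h1 : (letterCrystal hn i).eps ⊤ = 0 := if_neg ht.symm
  have h2 : (letterCrystal hn i).phi ⊤ = 0 :=
    if_neg fun h' => h0 (sub_left_inj.1 (h'.symm.trans zero_sub_one.symm))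
  induction m with
  | zero => exact ⟨rfl, rfl⟩
  | succ m ih => simp only [List.replicate_succ, listEps, listPhi, h1, h2, ih, and_self]

theorem StateE.ofWord {hn : 2 ≤ n} {i : Fin n} (h0 : i ≠ 0) (ht : i ≠ ⊤) {w w' : List (Fin n)}
    (h : (letterCrystal hn i).listE w = some w') : StateE hn i (ofWord w) (ofWord w') := by
  refine ⟨w.length, fun J hJ => ?_⟩
  have hl := listE_length _ h
  rw [statePrefix_ofWord w hJ, statePrefix_ofWord w' (by omega), hl]
  refine listE_append_left _ ?_ h
  rw [(list_eps_phi_replicate_top hn h0 ht _).1]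
  exact Nat.zero_le _

/-- A letter `i - 1` cancels only against a later letter `i`, which a decreasing word does not have.
Hence the word of a soliton behaves like the row of its label. -/
theorem list_of_decreasing (hn : 2 ≤ n) {i : Fin n} (h0 : i ≠ 0) {w : List (Fin n)}
    (hw : w.Pairwise (· ≥ ·)) : (letterCrystal hn i).listEps w = w.count i ∧
      (letterCrystal hn i).listPhi w = w.count (i - 1) := by
  have hlt : i - 1 < i := by
    rw [Fin.lt_def]
    have := val_sub_one_of_ne h0
    omega
  induction w with
  | nil => exact ⟨rfl, rfl⟩
  | cons a w ih =>
    obtain ⟨h1, h2⟩ := List.pairwise_cons.1 hw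
    obtain ⟨h3, h4⟩ := ih h2
    have e1 : (letterCrystal hn i).eps a = if a = i then 1 else 0 := rfl
    have e2 : (letterCrystal hn i).phi a = if a = i - 1 then 1 else 0 := rfl
    have h5 : a = i - 1 → w.count i = 0 := by
      rintro rfl
      exact List.count_eq_zero.2 fun h => absurd (h1 i h) (not_le.2 hlt)
    simp only [listEps, listPhi, h3, h4, e1, e2, List.count_cons, beq_iff_eq]
    by_cases ha : a = i - 1
    · rw [if_pos ha, if_neg (by rw [ha]; exact hlt.ne), h5 ha]
      omega
    · rw [if_neg ha]
      omega

/-- The operator changes the last letter `i` of the word, which keeps it decreasing. -/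
theorem listE_of_decreasing (hn : 2 ≤ n) {i : Fin n} (h0 : i ≠ 0) {w : List (Fin n)}
    (hw : w.Pairwise (· ≥ ·)) (hi : i ∈ w) : ∃ w', (letterCrystal hn i).listE w = some w' ∧
      w'.Pairwise (· ≥ ·) ∧ (w' : Multiset (Fin n)) = (i - 1) ::ₘ (w : Multiset (Fin n)).erase i := by
  have hlt : i - 1 < i := by
    rw [Fin.lt_def]
    have := val_sub_one_of_ne h0
    omega
  induction w with
  | nil => exact absurd hi List.not_mem_nil
  | cons a w ih =>
    obtain ⟨h1, h2⟩ := List.pairwise_cons.1 hw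
    obtain ⟨h3, h4⟩ := list_of_decreasing hn h0 h2
    have e2 : (letterCrystal hn i).phi a = if a = i - 1 then 1 else 0 := rfl
    by_cases hiw : i ∈ w
    · obtain ⟨w', g1, g2, g3⟩ := ih h2 hiw
      have ha : a ≠ i - 1 := by
        rintro rfl
        exact absurd (h1 i hiw) (not_le.2 hlt)
      refine ⟨a :: w', listE_right ?_ g1, List.pairwise_cons.2 ⟨fun c hc => ?_, g2⟩, ?_⟩
      · rw [e2, if_neg ha, h3]
        exact List.count_pos_iff.2 hiw
      · have hc' : c ∈ (w' : Multiset (Fin n)) := hc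
        rw [g3, Multiset.mem_cons] at hc'
        rcases hc' with rfl | hc'
        · exact hlt.le.trans (h1 i hiw)
        · exact h1 c (Multiset.mem_of_mem_erase hc')
      · rw [← Multiset.cons_coe, g3, ← Multiset.cons_coe, Multiset.cons_swap]
        by_cases hai : a = i
        · rw [hai, Multiset.erase_cons_head, Multiset.cons_erase (Multiset.mem_coe.2 hiw)]
        · rw [Multiset.erase_cons_tail _ hai]
    · have hai : a = i := by
        rcases List.mem_cons.1 hi with h | h
        · exact h.symm
        · exact absurd h hiw
      subst hai
      refine ⟨(a - 1) :: w, listE_left ?_ (if_pos rfl), List.pairwise_cons.2 ⟨fun c hc => ?_, h2⟩, ?_⟩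
      · rw [h3, List.count_eq_zero.2 hiw]
        exact Nat.zero_le _
      · have hca : c ≠ a := fun h => hiw (h ▸ hc)
        have := lt_of_le_of_ne (h1 c hc) hca
        rw [ge_iff_le, Fin.le_def]
        rw [Fin.lt_def] at this
        have := val_sub_one_of_ne h0
        omega
      · rw [← Multiset.cons_coe, ← Multiset.cons_coe, Multiset.erase_cons_head]

end words

/-! ### Words of solitons -/

section labels

variable {N : ℕ}

/-- The decreasing word of a row, in the alphabet with one more letter. -/
def rowWord {l : ℕ} (b : Row N l) : List (Fin (N + 1)) := (b.1.sort (· ≥ ·)).map Fin.castSucc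

theorem rowWord_coe {l : ℕ} (b : Row N l) :
    (rowWord b : Multiset (Fin (N + 1))) = b.1.map Fin.castSucc := by
  rw [rowWord, ← Multiset.map_coe, Multiset.sort_eq]

theorem rowWord_pairwise {l : ℕ} (b : Row N l) : (rowWord b).Pairwise (· ≥ ·) :=
  List.Pairwise.map _ (fun _ _ h => h) (Multiset.pairwise_sort b.1 (· ≥ ·))

theorem rowWord_length {l : ℕ} (b : Row N l) : (rowWord b).length = l := by
  rw [rowWord, List.length_map, Multiset.length_sort]
  exact b.2

theorem eq_rowWord {l : ℕ} {b : Row N l} {w : List (Fin (N + 1))} (hw : w.Pairwise (· ≥ ·))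
    (h : (w : Multiset (Fin (N + 1))) = b.1.map Fin.castSucc) : w = rowWord b := by
  rw [← rowWord_coe, Multiset.coe_eq_coe] at h
  exact h.eq_of_pairwise (fun _ _ _ _ h1 h2 => le_antisymm h2 h1) hw (rowWord_pairwise b)

variable [NeZero N]

theorem castSucc_ne_zero_of_ne {i : Fin N} (hi : i ≠ 0) : i.castSucc ≠ 0 := by
  intro h
  have := congrArg Fin.val h
  rw [Fin.val_castSucc, Fin.val_zero] at this
  exact hi (Fin.ext this)

theorem castSucc_sub_one {i : Fin N} (hi : i ≠ 0) : (i - 1).castSucc = i.castSucc - 1 := by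
  apply Fin.ext
  have h1 := val_sub_one_of_ne hi
  have h2 : i.castSucc ≠ 0 := castSucc_ne_zero_of_ne hi
  have h3 := val_sub_one_of_ne h2
  simp only [Fin.val_castSucc] at *
  omega

theorem rowWord_eps_phi (hn : 2 ≤ N + 1) {l : ℕ} {i : Fin N} (hi : i ≠ 0) (b : Row N l) :
    (letterCrystal hn i.castSucc).listEps (rowWord b) = mult b i ∧
      (letterCrystal hn i.castSucc).listPhi (rowWord b) = mult b (i - 1) := by
  have h0 : i.castSucc ≠ 0 := castSucc_ne_zero_of_ne hi
  obtain ⟨h1, h2⟩ := list_of_decreasing hn h0 (rowWord_pairwise b)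
  have hc : ∀ j : Fin N, (rowWord b).count j.castSucc = mult b j := fun j => by
    rw [← Multiset.coe_count, rowWord_coe, Multiset.count_map_eq_count' _ _
      (Fin.castSucc_injective N)]
    rfl
  rw [h1, h2, ← castSucc_sub_one hi, hc, hc]
  exact ⟨rfl, rfl⟩

theorem rowWord_e (hn : 2 ≤ N + 1) {l : ℕ} {i : Fin N} (hi : i ≠ 0) {b b' : Row N l}
    (h : rowE i b = some b') :
    (letterCrystal hn i.castSucc).listE (rowWord b) = some (rowWord b') := by
  have h0 : i.castSucc ≠ 0 := castSucc_ne_zero_of_ne hi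
  obtain ⟨h1, h2⟩ := replaceLetter_eq_some.1 h
  have hmem : i.castSucc ∈ rowWord b := by
    rw [← Multiset.mem_coe, rowWord_coe]
    exact Multiset.mem_map_of_mem _ h1
  obtain ⟨w', g1, g2, g3⟩ := listE_of_decreasing hn h0 (rowWord_pairwise b) hmem
  rw [g1, eq_rowWord (b := b') g2]
  rw [g3, rowWord_coe, h2, Multiset.map_cons, castSucc_sub_one hi,
    Multiset.map_erase _ (Fin.castSucc_injective N)]

end labels

end BoxBall

namespace BoxBall
open ColorCrystal

/-! ### Words with few letters passing through the carrier -/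

section blocks

variable {n : ℕ} [NeZero n]

/-- The row `u` consists of `p` letters `n`, `q` letters `c` and `s` letters `1`. -/
def IsBlock (c : Fin n) {l : ℕ} (p q s : ℕ) (u : Row n l) : Prop :=
  ∀ j, mult u j = (if j = ⊤ then p else 0) + (if j = c then q else 0) + (if j = 0 then s else 0)

/-- Passing through the word `w` changes `w` to `v` and the carrier as indicated. -/
def Pass (l : ℕ) (c : Fin n) (x : ℕ × ℕ × ℕ) (w v : List (Fin n)) (y : ℕ × ℕ × ℕ) : Prop :=
  ∀ u : Row n l, IsBlock c x.1 x.2.1 x.2.2 u →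
    (passWord u w).1 = v ∧ IsBlock c y.1 y.2.1 y.2.2 (passWord u w).2

theorem Pass.append {l : ℕ} {c : Fin n} {x y z : ℕ × ℕ × ℕ} {w w' v v' : List (Fin n)}
    (h : Pass l c x w v y) (h' : Pass l c y w' v' z) : Pass l c x (w ++ w') (v ++ v') z := by
  intro u hu
  obtain ⟨h1, h2⟩ := h u hu
  obtain ⟨h3, h4⟩ := h' _ h2
  rw [passWord_append]
  exact ⟨by rw [h1, h3], h4⟩

theorem Pass.nil (l : ℕ) (c : Fin n) (x : ℕ × ℕ × ℕ) : Pass l c x [] [] x :=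
  fun _ hu => ⟨rfl, hu⟩

theorem Pass.replicate {l : ℕ} {c a b : Fin n} {y z : ℕ × ℕ × ℕ} (m : ℕ) (x : ℕ → ℕ × ℕ × ℕ)
    (hy : x 0 = y) (hz : x m = z) (h : ∀ i < m, Pass l c (x i) [a] [b] (x (i + 1))) :
    Pass l c y (List.replicate m a) (List.replicate m b) z := by
  subst hy hz
  induction m with
  | zero => exact Pass.nil _ _ _
  | succ m ih =>
    rw [List.replicate_succ', List.replicate_succ']
    exact (ih fun i hi => h i (by omega)).append (h m (by omega))

theorem Pass.single (hn : 2 ≤ n) {l : ℕ} {c a b : Fin n} {x y : ℕ × ℕ × ℕ}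
    (h : ∀ u : Row n l, IsBlock c x.1 x.2.1 x.2.2 u → outLetter u a = b)
    (hxy : ∀ j, (if j = ⊤ then y.1 else 0) + (if j = c then y.2.1 else 0) +
      (if j = 0 then y.2.2 else 0) + (if j = b then 1 else 0) =
      (if j = ⊤ then x.1 else 0) + (if j = c then x.2.1 else 0) +
      (if j = 0 then x.2.2 else 0) + (if j = a then 1 else 0)) : Pass l c x [a] [b] y := by
  intro u hu
  refine ⟨by simp only [passWord, h u hu], fun j => ?_⟩
  have h1 := mult_nextRow hn u a j
  rw [h u hu, hu j, ← hxy j] at h1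
  exact Nat.add_right_cancel h1

/-- In the names of these lemmas the first word is the entering letter and the second the leaving
one, where `one` is `0`, `mid` is `c` and `top` is `⊤`. The triples count the letters `⊤`, `c`, `0`
in the carrier. -/
theorem pass_one_top (hn : 2 ≤ n) (l : ℕ) (c : Fin n) (p q s m : ℕ) : Pass l c (p + m, q, s) (List.replicate m 0)
    (List.replicate m ⊤) (p, q, s + m) := by
  refine Pass.replicate m (fun i => (p + m - i, q, s + i)) (by simp) (by simp) fun i hi => ?_
  refine Pass.single hn (fun u hu => ?_) fun j => ?_
  · refine outLetter_of_le hn ?_ (fun d hd => absurd hd (not_lt.2 (Fin.zero_le _)))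
      fun d hd => absurd hd not_top_lt
    rw [hu, if_pos rfl]
    dsimp only
    omega
  · dsimp only
    split_ifs <;> omega

/-- The condition on `c` is demanded only if `c` actually occurs, so that the case of two letters,
where nothing lies strictly between `0` and `⊤`, is covered. -/
theorem pass_one_mid (hn : 2 ≤ n) (l : ℕ) (c : Fin n) (q s m : ℕ) (hc : m ≠ 0 → 0 < c ∧ c < ⊤) : Pass l c (0, q + m, s)
    (List.replicate m 0) (List.replicate m c) (0, q, s + m) := by
  refine Pass.replicate m (fun i => (0, q + m - i, s + i)) (by simp) (by simp) fun i hi => ?_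
  obtain ⟨h1, h2⟩ := hc (by omega)
  refine Pass.single hn (fun u hu => ?_) fun j => ?_
  · refine outLetter_of_le hn ?_ (fun d hd => absurd hd (not_lt.2 (Fin.zero_le _)))
      fun d hd => ?_
    · rw [hu, if_pos rfl]
      dsimp only
      omega
    · rw [hu, if_neg hd.ne', if_neg (h1.trans hd).ne']
      simp
  · dsimp only
    split_ifs <;> omega

theorem pass_one_one (hn : 2 ≤ n) (l : ℕ) (c : Fin n) (s m : ℕ) : Pass l c (0, 0, s + 1)
    (List.replicate m 0) (List.replicate m 0) (0, 0, s + 1) := by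
  refine Pass.replicate m (fun _ => (0, 0, s + 1)) (by simp) (by simp) fun i hi => ?_
  refine Pass.single hn (fun u hu => ?_) fun j => rfl
  refine outLetter_of_le hn ?_ (fun d hd => absurd hd (not_lt.2 (Fin.zero_le _))) fun d hd => ?_
  · rw [hu, if_pos (rfl : (0 : Fin n) = 0)]
    dsimp only
    omega
  · rw [hu, if_neg (show d ≠ 0 from hd.ne')]
    simp

theorem pass_mid_one (hn : 2 ≤ n) (l : ℕ) (c : Fin n) (p q s m : ℕ) (hc : m ≠ 0 → 0 < c ∧ c < ⊤) : Pass l c (p, q, s + m)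
    (List.replicate m c) (List.replicate m 0) (p, q + m, s) := by
  refine Pass.replicate m (fun i => (p, q + i, s + m - i)) (by simp) (by simp) fun i hi => ?_
  obtain ⟨h1, h2⟩ := hc (by omega)
  refine Pass.single hn (fun u hu => ?_) fun j => ?_
  · refine outLetter_of_lt hn h1 ?_ fun d hd hd' => ?_
    · rw [hu, if_pos (rfl : (0 : Fin n) = 0)]
      dsimp only
      omega
    · rw [hu, if_neg (show d ≠ 0 from hd.ne'), if_neg hd'.ne, if_neg (hd'.trans h2).ne]
  · dsimp only
    split_ifs <;> omega

theorem pass_mid_top (hn : 2 ≤ n) (l : ℕ) (c : Fin n) (p q m : ℕ) (hc : m ≠ 0 → 0 < c ∧ c < ⊤) : Pass l c (p + m, q, 0)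
    (List.replicate m c) (List.replicate m ⊤) (p, q + m, 0) := by
  refine Pass.replicate m (fun i => (p + m - i, q + i, 0)) (by simp) (by simp) fun i hi => ?_
  obtain ⟨h1, h2⟩ := hc (by omega)
  refine Pass.single hn (fun u hu => ?_) fun j => ?_
  · refine outLetter_of_le hn ?_ (fun d hd => ?_) fun d hd => absurd hd not_top_lt
    · rw [hu, if_pos rfl]
      dsimp only
      omega
    · rw [hu, if_neg (hd.trans h2).ne, if_neg hd.ne]
      simp
  · dsimp only
    split_ifs <;> omega

theorem pass_top_mid (hn : 2 ≤ n) (l : ℕ) (c : Fin n) (p q s m : ℕ) (hc : m ≠ 0 → 0 < c ∧ c < ⊤) : Pass l c (p, q + m, s)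
    (List.replicate m ⊤) (List.replicate m c) (p + m, q, s) := by
  refine Pass.replicate m (fun i => (p + i, q + m - i, s)) (by simp) (by simp) fun i hi => ?_
  obtain ⟨h1, h2⟩ := hc (by omega)
  refine Pass.single hn (fun u hu => ?_) fun j => ?_
  · refine outLetter_of_lt hn h2 ?_ fun d hd hd' => ?_
    · rw [hu, if_pos (rfl : c = c)]
      dsimp only
      omega
    · rw [hu, if_neg hd'.ne, if_neg (h1.trans hd).ne', if_neg (show d ≠ c from hd.ne')]
  · dsimp only
    split_ifs <;> omega

theorem pass_top_one (hn : 2 ≤ n) (l : ℕ) (c : Fin n) (p s m : ℕ) : Pass l c (p, 0, s + m)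
    (List.replicate m ⊤) (List.replicate m 0) (p + m, 0, s) := by
  refine Pass.replicate m (fun i => (p + i, 0, s + m - i)) (by simp) (by simp) fun i hi => ?_
  refine Pass.single hn (fun u hu => ?_) fun j => ?_
  · refine outLetter_of_lt hn (lt_of_le_of_ne (Fin.zero_le _) (zero_ne_top hn)) ?_
      fun d hd hd' => ?_
    · rw [hu, if_pos (rfl : (0 : Fin n) = 0)]
      dsimp only
      omega
    · rw [hu, if_neg hd'.ne, if_neg (show d ≠ 0 from hd.ne')]
      simp
  · dsimp only
    split_ifs <;> omega

theorem isBlock_top_iff {l : ℕ} (c : Fin n) (u : Row n l) : IsBlock c l 0 0 u ↔ u = topRow n l := by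
  constructor
  · intro h
    exact mult_injective (funext fun j => by rw [h j, mult_topRow]; simp)
  · rintro rfl j
    rw [mult_topRow]
    simp

theorem pass_top_top (hn : 2 ≤ n) (l : ℕ) (c : Fin n) (m : ℕ) : Pass l c (l, 0, 0)
    (List.replicate m ⊤) (List.replicate m ⊤) (l, 0, 0) := by
  refine Pass.replicate m (fun i => (l, 0, 0)) (by simp) (by simp) fun i hi => ?_
  refine Pass.single hn (fun u hu => ?_) fun j => rfl
  rw [(isBlock_top_iff c u).1 hu]
  exact (top_top hn l).1

/-- Unloading the carrier. -/
theorem pass_tail (hn : 2 ≤ n) (l : ℕ) (c : Fin n) (k s j m : ℕ) (hs : 0 < s) (hc : k ≠ 0 → 0 < c ∧ c < ⊤) (hl : k + s = l) :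
    Pass l c (0, k, s) (List.replicate j 0 ++ List.replicate (l + m) ⊤)
      (List.replicate k c ++ (List.replicate (s + j) 0 ++ List.replicate m ⊤)) (l, 0, 0) := by
  subst hl
  -- The `j` letters `1` expel the letters `c`, the largest ones, first. Either some `c` remain for
  -- the letters `n` to pull out, or the surplus letters `1` just replace letters `1`; the output is
  -- the same.
  rcases Nat.le_total j k with hjk | hjk
  · obtain ⟨i, rfl⟩ := Nat.exists_eq_add_of_le hjk
    have h1 := pass_one_mid hn (j + i + s) c i s j fun h => hc (by omega)
    have h2 := pass_top_mid hn (j + i + s) c 0 0 (s + j) i fun h => hc (by omega)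
    have h3 := pass_top_one hn (j + i + s) c i 0 (s + j)
    have h4 := pass_top_top hn (j + i + s) c m
    rw [zero_add] at h2 h3
    rw [show i + (s + j) = j + i + s by omega] at h3
    rw [add_comm i j] at h1
    have := h1.append (h2.append (h3.append h4))
    convert this using 1
    · rw [← List.append_assoc (List.replicate i ⊤), ← List.replicate_add,
        ← List.replicate_add]
      congr 2
      omega
    · rw [← List.append_assoc (List.replicate j c), ← List.replicate_add]
  · obtain ⟨i, rfl⟩ := Nat.exists_eq_add_of_le hjk
    have h1 := pass_one_mid hn (k + s) c 0 s k hc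
    have h2 := pass_one_one hn (k + s) c (s + k - 1) i
    have h3 := pass_top_one hn (k + s) c 0 0 (k + s)
    have h4 := pass_top_top hn (k + s) c m
    rw [zero_add] at h1
    rw [zero_add] at h3
    rw [show s + k - 1 + 1 = k + s by omega] at h2
    rw [show s + k = k + s by omega] at h1
    have := h1.append (h2.append (h3.append h4))
    convert this using 1
    · rw [← List.append_assoc (List.replicate k 0), ← List.replicate_add,
        ← List.replicate_add]
    · rw [← List.append_assoc (List.replicate i 0), ← List.replicate_add]
      congr 3
      omega

end blocks

end BoxBall

namespace BoxBall
open ColorCrystal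

/-! ### Single time steps for two solitons with highest weight labels -/

section dynamics

variable {n : ℕ} [NeZero n]

/-- The intermediate loads need to agree only up to arithmetic identities. -/
theorem Pass.trans {l : ℕ} {c : Fin n} {p q s p' q' s' : ℕ} {x z : ℕ × ℕ × ℕ}
    {w w' v v' : List (Fin n)} (h : Pass l c x w v (p, q, s)) (h' : Pass l c (p', q', s') w' v' z)
    (hy : p = p' ∧ q = q' ∧ s = s') : Pass l c x (w ++ w') (v ++ v') z := by
  obtain ⟨rfl, rfl, rfl⟩ := hy
  exact h.append h'

theorem evolFin_ofWord (hn : 2 ≤ n) {l : ℕ} {c : Fin n} {w v : List (Fin n)}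
    (h : Pass l c (l, 0, 0) w v (l, 0, 0)) : evolFin l (ofWord w) = ofWord v := by
  obtain ⟨h1, h2⟩ := h (topRow n l) ((isBlock_top_iff c _).2 rfl)
  have h3 := passWord_statePrefix l (ofWord w) w.length
  have h4 := statePrefix_ofWord w le_rfl
  rw [Nat.sub_self, List.replicate_zero, List.append_nil] at h4
  rw [h4] at h3
  rw [h3] at h1 h2
  have h5 := (isBlock_top_iff c _).1 h2
  have h6 : ∀ m, carrier l (ofWord w) (w.length + m) = topRow n l := by
    intro m
    induction m with
    | zero => exact h5
    | succ m ih =>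
      rw [← add_assoc, carrier_succ, ih, show ofWord w (w.length + m) = ⊤ from
        List.getD_eq_default _ _ (by omega)]
      exact (top_top hn l).2
  funext i
  rcases Nat.lt_or_ge i w.length with hi | hi
  · rw [← h1]
    have : i < (statePrefix (evolFin l (ofWord w)) w.length).length := by simpa [statePrefix] using hi
    rw [ofWord, List.getD_eq_getElem _ _ this]
    simp [statePrefix]
  · obtain ⟨m, rfl⟩ := Nat.exists_eq_add_of_le hi
    have hv : v.length = w.length := by rw [← h1]; simp [statePrefix]
    rw [evolFin_apply, h6, ofWord, List.getD_eq_default _ _ hi, ofWord,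
      List.getD_eq_default _ _ (by omega)]
    exact (top_top hn l).1

theorem ofWord_append_top (w : List (Fin n)) (m : ℕ) :
    ofWord (w ++ List.replicate m ⊤) = ofWord w := by
  funext i
  rcases Nat.lt_or_ge i w.length with hi | hi
  · rw [ofWord, ofWord, List.getD_append _ _ _ _ hi]
  · rw [ofWord, ofWord, List.getD_append_right _ _ _ _ hi, List.getD_eq_default w _ hi]
    simp

theorem replicate_merge {A : Type*} (a b : ℕ) (x : A) (w : List A) :
    List.replicate a x ++ (List.replicate b x ++ w) = List.replicate (a + b) x ++ w := by
  rw [List.replicate_add, List.append_assoc]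

/-- The word `n^α 1^A n^d c^k 1^B n^m`. -/
def fiveBlocks (c : Fin n) (α A d k B m : ℕ) : List (Fin n) :=
  List.replicate α ⊤ ++ (List.replicate A 0 ++ (List.replicate d ⊤ ++
    (List.replicate k c ++ (List.replicate B 0 ++ List.replicate m ⊤))))

theorem fiveBlocks_congr {c : Fin n} {α A d k B m α' A' d' k' B' m' : ℕ}
    (h : α = α' ∧ A = A' ∧ d = d' ∧ k = k' ∧ B = B' ∧ m = m') :
    List.replicate α ⊤ ++ (List.replicate A 0 ++ (List.replicate d ⊤ ++
      (List.replicate k c ++ (List.replicate B 0 ++ List.replicate m ⊤)))) =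
    fiveBlocks c α' A' d' k' B' m' := by
  obtain ⟨rfl, rfl, rfl, rfl, rfl, rfl⟩ := h
  rfl

theorem evolFin_fiveBlocks (hn : 2 ≤ n) {l : ℕ} {c : Fin n} {α A d k B m α' A' d' k' B' m' : ℕ}
    (h : Pass l c (l, 0, 0) (fiveBlocks c α A d k B m) (fiveBlocks c α' A' d' k' B' m')
      (l, 0, 0)) : evolFin l (ofWord (fiveBlocks c α A d k B 0)) =
        ofWord (fiveBlocks c α' A' d' k' B' 0) := by
  have := evolFin_ofWord hn h
  have e : ∀ α A d k B m : ℕ, ofWord (fiveBlocks c α A d k B m) =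
      ofWord (fiveBlocks c α A d k B 0) := by
    intro α A d k B m
    have := ofWord_append_top (fiveBlocks c α A d k B 0) m
    rw [← this]
    simp only [fiveBlocks, List.append_assoc, List.replicate_zero, List.nil_append]
  rwa [e, e α'] at this

/-- The longer soliton approaches. -/
theorem evolFin_approach (hn : 2 ≤ n) {c : Fin n} (α A d k e : ℕ)
    (hc : k ≠ 0 → 0 < c ∧ c < ⊤) (hA : e + k + 1 ≤ A) (hd : e < d) :
    evolFin (e + k + 1) (ofWord (fiveBlocks c α A d k e 0)) =
      ofWord (fiveBlocks c (α + (e + k + 1)) A (d - 1) k e 0) := by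
  obtain ⟨a, rfl⟩ := Nat.exists_eq_add_of_le hA
  obtain ⟨d, rfl⟩ := Nat.exists_eq_add_of_lt hd
  have s0 := pass_top_top hn (e + k + 1) c α
  have s1 := pass_one_top hn (e + k + 1) c 0 0 0 (e + k + 1)
  have s2 := pass_one_one hn (e + k + 1) c (e + k) a
  have t1 := pass_one_top hn (e + k + 1) c 1 k 0 e
  have t2 := pass_top_mid hn (e + k + 1) c 1 0 e k hc
  have t3 := pass_top_one hn (e + k + 1) c (k + 1) 0 e
  have t4 := pass_top_top hn (e + k + 1) c 0
  -- Here the gap is `e + d + 1`, against a load of `e + k + 1`. If `d ≤ k`, the carrier still holds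
  -- `k - d` letters `1` when it reaches the letters `c`; otherwise it has been emptied before.
  rcases Nat.le_total d k with h | h
  · obtain ⟨j, rfl⟩ := Nat.exists_eq_add_of_le h
    have s3 := pass_top_one hn (e + (d + j) + 1) c 0 j (e + d + 1)
    have s4 := pass_mid_one hn (e + (d + j) + 1) c (e + d + 1) 0 0 j fun h => hc (by omega)
    have s5 := pass_mid_top hn (e + (d + j) + 1) c (e + 1) j d fun h => hc (by omega)
    refine evolFin_fiveBlocks hn (m := (d + j) + e) (m' := 0) ?_
    convert s0.trans (s1.trans (s2.trans (s3.trans (s4.trans (s5.trans (t1.trans (t2.trans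
      (t3.trans t4 (by omega)) (by omega)) (by omega)) (by omega)) (by omega)) (by omega)) (by
      omega)) (by omega)) (by omega) using 1
    · simp only [replicate_merge, ← List.replicate_add]
      exact (fiveBlocks_congr (by omega)).symm
    · simp only [replicate_merge]
      exact (fiveBlocks_congr (by omega)).symm
  · obtain ⟨j, rfl⟩ := Nat.exists_eq_add_of_le h
    have s3 := pass_top_one hn (e + k + 1) c 0 0 (e + k + 1)
    have s4 := pass_top_top hn (e + k + 1) c j
    have s5 := pass_mid_top hn (e + k + 1) c (e + 1) 0 k hc
    refine evolFin_fiveBlocks hn (m := k + e) (m' := 0) ?_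
    convert s0.trans (s1.trans (s2.trans (s3.trans (s4.trans (s5.trans (t1.trans (t2.trans
      (t3.trans t4 (by omega)) (by omega)) (by omega)) (by omega)) (by omega)) (by omega)) (by
      omega)) (by omega)) (by omega) using 1
    · simp only [replicate_merge, ← List.replicate_add]
      exact (fiveBlocks_congr (by omega)).symm
    · simp only [replicate_merge]
      exact (fiveBlocks_congr (by omega)).symm

/-- The shorter soliton grows. -/
theorem evolFin_grow (hn : 2 ≤ n) {c : Fin n} (α A k e j : ℕ)
    (hc : k ≠ 0 → 0 < c ∧ c < ⊤) (hA : e + k + 1 ≤ A) :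
    evolFin (e + k + 1) (ofWord (fiveBlocks c α A e k (e + j) 0)) =
      ofWord (fiveBlocks c (α + (e + k + 1)) (A - 1) e k (e + j + 1) 0) := by
  obtain ⟨a, rfl⟩ := Nat.exists_eq_add_of_le hA
  have s0 := pass_top_top hn (e + k + 1) c α
  have s1 := pass_one_top hn (e + k + 1) c 0 0 0 (e + k + 1)
  have s2 := pass_one_one hn (e + k + 1) c (e + k) a
  -- The gap takes only `e` of the `e + k + 1` letters `1`. All but one of the rest are exchanged
  -- for the `k` letters `c`, and the next `e` letters `1` are replaced by letters `n`, which
  -- recreates the gap.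
  have s3 := pass_top_one hn (e + k + 1) c 0 (k + 1) e
  have s4 := pass_mid_one hn (e + k + 1) c e 0 1 k hc
  have s5 := pass_one_top hn (e + k + 1) c 0 k 1 e
  have s6 := pass_tail hn (e + k + 1) c k (e + 1) j 0 (by omega) hc (by omega)
  · refine evolFin_fiveBlocks hn (m := e + k + 1) (m' := 0) ?_
    convert s0.trans (s1.trans (s2.trans (s3.trans (s4.trans (s5.trans s6 (by omega)) (by omega))
      (by omega)) (by omega)) (by omega)) (by omega) using 1
    · simp only [replicate_merge]
      exact (fiveBlocks_congr (by omega)).symm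
    · simp only [replicate_merge]
      exact (fiveBlocks_congr (by omega)).symm

/-- The shorter soliton leaves. -/
theorem evolFin_leave (hn : 2 ≤ n) {c : Fin n} (α d k e B : ℕ)
    (hc : k ≠ 0 → 0 < c ∧ c < ⊤) (hd : e ≤ d) (hB : e < B) :
    evolFin (e + k + 1) (ofWord (fiveBlocks c α (e + k) d k B 0)) =
      ofWord (fiveBlocks c (α + (e + k)) (e + k) (d + 1) k B 0) := by
  obtain ⟨d, rfl⟩ := Nat.exists_eq_add_of_le hd
  obtain ⟨b, rfl⟩ := Nat.exists_eq_add_of_lt hB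
  have s0 := pass_top_top hn (e + k + 1) c α
  have s1 := pass_one_top hn (e + k + 1) c 1 0 0 (e + k)
  have t1 := pass_one_top hn (e + k + 1) c 0 k 0 (e + 1)
  have t2 := pass_tail hn (e + k + 1) c k (e + 1) b 0 (by omega) hc (by omega)
  rcases Nat.le_total d k with h | h
  · obtain ⟨j, rfl⟩ := Nat.exists_eq_add_of_le h
    have s3 := pass_top_one hn (e + (d + j) + 1) c 1 j (e + d)
    have s4 := pass_mid_one hn (e + (d + j) + 1) c (e + d + 1) 0 0 j fun h => hc (by omega)
    have s5 := pass_mid_top hn (e + (d + j) + 1) c (e + 1) j d fun h => hc (by omega)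
    refine evolFin_fiveBlocks hn (m := e + (d + j) + 1) (m' := 0) ?_
    convert s0.trans (s1.trans (s3.trans (s4.trans (s5.trans (t1.trans t2 (by omega)) (by omega))
      (by omega)) (by omega)) (by omega)) (by omega) using 1
    · simp only [replicate_merge]
      exact (fiveBlocks_congr (by omega)).symm
    · simp only [replicate_merge]
      exact (fiveBlocks_congr (by omega)).symm
  · obtain ⟨j, rfl⟩ := Nat.exists_eq_add_of_le h
    have s3 := pass_top_one hn (e + k + 1) c 1 0 (e + k)
    have s4 := pass_top_top hn (e + k + 1) c j
    have s5 := pass_mid_top hn (e + k + 1) c (e + 1) 0 k hc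
    refine evolFin_fiveBlocks hn (m := e + k + 1) (m' := 0) ?_
    convert s0.trans (s1.trans (s3.trans (s4.trans (s5.trans (t1.trans t2 (by omega)) (by omega))
      (by omega)) (by omega)) (by omega)) (by omega) using 1
    · simp only [replicate_merge]
      exact (fiveBlocks_congr (by omega)).symm
    · simp only [replicate_merge]
      exact (fiveBlocks_congr (by omega)).symm

end dynamics

end BoxBall

namespace BoxBall
open ColorCrystal

/-! ### The complete collision of two solitons with highest weight labels -/

section highest

variable {n : ℕ} [NeZero n]

theorem iterate_approach (hn : 2 ≤ n) {c : Fin n} (α A d k e : ℕ)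
    (hc : k ≠ 0 → 0 < c ∧ c < ⊤) (hA : e + k + 1 ≤ A) (t : ℕ) (hd : e + t ≤ d) :
    (evolFin (e + k + 1))^[t] (ofWord (fiveBlocks c α A d k e 0)) =
      ofWord (fiveBlocks c (α + t * (e + k + 1)) A (d - t) k e 0) := by
  induction t with
  | zero => simp
  | succ t ih =>
    rw [Function.iterate_succ_apply', ih (by omega), evolFin_approach hn _ _ _ _ _ hc hA (by omega),
      Nat.succ_mul, add_assoc, Nat.sub_sub]

theorem iterate_grow (hn : 2 ≤ n) {c : Fin n} (α A k e : ℕ)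
    (hc : k ≠ 0 → 0 < c ∧ c < ⊤) (t : ℕ) (hA : e + k + t ≤ A) :
    (evolFin (e + k + 1))^[t] (ofWord (fiveBlocks c α A e k e 0)) =
      ofWord (fiveBlocks c (α + t * (e + k + 1)) (A - t) e k (e + t) 0) := by
  induction t with
  | zero => simp
  | succ t ih =>
    rw [Function.iterate_succ_apply', ih (by omega), evolFin_grow hn _ _ _ _ _ hc (by omega),
      Nat.succ_mul, add_assoc α, Nat.sub_sub, add_assoc e t]

theorem iterate_leave (hn : 2 ≤ n) {c : Fin n} (α k e B : ℕ)
    (hc : k ≠ 0 → 0 < c ∧ c < ⊤) (hB : e < B) (t : ℕ) :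
    (evolFin (e + k + 1))^[t] (ofWord (fiveBlocks c α (e + k) e k B 0)) =
      ofWord (fiveBlocks c (α + t * (e + k)) (e + k) (e + t) k B 0) := by
  induction t with
  | zero => simp
  | succ t ih =>
    rw [Function.iterate_succ_apply', ih, evolFin_leave hn _ _ _ _ _ hc (by omega) hB,
      Nat.succ_mul, add_assoc, add_assoc]

/-- The three phases last `d - e` steps (approach), `A - (e + k)` steps (transfer of letters) and
the remaining time (separation). Written additively, the hypotheses on `α'` and `d'` say that the
soliton of length `e + k`, first found after `α + A + d` components, is held back by `2 (e + k) - k`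
compared with free motion. -/
theorem iterate_fiveBlocks (hn : 2 ≤ n) {c : Fin n} {α A d k e s α' d' : ℕ}
    (hc : k ≠ 0 → 0 < c ∧ c < ⊤) (hA : e + k < A) (hd : e + k ≤ d) (hs : d + A ≤ s)
    (hα : α' + 2 * (e + k) = α + A + d + k + s * (e + k))
    (hd' : d' + A + d + 2 * k = s + 3 * (e + k)) :
    (evolFin (e + k + 1))^[s] (ofWord (fiveBlocks c α A d k e 0)) =
      ofWord (fiveBlocks c α' (e + k) d' k (A - k) 0) := by
  obtain ⟨x, rfl⟩ := Nat.exists_eq_add_of_le (show e ≤ d by omega)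
  obtain ⟨y, rfl⟩ := Nat.exists_eq_add_of_lt hA
  obtain ⟨z, rfl⟩ := Nat.exists_eq_add_of_le (show x + (y + 1) ≤ s by omega)
  rw [show x + (y + 1) + z = z + ((y + 1) + x) by ring, Function.iterate_add_apply,
    Function.iterate_add_apply, iterate_approach hn _ _ _ _ _ hc (by omega) x le_rfl,
    Nat.add_sub_cancel, iterate_grow hn _ _ _ _ hc (y + 1) (by omega),
    show e + k + y + 1 - (y + 1) = e + k by omega, iterate_leave hn _ _ _ _ hc (by omega) z]
  congr 2
  · have : (x + (y + 1) + z) * (e + k) = x * (e + k) + (y + 1) * (e + k) + z * (e + k) := by ring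
    simp only [Nat.mul_add _ (e + k) 1]
    omega
  · omega
  · omega

theorem evolFin_single (hn : 2 ≤ n) (c : Fin n) (k m α : ℕ) (hk : 1 ≤ k) :
    evolFin k (ofWord (List.replicate α ⊤ ++ List.replicate m (0 : Fin n))) =
      ofWord (List.replicate (α + min k m) ⊤ ++ List.replicate m 0) := by
  have h : Pass k c (k, 0, 0) (List.replicate α ⊤ ++ (List.replicate m 0 ++ List.replicate k ⊤))
      (List.replicate (α + min k m) ⊤ ++ (List.replicate m 0 ++ List.replicate (k - m) ⊤))
      (k, 0, 0) := by
    have s0 := pass_top_top hn k c α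
    rcases Nat.le_total m k with h | h
    · obtain ⟨j, rfl⟩ := Nat.exists_eq_add_of_le h
      have s1 := pass_one_top hn (m + j) c j 0 0 m
      have s2 := pass_top_one hn (m + j) c j 0 m
      have s3 := pass_top_top hn (m + j) c j
      convert s0.trans (s1.trans (s2.trans s3 (by omega)) (by omega)) (by omega) using 1
      · rw [← List.replicate_add]
      · rw [replicate_merge, min_eq_right h, Nat.add_sub_cancel_left]
    · obtain ⟨j, rfl⟩ := Nat.exists_eq_add_of_le h
      have s1 := pass_one_top hn k c 0 0 0 k
      have s2 := pass_one_one hn k c (k - 1) j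
      have s3 := pass_top_one hn k c 0 0 k
      rw [zero_add] at s3
      convert s0.trans (s1.trans (s2.trans s3 (by omega)) (by omega)) (by omega) using 1
      · rw [replicate_merge]
      · rw [replicate_merge, min_eq_left h, Nat.sub_eq_zero_of_le h, List.replicate_zero,
          List.append_nil, add_comm k j, List.replicate_add j k]
  have := evolFin_ofWord hn h
  rwa [← List.append_assoc, ofWord_append_top, ← List.append_assoc, ofWord_append_top] at this

end highest

/-! ### From highest weight labels to arbitrary labels -/

section solitons

variable {N : ℕ} [NeZero N]

theorem rowWord_of_mult {l : ℕ} {b : Row N l} (a : Fin N) (k e : ℕ)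
    (h : ∀ j, mult b j = (if j = a then k else 0) + (if j = 0 then e else 0)) :
    rowWord b = List.replicate k a.castSucc ++ List.replicate e 0 := by
  refine (eq_rowWord ?_ ?_).symm
  · rw [List.pairwise_append]
    refine ⟨List.pairwise_replicate.2 (Or.inr le_rfl), List.pairwise_replicate.2 (Or.inr le_rfl),
      fun x _ y hy => ?_⟩
    rw [List.eq_of_mem_replicate hy]
    exact Fin.zero_le _
  · have : b.1 = Multiset.replicate k a + Multiset.replicate e 0 := by
      ext j
      rw [Multiset.count_add, Multiset.count_replicate, Multiset.count_replicate]
      simp only [@eq_comm _ _ j]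
      exact h j
    rw [this, Multiset.map_add, Multiset.map_replicate, Multiset.map_replicate, ← Multiset.coe_add]
    rfl

theorem rowWord_eq_zeros {l : ℕ} {b : Row N l} (h : ∀ j, j ≠ 0 → mult b j = 0) :
    mult b 0 = l ∧ rowWord b = List.replicate l 0 := by
  have h0 : mult b 0 = l := by
    refine Eq.trans ?_ (sum_mult b)
    exact (Finset.sum_eq_single 0 (fun j _ hj => h j hj) (by simp)).symm
  refine ⟨h0, ?_⟩
  rw [rowWord_of_mult 0 0 l fun j => ?_, List.replicate_zero, List.nil_append]
  split_ifs with hj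
  · rw [hj, h0, zero_add]
  · rw [h j hj]

theorem castSucc_ne_top {N : ℕ} (i : Fin N) : (i.castSucc : Fin (N + 1)) ≠ ⊤ :=
  (Fin.castSucc_lt_last i).ne

theorem weightSum_lt (hN : 2 ≤ N) {l : ℕ} {i : Fin N} (hi : i ≠ 0) {b b' : Row N l}
    (h : (rowCrystal hN l i).e b = some b') : weightSum Fin.val b' < weightSum Fin.val b := by
  have h1 := weightSum_e hN Fin.val h
  have h2 := val_sub_one_of_ne hi
  omega

theorem weightSum_tensor_lt (hN : 2 ≤ N) {l l' : ℕ} {i : Fin N} (hi : i ≠ 0)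
    {b b' : Row N l × Row N l'} (h : (rowTensor hN l l' i).e b = some b') :
    weightSum Fin.val b'.1 + weightSum Fin.val b'.2 <
      weightSum Fin.val b.1 + weightSum Fin.val b.2 := by
  have h1 := weightSum_tensor_e hN Fin.val h
  have h2 := val_sub_one_of_ne hi
  omega

/-- The state with a single soliton. -/
def oneWord {l : ℕ} (α : ℕ) (b : Row N l) : List (Fin (N + 1)) :=
  List.replicate α ⊤ ++ rowWord b

/-- The state with two solitons. -/
def twoWord {l l' : ℕ} (α : ℕ) (b : Row N l) (d : ℕ) (b' : Row N l') : List (Fin (N + 1)) :=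
  List.replicate α ⊤ ++ (rowWord b ++ (List.replicate d ⊤ ++ rowWord b'))

theorem listE_replicate_top (hn : 2 ≤ N + 1) {i : Fin N} (hi : i ≠ 0) (α : ℕ)
    {w w' : List (Fin (N + 1))} (h : (letterCrystal hn i.castSucc).listE w = some w') :
    (letterCrystal hn i.castSucc).listE (List.replicate α ⊤ ++ w) =
      some (List.replicate α ⊤ ++ w') := by
  refine listE_append_right _ ?_ h
  rw [(list_eps_phi_replicate_top hn (castSucc_ne_zero_of_ne hi) (castSucc_ne_top i) α).2]
  exact Nat.pos_of_ne_zero ((letterCrystal hn i.castSucc).list.eps_ne_zero h)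

theorem oneWord_e (hN : 2 ≤ N) (hn : 2 ≤ N + 1) {l : ℕ} {i : Fin N} (hi : i ≠ 0) (α : ℕ)
    {b b' : Row N l} (h : (rowCrystal hN l i).e b = some b') :
    (letterCrystal hn i.castSucc).listE (oneWord α b) = some (oneWord α b') :=
  listE_replicate_top hn hi α (rowWord_e hn hi h)

theorem twoWord_e (hN : 2 ≤ N) (hn : 2 ≤ N + 1) {l l' : ℕ} {i : Fin N} (hi : i ≠ 0) (α d : ℕ)
    {x y : Row N l × Row N l'} (h : (rowTensor hN l l' i).e x = some y) :
    (letterCrystal hn i.castSucc).listE (twoWord α x.1 d x.2) = some (twoWord α y.1 d y.2) := by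
  refine listE_replicate_top hn hi α ?_
  obtain ⟨z1, z2⟩ := list_eps_phi_replicate_top hn (castSucc_ne_zero_of_ne hi)
    (castSucc_ne_top i) d
  have h1 := rowWord_eps_phi hn hi x.1
  have h2 := rowWord_eps_phi hn hi x.2
  have h3 := (list_append (letterCrystal hn i.castSucc) (List.replicate d ⊤) (rowWord x.2)).1
  have h4 : (rowCrystal hN l i).phi x.1 = mult x.1 (i - 1) := rfl
  have h5 : (rowCrystal hN l' i).eps x.2 = mult x.2 i := rfl
  rcases tensor_e_cases h with ⟨g1, g2, g3⟩ | ⟨g1, g2, g3⟩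
  · rw [g3]
    exact listE_append_left _ (by omega) (rowWord_e hn hi g2)
  · rw [g3]
    exact listE_append_right _ (by omega) (listE_replicate_top hn hi d (rowWord_e hn hi g2))

/-- The label `1^l` is computed directly; every other label is led to it by operators `e_i`, `i ≠
0`, which commute with the evolution. -/
theorem oneWord_evolFin (k : ℕ) (hk : 1 ≤ k) {l : ℕ} (α : ℕ) (b : Row N l) :
    evolFin k (ofWord (oneWord α b)) = ofWord (oneWord (α + min k l) b) := by
  have hn : 2 ≤ N + 1 := Nat.succ_le_succ (NeZero.one_le)
  have base : ∀ b : Row N l, (∀ j, j ≠ 0 → mult b j = 0) →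
      evolFin k (ofWord (oneWord α b)) = ofWord (oneWord (α + min k l) b) := by
    intro b hb
    rw [oneWord, oneWord, (rowWord_eq_zeros hb).2]
    exact evolFin_single hn 0 k l α hk
  rcases Nat.lt_or_ge N 2 with hN | hN
  · have : N = 1 := by have := NeZero.pos N; omega
    subst this
    exact base b fun j hj => absurd (Subsingleton.elim j 0) hj
  · refine e_induction (fun i => rowCrystal hN l i) {0}ᶜ (weightSum Fin.val)
      (fun i hi b b' h => weightSum_lt hN hi h) (fun b hb => base b hb) (fun i hi b b' h ih => ?_) b
    have h0 := castSucc_ne_zero_of_ne (i := i) hi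
    have ht := castSucc_ne_top i
    have s1 := (StateE.ofWord h0 ht (oneWord_e hN hn hi α h)).evolFin h0 ht (ofWord_finState _)
      (ofWord_finState _) k
    rw [ih] at s1
    exact s1.left_unique (StateE.ofWord h0 ht (oneWord_e hN hn hi _ h))

/-- The scattering of two solitons under the evolution that just distinguishes them. -/
theorem twoWord_iterate {l₁ l₂ : ℕ} (hl : l₂ < l₁) (b : Row N l₁ × Row N l₂) :
    ∃ k ≤ l₂, energy b = -(k : ℤ) ∧ ∀ α d s α' d' : ℕ, l₂ ≤ d → d + l₁ ≤ s →
      α' + 2 * l₂ = α + l₁ + d + k + s * l₂ → d' + l₁ + d + 2 * k = s + 3 * l₂ →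
      (evolFin (l₂ + 1))^[s] (ofWord (twoWord α b.1 d b.2)) =
        ofWord (twoWord α' (crystalIso b).1 d' (crystalIso b).2) := by
  have hn : 2 ≤ N + 1 := Nat.succ_le_succ (NeZero.one_le)
  rcases Nat.lt_or_ge N 2 with hN | hN
  · have : N = 1 := by have := NeZero.pos N; omega
    subst this
    -- With one label letter the block of letters `c` is empty and `c` may be anything.
    refine ⟨0, Nat.zero_le _, energy_eq_zero_of_one hl b, fun α d s α' d' hd hs hα hd' => ?_⟩
    have e : ∀ {l : ℕ} (b : Row 1 l), rowWord b = List.replicate l 0 := fun b =>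
      (rowWord_eq_zeros fun j hj => absurd (Subsingleton.elim j 0) hj).2
    have := iterate_fiveBlocks hn (c := (0 : Fin (1 + 1))) (α := α) (A := l₁) (d := d) (k := 0)
      (e := l₂) (s := s) (α' := α') (d' := d') (by simp) hl hd hs hα hd'
    simpa [fiveBlocks, twoWord, e] using this
  rw [energy_eq hN, crystalIso_eq hN]
  refine e_induction (P := fun b => ∃ k ≤ l₂, rowEnergy b = -(k : ℤ) ∧
      ∀ α d s α' d' : ℕ, l₂ ≤ d → d + l₁ ≤ s →
        α' + 2 * l₂ = α + l₁ + d + k + s * l₂ → d' + l₁ + d + 2 * k = s + 3 * l₂ →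
        (evolFin (l₂ + 1))^[s] (ofWord (twoWord α b.1 d b.2)) =
          ofWord (twoWord α' (rowSwap b).1 d' (rowSwap b).2))
    (fun i => rowTensor hN l₁ l₂ i) {0}ᶜ (fun b => weightSum Fin.val b.1 + weightSum Fin.val b.2)
    (fun i hi b b' h => weightSum_tensor_lt hN hi h) (fun b hb => ?_) (fun i hi b b' h ih => ?_) b
  · have v1 : ((1 : Fin N) : ℕ) = 1 := by
      rw [Fin.val_one', Nat.mod_eq_of_lt (by omega)]
    have h10 : (1 : Fin N) ≠ 0 := fun h => by rw [h, Fin.val_zero] at v1; omega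
    -- Highest weight elements are `1^{l₁} ⊗ 1^e 2^k`: a letter of the second row needs its
    -- predecessor in the first one.
    have hb1 : ∀ j, j ≠ 0 → mult b.1 j = 0 := fun j hj =>
      (Nat.add_eq_zero_iff.1 (hb j hj)).1
    have hb2 : ∀ j, j ≠ 0 → j ≠ 1 → mult b.2 j = 0 := fun j hj hj' => by
      have h1 := (Nat.add_eq_zero_iff.1 (hb j hj)).2
      have h2 : mult b.1 (j - 1) = 0 := hb1 _ (sub_ne_zero.2 hj')
      change mult b.2 j - mult b.1 (j - 1) = 0 at h1
      omega
    have hsum : mult b.2 1 + mult b.2 0 = l₂ := by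
      rw [← Finset.sum_pair h10]
      refine Eq.trans ?_ (sum_mult b.2)
      refine Finset.sum_subset (Finset.subset_univ _) fun j _ hj => ?_
      simp only [Finset.mem_insert, Finset.mem_singleton, not_or] at hj
      exact hb2 j hj.2 hj.1
    obtain ⟨m1, w1⟩ := rowWord_eq_zeros hb1
    -- The image is again of highest weight, so its first row is `1^{l₂}`; conservation of letters
    -- yields `1^{l₁-k} 2^k` for the second.
    have hs1 : ∀ j, j ≠ 0 → mult (rowSwap b).1 j = 0 := fun j hj => by
      have h1 := (rowSwap_hom hN l₁ l₂ j).eps b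
      rw [show (rowTensor hN l₁ l₂ j).eps b = 0 from hb j hj] at h1
      exact (Nat.add_eq_zero_iff.1 h1).1
    obtain ⟨m2, w2⟩ := rowWord_eq_zeros hs1
    set k := mult b.2 1 with hk
    set e := mult b.2 0 with he
    have w3 : rowWord b.2 = List.replicate k (1 : Fin N).castSucc ++ List.replicate e 0 := by
      refine rowWord_of_mult 1 k e fun j => ?_
      by_cases j0 : j = 0
      · rw [if_pos j0, if_neg (by rw [j0]; exact h10.symm), j0, zero_add]
      · rw [if_neg j0]
        by_cases j1 : j = 1
        · rw [if_pos j1, j1, add_zero]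
        · rw [if_neg j1, hb2 j j0 j1]
    have w4 : rowWord (rowSwap b).2 =
        List.replicate k (1 : Fin N).castSucc ++ List.replicate (l₁ - k) 0 := by
      refine rowWord_of_mult 1 k (l₁ - k) fun j => ?_
      have hw := rowSwap_weight b j
      by_cases j0 : j = 0
      · rw [if_pos j0, if_neg (by rw [j0]; exact h10.symm), j0]
        rw [j0, m1, m2] at hw
        omega
      · rw [if_neg j0]
        rw [hs1 j j0, hb1 j j0] at hw
        by_cases j1 : j = 1
        · rw [if_pos j1]
          rw [j1] at hw ⊢
          omega
        · rw [if_neg j1]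
          rw [hb2 j j0 j1] at hw
          omega
    refine ⟨k, by omega, ?_, fun α d s α' d' hd hs hα hd' => ?_⟩
    -- With `Q` zero at the letter `1`, the multiplicity `l₂` of this letter in the first row of the
    -- image is `e + Q_N`. Thus `Q_N = k` and `H = -k`.
    · have q0 : tropQ (mult b.1) (mult b.2) 0 = 0 := by
        have h : ((window (mult b.1) (mult b.2) 0 (N - 1)).map Prod.fst).sum = 0 := by
          refine List.sum_eq_zero fun a ha => ?_
          rw [window, List.map_map] at ha
          obtain ⟨t, ht, rfl⟩ := List.mem_map.1 ha
          rw [List.mem_range] at ht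
          refine hb1 _ ?_
          rw [zero_add, ← zero_nsmul (1 : Fin N)]
          exact nsmul_one_ne (by omega) (by omega) (by omega)
        rw [tropQ_self, h]
        omega
      have h1 := mult_rowSwap_fst b
      have h2 := congrFun h1 0
      rw [m2, imageFst, q0, zero_sub_one] at h2
      simp only [rowEnergy]
      omega
    · have v2 : (1 : Fin N).castSucc.val = 1 := v1
      have hc : 0 < (1 : Fin N).castSucc ∧ (1 : Fin N).castSucc < ⊤ :=
        ⟨by rw [Fin.lt_def, v2]; exact Nat.one_pos, Fin.castSucc_lt_last _⟩
      have hek : e + k = l₂ := by omega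
      have := iterate_fiveBlocks hn (α := α) (A := l₁) (d := d) (k := k) (e := e) (s := s)
        (α' := α') (d' := d') (fun _ => hc) (by omega) (by omega) hs (by rw [hek]; omega) (by omega)
      rw [hek] at this
      simpa only [twoWord, w1, w2, w3, w4, fiveBlocks, List.replicate_zero, List.append_nil,
        List.append_assoc] using this
  · obtain ⟨k, hk, h1, h2⟩ := ih
    refine ⟨k, hk, ?_, fun α d s α' d' hd hs hα hd' => ?_⟩
    · rw [← h1, rowEnergy_of_ne_zero hN hi h]
    · have h0 := castSucc_ne_zero_of_ne (i := i) hi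
      have ht := castSucc_ne_top i
      have s1 := (StateE.ofWord h0 ht (twoWord_e hN hn hi α d h)).iterate h0 ht
        (ofWord_finState _) (ofWord_finState _) (l₂ + 1) s
      -- The evolved states of `b` and of `e_i b` are joined by `e_i`, and so are the predicted
      -- ones; injectivity of `e_i` transfers the claim.
      rw [h2 α d s α' d' hd hs hα hd'] at s1
      exact s1.left_unique (StateE.ofWord h0 ht (twoWord_e hN hn hi _ _
        ((rowSwap_hom hN l₁ l₂ i).e _ _ h)))

end solitons

end BoxBall

namespace BoxBall
open ColorCrystal

/-! ### States made of solitons -/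

section configurations

variable {N : ℕ}

/-- The position of the soliton `x` when the solitons of length `l` have moved by `v l`. -/
def place (v : ℕ → ℤ) (x : Soliton N) : ℤ := v x.len - x.pow

/-- The state with the single soliton `x`. -/
def singleState (v : ℕ → ℤ) (x : Soliton N) : ℕ → Fin (N + 1) :=
  ofWord (oneWord (place v x - 1).toNat x.label)

/-- The number of components up to the end of the soliton `x`. -/
def endpoint (v : ℕ → ℤ) (x : Soliton N) : ℕ := (place v x - 1).toNat + x.len

/-- The state with the solitons `xs`. -/
def stateOf (v : ℕ → ℤ) : List (Soliton N) → ℕ → Fin (N + 1)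
  | [] => fun _ => ⊤
  | x :: xs => glue (endpoint v x) (singleState v x) (stateOf v xs)

/-- The solitons `xs` are located in positive components, in this order, with gaps at least `g`. -/
def Spaced (v : ℕ → ℤ) (g : ℕ) (xs : List (Soliton N)) : Prop :=
  (∀ x ∈ xs, 1 ≤ place v x) ∧
    xs.Pairwise fun x y => place v x + (x.len : ℤ) + (g : ℤ) ≤ place v y

theorem Spaced.mono {v : ℕ → ℤ} {g g' : ℕ} {xs : List (Soliton N)} (h : Spaced v g xs)
    (hg : g' ≤ g) : Spaced v g' xs :=
  ⟨h.1, h.2.imp fun h => by omega⟩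

theorem spaced_cons {v : ℕ → ℤ} {g : ℕ} {x : Soliton N} {xs : List (Soliton N)} :
    Spaced v g (x :: xs) ↔ 1 ≤ place v x ∧
      (∀ y ∈ xs, place v x + (x.len : ℤ) + (g : ℤ) ≤ place v y) ∧ Spaced v g xs := by
  rw [Spaced, Spaced, List.forall_mem_cons, List.pairwise_cons]
  tauto

theorem spaced_append {v : ℕ → ℤ} {g : ℕ} {xs ys : List (Soliton N)} :
    Spaced v g (xs ++ ys) ↔ Spaced v g xs ∧ Spaced v g ys ∧
      ∀ x ∈ xs, ∀ y ∈ ys, place v x + (x.len : ℤ) + (g : ℤ) ≤ place v y := by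
  rw [Spaced, Spaced, Spaced, List.pairwise_append, List.forall_mem_append]
  tauto

theorem place_congr {v v' : ℕ → ℤ} {x : Soliton N} (h : v x.len = v' x.len) :
    place v x = place v' x := by
  rw [place, place, h]

theorem Spaced.congr {v v' : ℕ → ℤ} {g : ℕ} {xs : List (Soliton N)} (h : Spaced v g xs)
    (hv : ∀ x ∈ xs, v x.len = v' x.len) : Spaced v' g xs :=
  ⟨fun x hx => place_congr (hv x hx) ▸ h.1 x hx,
    h.2.imp_of_mem fun hx hy h => by
      rw [← place_congr (hv _ hx), ← place_congr (hv _ hy)]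
      exact h⟩

theorem stateOf_congr {v v' : ℕ → ℤ} {xs : List (Soliton N)}
    (hv : ∀ x ∈ xs, v x.len = v' x.len) : stateOf v xs = stateOf v' xs := by
  induction xs with
  | nil => rfl
  | cons x xs ih =>
    rw [List.forall_mem_cons] at hv
    simp only [stateOf, ih hv.2, endpoint, singleState, place_congr hv.1]

theorem singleState_of_lt {v : ℕ → ℤ} {x : Soliton N} {i : ℕ} (h : (i : ℤ) + 1 < place v x) :
    singleState v x i = ⊤ := by
  rw [singleState, ofWord, oneWord, List.getD_append _ _ _ _ (by simp; omega)]
  simp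

theorem singleState_of_endpoint_le {v : ℕ → ℤ} {x : Soliton N} {i : ℕ} (h : endpoint v x ≤ i) :
    singleState v x i = ⊤ := by
  refine List.getD_eq_default _ _ ?_
  rw [oneWord, List.length_append, List.length_replicate, rowWord_length]
  exact h

theorem singleState_of_mem {v : ℕ → ℤ} {x : Soliton N} {i j : ℕ} (h0 : 1 ≤ place v x)
    (h : (i : ℤ) + 1 = place v x + j) {a : Fin (N + 1)} (ha : x.word[j]? = some a) :
    singleState v x i = a := by
  rw [singleState, ofWord, oneWord, List.getD_append_right _ _ _ _ (by simp; omega),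
    List.length_replicate, show i - (place v x - 1).toNat = j by omega, List.getD_eq_getElem?_getD]
  change (x.word[j]?).getD ⊤ = a
  rw [ha, Option.getD_some]

theorem stateOf_of_lt {v : ℕ → ℤ} {xs : List (Soliton N)} {i : ℕ}
    (h : ∀ x ∈ xs, (i : ℤ) + 1 < place v x) : stateOf v xs i = ⊤ := by
  induction xs with
  | nil => rfl
  | cons x xs ih =>
    rw [List.forall_mem_cons] at h
    simp only [stateOf, glue]
    split_ifs
    · exact singleState_of_lt h.1
    · exact ih h.2

theorem stateOf_of_endpoint_le {v : ℕ → ℤ} {xs : List (Soliton N)} {i : ℕ}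
    (h : ∀ x ∈ xs, endpoint v x ≤ i) : stateOf v xs i = ⊤ := by
  induction xs with
  | nil => rfl
  | cons x xs ih =>
    rw [List.forall_mem_cons] at h
    simp only [stateOf, glue]
    rw [if_neg (by omega)]
    exact ih h.2

theorem stateOf_finState (v : ℕ → ℤ) (xs : List (Soliton N)) : FinState (stateOf v xs) := by
  refine ⟨(xs.map (endpoint v)).sum, fun i hi => stateOf_of_endpoint_le fun x hx => le_trans ?_ hi⟩
  exact List.le_sum_of_mem (List.mem_map_of_mem hx)

theorem glue_assoc {n : ℕ} {a b : ℕ} (h : a ≤ b) (p q r : ℕ → Fin n) :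
    glue a p (glue b q r) = glue b (glue a p q) r := by
  funext i
  simp only [glue]
  split_ifs <;> first | rfl | omega

theorem glue_congr {n : ℕ} [NeZero n] {a b : ℕ} {p q : ℕ → Fin n}
    (h : ∀ i, (a ≤ i ∧ i < b) ∨ (b ≤ i ∧ i < a) → p i = q i) : glue a p q = glue b p q := by
  funext i
  simp only [glue]
  split_ifs with h1 h2 h2
  · rfl
  · exact h i (by omega)
  · exact (h i (by omega)).symm
  · rfl

theorem stateOf_append {v : ℕ → ℤ} {g : ℕ} {xs ys : List (Soliton N)} {a : ℕ}
    (hx : Spaced v g xs) (h : ∀ x ∈ xs, endpoint v x ≤ a) (h' : ∀ y ∈ ys, (a : ℤ) < place v y) :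
    stateOf v (xs ++ ys) = glue a (stateOf v xs) (stateOf v ys) := by
  induction xs with
  | nil =>
    funext i
    simp only [List.nil_append, glue]
    split_ifs with hi
    · exact stateOf_of_lt fun y hy => by have := h' y hy; omega
    · rfl
  | cons x xs ih =>
    rw [spaced_cons] at hx
    rw [List.forall_mem_cons] at h
    rw [List.cons_append, stateOf, ih hx.2.2 h.2, glue_assoc h.1]
    rfl

theorem ballCount_singleState (v : ℕ → ℤ) (x : Soliton N) (J : ℕ) :
    ballCount (singleState v x) J ≤ x.len := by
  have h : ballCount (singleState v x) J ≤
      ∑ i ∈ Finset.range J, if i ∈ Finset.Ico (place v x - 1).toNat (endpoint v x) then 1 else 0 := by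
    refine Finset.sum_le_sum fun i _ => ?_
    split_ifs with h1 h2 h2
    · exact Nat.zero_le _
    · exact Nat.zero_le _
    · exact le_rfl
    · rw [Finset.mem_Ico, not_and_or] at h2
      refine absurd ?_ h1
      rcases h2 with h2 | h2
      · exact singleState_of_lt (by omega)
      · exact singleState_of_endpoint_le (not_lt.1 h2)
  refine h.trans ?_
  rw [← Finset.card_filter]
  refine (Finset.card_le_card (t := Finset.Ico (place v x - 1).toNat (endpoint v x)) ?_).trans ?_
  · intro i hi
    exact (Finset.mem_filter.1 hi).2
  · rw [Nat.card_Ico, endpoint]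
    omega

/-- In contrast to `carrier_eq_top`, the distance needed for unloading is bounded by the number of
letters to be put down, not by the capacity. This keeps the required gaps independent of `r`. -/
theorem carrier_eq_top_of_ballCount {n : ℕ} [NeZero n] (hn : 2 ≤ n) {l m R j : ℕ} {p : ℕ → Fin n}
    (h : ∀ i, R ≤ i → p i = ⊤) (hm : ∀ J, ballCount p J ≤ m) (hj : R + m ≤ j) :
    carrier l p j = topRow n l := by
  obtain ⟨i, rfl⟩ : ∃ i, j = R + i := ⟨j - R, by omega⟩
  have h1 := ballCount_evolFin hn l p R
  have h2 := hm R
  rw [eq_topRow_iff, mult_top_carrier hn i fun i h1 _ => h i h1]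
  omega

/-- The displacement of solitons under `T_k`. -/
def speed (k : ℕ) (l : ℕ) : ℤ := (min k l : ℕ)

theorem place_add (v w : ℕ → ℤ) (x : Soliton N) : place (v + w) x = place v x + w x.len := by
  simp only [place, Pi.add_apply]
  ring

theorem speed_nonneg (k l : ℕ) : 0 ≤ speed k l := Int.natCast_nonneg _

theorem speed_le (k l : ℕ) : speed k l ≤ l := by
  rw [speed]
  omega

/-- One evolution can shorten a gap by at most the greatest length. -/
theorem Spaced.add_speed {v : ℕ → ℤ} {g L : ℕ} {xs : List (Soliton N)}
    (hL : ∀ x ∈ xs, x.len ≤ L) (h : Spaced v (g + L) xs) (k : ℕ) : Spaced (v + speed k) g xs := by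
  refine ⟨fun x hx => ?_, h.2.imp_of_mem fun {x y} hx hy h' => ?_⟩
  · have := h.1 x hx
    have := speed_nonneg k x.len
    rw [place_add]
    omega
  · have := speed_le k x.len
    have := speed_nonneg k y.len
    have := hL x hx
    rw [place_add, place_add]
    omega

/-- Well separated solitons move freely. -/
theorem evolFin_stateOf [NeZero N] {k : ℕ} (hk : 1 ≤ k) {v : ℕ → ℤ} {L : ℕ} {xs : List (Soliton N)}
    (hL : ∀ x ∈ xs, x.len ≤ L) (h : Spaced v L xs) :
    evolFin k (stateOf v xs) = stateOf (v + speed k) xs := by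
  have hn : 2 ≤ N + 1 := Nat.succ_le_succ (NeZero.one_le)
  induction xs with
  | nil =>
    funext i
    exact evolFin_eq_top_left hn (L := i + 1) (fun _ _ => rfl) (Nat.lt_succ_self i)
  | cons x xs ih =>
    obtain ⟨h1, h2, h3⟩ := spaced_cons.1 h
    rw [List.forall_mem_cons] at hL
    have hrest : ∀ i < endpoint v x + x.len, stateOf v xs i = ⊤ := fun i hi =>
      stateOf_of_lt fun y hy => by
        have := h2 y hy
        rw [endpoint] at hi
        omega
    -- The cut is moved to the right by `x.len` letters `n`, to where the carrier is a top row
    -- again.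
    have hcut : stateOf v (x :: xs) = glue (endpoint v x + x.len) (singleState v x) (stateOf v xs) := by
      refine glue_congr fun i hi => ?_
      rw [singleState_of_endpoint_le (by omega), hrest i (by omega)]
    rw [hcut, evolFin_glue hn (carrier_eq_top_of_ballCount hn (fun i => singleState_of_endpoint_le)
      (ballCount_singleState v x) le_rfl) hrest, ih hL.2 h3]
    have hs : evolFin k (singleState v x) = singleState (v + speed k) x := by
      rw [singleState, oneWord_evolFin k hk, singleState]
      congr 2
      rw [place_add, speed]
      omega
    have hsp : endpoint (v + speed k) x = endpoint v x + min k x.len := by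
      rw [endpoint, endpoint, place_add, speed]
      omega
    rw [hs]
    refine (glue_congr fun i hi => ?_).symm
    rw [singleState_of_endpoint_le (by omega)]
    refine (stateOf_of_lt fun y hy => ?_).symm
    have := h2 y hy
    have := speed_nonneg k y.len
    rw [place_add]
    have : endpoint v x = (place v x - 1).toNat + x.len := rfl
    omega

end configurations

end BoxBall

namespace BoxBall
open ColorCrystal

/-! ### Flows -/

section flows

/-- The displacement caused by several time evolutions. -/
def disp : List ℕ → ℕ → ℤ
  | [] => 0
  | k :: F => speed k + disp F

/-- The composition of several time evolutions. -/
noncomputable def act {n : ℕ} [NeZero n] : List ℕ → (ℕ → Fin n) → ℕ → Fin n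
  | [], p => p
  | k :: F, p => act F (evolFin k p)

theorem disp_append (F E : List ℕ) : disp (F ++ E) = disp F + disp E := by
  induction F with
  | nil => exact (zero_add _).symm
  | cons k F ih => rw [List.cons_append, disp, disp, ih, add_assoc]

theorem disp_replicate (t k : ℕ) : disp (List.replicate t k) = fun l => (t : ℤ) * speed k l := by
  induction t with
  | zero => funext l; simp [disp]
  | succ t ih =>
    funext l
    simp only [List.replicate_succ, disp, ih, Pi.add_apply]
    push_cast
    ring

variable {n : ℕ} [NeZero n]

theorem act_append (F E : List ℕ) (p : ℕ → Fin n) : act (F ++ E) p = act E (act F p) := by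
  induction F generalizing p with
  | nil => rfl
  | cons k F ih => exact ih _

theorem act_replicate (t k : ℕ) (p : ℕ → Fin n) :
    act (List.replicate t k) p = (evolFin k)^[t] p := by
  induction t generalizing p with
  | zero => rfl
  | succ t ih => exact ih _

theorem act_evolFin (hn : 2 ≤ n) (F : List ℕ) (k : ℕ) (p : ℕ → Fin n) :
    act F (evolFin k p) = evolFin k (act F p) := by
  induction F generalizing p with
  | nil => rfl
  | cons j F ih => rw [act, evolFin_comm hn, ih, act]

theorem act_comm (hn : 2 ≤ n) (F E : List ℕ) (p : ℕ → Fin n) :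
    act F (act E p) = act E (act F p) := by
  induction E generalizing p with
  | nil => rfl
  | cons k E ih => rw [act, act, ih, act_evolFin hn]

theorem FinState.act (hn : 2 ≤ n) {p : ℕ → Fin n} (h : FinState p) (F : List ℕ) :
    FinState (act F p) := by
  induction F generalizing p with
  | nil => exact h
  | cons k F ih => exact ih (h.evolFin hn k)

theorem act_injective (hn : 2 ≤ n) {p q : ℕ → Fin n} (hp : FinState p) (hq : FinState q)
    {F : List ℕ} (h : BoxBall.act F p = BoxBall.act F q) : p = q := by
  induction F generalizing p q with
  | nil => exact h
  | cons k F ih =>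
    exact evolFin_injective hn hp hq (ih (hp.evolFin hn k) (hq.evolFin hn k) h)

/-- The state `q` arises from `p` by time evolutions and their inverses, with displacement `w`. -/
def Linked (p q : ℕ → Fin n) (w : ℕ → ℤ) : Prop :=
  ∃ F E : List ℕ, (∀ k ∈ F, 1 ≤ k) ∧ (∀ k ∈ E, 1 ≤ k) ∧ act F p = act E q ∧
    w + disp E = disp F

theorem Linked.refl (p : ℕ → Fin n) : Linked p p 0 :=
  ⟨[], [], by simp, by simp, rfl, zero_add _⟩

theorem Linked.symm {p q : ℕ → Fin n} {w : ℕ → ℤ} (h : Linked p q w) : Linked q p (-w) := by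
  obtain ⟨F, E, hF, hE, h1, h2⟩ := h
  exact ⟨E, F, hE, hF, h1.symm, by rw [← h2, neg_add_cancel_left]⟩

theorem Linked.trans (hn : 2 ≤ n) {p q z : ℕ → Fin n} {w w' : ℕ → ℤ} (h : Linked p q w)
    (h' : Linked q z w') : Linked p z (w + w') := by
  obtain ⟨F, E, hF, hE, h1, h2⟩ := h
  obtain ⟨F', E', hF', hE', h3, h4⟩ := h'
  refine ⟨F ++ F', E' ++ E, ?_, ?_, ?_, ?_⟩
  · exact List.forall_mem_append.2 ⟨hF, hF'⟩
  · exact List.forall_mem_append.2 ⟨hE', hE⟩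
  -- Commutativity moves `E` past `F'`, as in the composition of fractions.
  · rw [act_append, act_append, h1, act_comm hn, h3]
  · rw [disp_append, disp_append, ← h2, ← h4]
    abel

theorem Linked.act {F : List ℕ} (hF : ∀ k ∈ F, 1 ≤ k) (p : ℕ → Fin n) :
    Linked p (BoxBall.act F p) (disp F) :=
  ⟨F, [], hF, by simp, rfl, add_zero _⟩

end flows

/-! ### Changing the distances between solitons by commuting flows -/

section isotopy

variable {N : ℕ}

theorem Spaced.add_disp {v : ℕ → ℤ} {g L : ℕ} {xs : List (Soliton N)}
    (hL : ∀ x ∈ xs, x.len ≤ L) (F : List ℕ) (h : Spaced v (g + F.length * L) xs) :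
    Spaced (v + disp F) g xs := by
  induction F generalizing v with
  | nil => simpa [disp] using h
  | cons k F ih =>
    rw [disp, ← add_assoc]
    refine ih (Spaced.add_speed hL (h.mono ?_) k)
    rw [List.length_cons, Nat.succ_mul]
    omega

theorem two_le_succ (N : ℕ) [NeZero N] : 2 ≤ N + 1 := Nat.succ_le_succ NeZero.one_le

theorem act_stateOf [NeZero N] {v : ℕ → ℤ} {L : ℕ} {xs : List (Soliton N)}
    (hL : ∀ x ∈ xs, x.len ≤ L) {F : List ℕ} (hF : ∀ k ∈ F, 1 ≤ k)
    (h : Spaced v (L + F.length * L) xs) : act F (stateOf v xs) = stateOf (v + disp F) xs := by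
  induction F generalizing v with
  | nil => rw [disp, add_zero, act]
  | cons k F ih =>
    rw [List.forall_mem_cons] at hF
    rw [act, evolFin_stateOf hF.1 hL (h.mono (by omega)), disp, ← add_assoc]
    refine ih hF.2 (Spaced.add_speed hL (h.mono ?_) k)
    rw [List.length_cons, Nat.succ_mul]
    omega

/-- Moving the solitons of length `l` by one. -/
theorem linked_single [NeZero N] {v : ℕ → ℤ} {L l : ℕ} {xs : List (Soliton N)}
    (hL : ∀ x ∈ xs, x.len ≤ L) (hl : 1 ≤ l) (h : Spaced v (3 * L) xs)
    (h' : Spaced (v + Pi.single l 1) (3 * L) xs) :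
    Linked (stateOf v xs) (stateOf (v + Pi.single l 1) xs) (Pi.single l 1) := by
  have key : ∀ E : List ℕ, (∀ k ∈ E, 1 ≤ k) → E.length ≤ 2 →
      Pi.single l 1 + disp E = disp [l, l] →
      Linked (stateOf v xs) (stateOf (v + Pi.single l 1) xs) (Pi.single l 1) := by
    intro E hE hlen hw
    have hll : ∀ k ∈ [l, l], 1 ≤ k := by simp [hl]
    have := Nat.mul_le_mul_right L hlen
    refine ⟨[l, l], E, hll, hE, ?_, hw⟩
    rw [act_stateOf hL hll (h.mono (by simp only [List.length_cons, List.length_nil]; omega)),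
      act_stateOf hL hE (h'.mono (by omega)), add_assoc, hw]
  have hd : ∀ m, (Pi.single l 1 : ℕ → ℤ) m = if m = l then 1 else 0 := fun m => by
    rw [Pi.single_apply]
  -- `T_l²` is compared with `T_{l-1} T_{l+1}`; the displacements differ by one for length `l` and
  -- agree for all others. For `l = 1` the trivial factor `T_0` is omitted. At most two steps are
  -- made on each side, each costing `L` of the gaps, which explains `3 * L`.
  rcases Nat.lt_or_ge 1 l with h1 | h1
  · refine key [l - 1, l + 1] (by simp; omega) (by simp) (funext fun m => ?_)
    simp only [disp, Pi.add_apply, hd, speed, Pi.zero_apply]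
    split_ifs <;> omega
  · obtain rfl : l = 1 := by omega
    refine key [2] (by simp) (by simp) (funext fun m => ?_)
    simp only [disp, Pi.add_apply, hd, speed, Pi.zero_apply]
    split_ifs <;> omega

/-- Among the solitons not yet at their target, the rightmost one is moved by one. What lies to its
right is already in its final place, so the gap there is at least the final one; the gap to its left
grows. The total missing displacement decreases. -/
theorem linked_of_le [NeZero N] {v v' : ℕ → ℤ} {L : ℕ} {xs : List (Soliton N)}
    (hL : ∀ x ∈ xs, 1 ≤ x.len ∧ x.len ≤ L) (hne : xs.Pairwise fun x y => x.len ≠ y.len)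
    (h : Spaced v (3 * L) xs) (h' : Spaced v' (3 * L) xs) (hv : ∀ x ∈ xs, v x.len ≤ v' x.len) :
    ∃ w, Linked (stateOf v xs) (stateOf v' xs) w ∧ ∀ x ∈ xs, v' x.len = v x.len + w x.len := by
  classical
  induction hm : (xs.map fun x => (v' x.len - v x.len).toNat).sum using Nat.strong_induction_on
    generalizing v with
  | _ m ih =>
    by_cases hall : ∀ x ∈ xs, v x.len = v' x.len
    · rw [stateOf_congr hall]
      exact ⟨0, Linked.refl _, fun x hx => by rw [hall x hx, Pi.zero_apply, add_zero]⟩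
    · push Not at hall
      obtain ⟨x₀, hx₀, hne₀⟩ := hall
      obtain ⟨x, hx, hmax⟩ := Finset.exists_max_image
        (xs.toFinset.filter fun x => v x.len ≠ v' x.len) (place v)
        ⟨x₀, Finset.mem_filter.2 ⟨List.mem_toFinset.2 hx₀, hne₀⟩⟩
      rw [Finset.mem_filter, List.mem_toFinset] at hx
      obtain ⟨hx, hxv⟩ := hx
      have hlt := lt_of_le_of_ne (hv x hx) hxv
      have hd : ∀ m, (Pi.single x.len 1 : ℕ → ℤ) m = if m = x.len then 1 else 0 := fun m => by
        rw [Pi.single_apply]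
      have hs : Spaced (v + Pi.single x.len 1) (3 * L) xs := by
        refine ⟨fun y hy => ?_, ((hne.and h.2).and h'.2).imp_of_mem fun {a b} ha hb hab => ?_⟩
        · have := h.1 y hy
          rw [place_add, hd]
          split_ifs <;> omega
        · obtain ⟨⟨h1, h2⟩, h3⟩ := hab
          rw [place_add, place_add, hd, hd]
          split_ifs with h4 h5 h5
          · omega
          -- A soliton to the right that had not arrived would contradict the maximality of `x`;
          -- distinct lengths identify `a` with `x`.
          · have h6 : v b.len = v' b.len := by
              by_contra hcon
              have h7 := hmax b (Finset.mem_filter.2 ⟨List.mem_toFinset.2 hb, hcon⟩)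
              have h8 := (hL a ha).1
              have h9 : place v a - place v x = x.pow - a.pow := by rw [place, place, h4]; ring
              have : a = x := by
                by_contra hax
                exact absurd h4 (by
                  rcases List.pairwise_iff_getElem.1 hne with hh
                  obtain ⟨i, hi, rfl⟩ := List.mem_iff_getElem.1 ha
                  obtain ⟨j, hj, rfl⟩ := List.mem_iff_getElem.1 hx
                  rcases lt_trichotomy i j with hij | hij | hij
                  · exact hh i j hi hj hij
                  · subst hij
                    exact absurd rfl hax
                  · exact (hh j i hj hi hij).symm)
              subst this
              omega
            have h7 : place v b = place v' b := place_congr h6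
            have h8 : place v a + 1 ≤ place v' a := by
              rw [place, place, h4]
              omega
            omega
          · omega
          · omega
      have hv1 : ∀ y ∈ xs, (v + Pi.single x.len 1 : ℕ → ℤ) y.len ≤ v' y.len := fun y hy => by
        rw [Pi.add_apply, hd]
        split_ifs with h4
        · rw [h4]
          omega
        · have := hv y hy
          omega
      have hsum : (xs.map fun y => (v' y.len - (v + Pi.single x.len 1 : ℕ → ℤ) y.len).toNat).sum < m := by
        rw [← hm]
        refine List.sum_lt_sum _ _ (fun y hy => ?_) ⟨x, hx, ?_⟩
        · rw [Pi.add_apply, hd]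
          split_ifs <;> omega
        · rw [Pi.add_apply, hd, if_pos rfl]
          omega
      obtain ⟨w, hw1, hw2⟩ := ih _ hsum hs hv1 rfl
      refine ⟨Pi.single x.len 1 + w, (linked_single (fun y hy => (hL y hy).2) (hL x hx).1 h hs).trans
        (two_le_succ N) hw1, fun y hy => ?_⟩
      rw [hw2 y hy, Pi.add_apply, Pi.add_apply, add_assoc]

/-- Any two well separated positions of the same solitons are linked. -/
theorem linked_stateOf [NeZero N] {v v' : ℕ → ℤ} {L : ℕ} {xs : List (Soliton N)}
    (hL : ∀ x ∈ xs, 1 ≤ x.len ∧ x.len ≤ L) (hne : xs.Pairwise fun x y => x.len ≠ y.len)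
    (h : Spaced v (3 * L) xs) (h' : Spaced v' (3 * L) xs) :
    ∃ w, Linked (stateOf v xs) (stateOf v' xs) w ∧ ∀ x ∈ xs, v' x.len = v x.len + w x.len := by
  -- Both placements are pushed forward to their pointwise maximum, which inherits the gaps, and the
  -- second link is inverted.
  have hs : Spaced (v ⊔ v') (3 * L) xs := by
    have e : ∀ x : Soliton N, place (v ⊔ v') x = max (place v x) (place v' x) := fun x => by
      simp only [place, Pi.sup_apply]
      omega
    refine ⟨fun x hx => ?_, (h.2.and h'.2).imp fun {a b} hab => ?_⟩
    · have := h.1 x hx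
      rw [e]
      omega
    · rw [e, e]
      omega
  obtain ⟨w, h1, h2⟩ := linked_of_le hL hne h hs fun x _ => le_sup_left
  obtain ⟨w', h3, h4⟩ := linked_of_le hL hne h' hs fun x _ => le_sup_right
  refine ⟨w + -w', h1.trans (two_le_succ N) h3.symm, fun x hx => ?_⟩
  have := h2 x hx
  have := h4 x hx
  rw [Pi.add_apply, Pi.neg_apply]
  omega

/-- A displacement depends on the length only; as the lengths are distinct, each soliton can still
be placed at will. The induction carries an arbitrary lower bound `M` for the positions. -/
theorem exists_spaced (g : ℕ) {xs : List (Soliton N)} (hne : xs.Pairwise fun x y => x.len ≠ y.len) :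
    ∃ v, Spaced v g xs ∧ ∀ x ∈ xs, (g : ℤ) ≤ place v x := by
  have : ∀ M : ℤ, 1 ≤ M → ∃ v, Spaced v g xs ∧ ∀ x ∈ xs, M ≤ place v x := by
    induction xs with
    | nil => exact fun M _ => ⟨0, ⟨by simp, List.Pairwise.nil⟩, by simp⟩
    | cons x xs ih =>
      intro M hM
      rw [List.pairwise_cons] at hne
      obtain ⟨v, h1, h2⟩ := ih hne.2 (M + x.len + g) (by omega)
      have e : ∀ y ∈ xs, v y.len = Function.update v x.len (M + x.pow) y.len := fun y hy => by
        rw [Function.update_of_ne (hne.1 y hy).symm]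
      have e' : place (Function.update v x.len (M + x.pow)) x = M := by
        rw [place, Function.update_self]
        ring
      refine ⟨Function.update v x.len (M + x.pow), spaced_cons.2 ⟨?_, fun y hy => ?_, h1.congr e⟩, ?_⟩
      · rw [e']
        exact hM
      · rw [e', ← place_congr (e y hy)]
        exact h2 y hy
      · refine List.forall_mem_cons.2 ⟨e'.ge, fun y hy => ?_⟩
        rw [← place_congr (e y hy)]
        have := h2 y hy
        omega
  obtain ⟨v, h, h'⟩ := this (g + 1) (by omega)
  exact ⟨v, h, fun x hx => (by omega : (g : ℤ) ≤ g + 1).trans (h' x hx)⟩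

end isotopy

end BoxBall

namespace BoxBall
open ColorCrystal

/-! ### Collision of two neighbours far from the other solitons -/

section exchange

variable {N : ℕ}

theorem ofWord_append {n : ℕ} [NeZero n] (w w' : List (Fin n)) :
    ofWord (w ++ w') = glue w.length (ofWord w) (ofWord (List.replicate w.length ⊤ ++ w')) := by
  funext i
  simp only [glue, ofWord]
  split_ifs with h
  · rw [List.getD_append _ _ _ _ h]
  · rw [List.getD_append_right _ _ _ _ (not_lt.1 h), List.getD_append_right _ _ _ _ (by simpa using h),
      List.length_replicate]

theorem glue_right_top {n : ℕ} [NeZero n] {a : ℕ} {p : ℕ → Fin n} (h : ∀ i, a ≤ i → p i = ⊤) :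
    glue a p (fun _ => ⊤) = p := by
  funext i
  simp only [glue]
  split_ifs with hi
  · rfl
  · exact (h i (not_lt.1 hi)).symm

theorem stateOf_pair {v : ℕ → ℤ} {x y : Soliton N} {α d : ℕ} (hα : place v x = α + 1)
    (hd : place v y = place v x + x.len + d) :
    stateOf v [x, y] = ofWord (twoWord α x.label d y.label) := by
  have h1 : twoWord α x.label d y.label =
      oneWord α x.label ++ (List.replicate d ⊤ ++ rowWord y.label) := by
    rw [twoWord, oneWord, List.append_assoc]
  have h2 : (oneWord α x.label).length = α + x.len := by
    rw [oneWord, List.length_append, List.length_replicate, rowWord_length]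
  rw [h1, ofWord_append, h2, replicate_merge]
  simp only [stateOf]
  rw [glue_right_top fun i => singleState_of_endpoint_le, endpoint, singleState, singleState,
    show (place v x - 1).toNat = α by omega, show (place v y - 1).toNat = α + x.len + d by omega]
  rfl

theorem place_replicate (v : ℕ → ℤ) (s r : ℕ) (x : Soliton N) :
    place (v + disp (List.replicate s r)) x = place v x + s * speed r x.len := by
  rw [place_add, disp_replicate]

/-- The exchange of two neighbours that are far from the other solitons. -/
theorem iterate_evolFin_exchange [NeZero N] {v : ℕ → ℤ} {L M s : ℕ} {us vs : List (Soliton N)}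
    {x y : Soliton N} (hL : ∀ z ∈ us ++ x :: y :: vs, z.len ≤ L) (hlt : y.len < x.len)
    (hs : s = 7 * L) (hM : M = 2 * (s * L) + 2 * s + 10 * L)
    (hus : Spaced v M us) (hvs : Spaced v M vs) (hx : (M : ℤ) ≤ place v x)
    (hux : ∀ u ∈ us, place v u + (u.len : ℤ) + (M : ℤ) ≤ place v x)
    (hxy : place v y = place v x + x.len + (3 * L : ℕ))
    (hyv : ∀ z ∈ vs, place v y + (y.len : ℤ) + (M : ℤ) ≤ place v z) :
    (evolFin (y.len + 1))^[s] (stateOf v (us ++ x :: y :: vs)) =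
      stateOf (v + disp (List.replicate s (y.len + 1)))
        (us ++ (twoBody x y).1 :: (twoBody x y).2 :: vs) ∧
    Spaced (v + disp (List.replicate s (y.len + 1))) (3 * L)
      (us ++ (twoBody x y).1 :: (twoBody x y).2 :: vs) := by
  have hn := two_le_succ N
  simp only [List.forall_mem_append, List.forall_mem_cons] at hL
  obtain ⟨hLu, hLx, hLy, hLv⟩ := hL
  obtain ⟨k, hk, hE, hdyn⟩ := twoWord_iterate hlt (x.label, y.label)
  set r := y.len + 1 with hr
  set v' := v + disp (List.replicate s r) with hv'
  set y' := (twoBody x y).1 with hy'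
  set x' := (twoBody x y).2 with hx'
  have ly : y'.len = y.len := rfl
  have lx : x'.len = x.len := rfl
  have hpl : ∀ z : Soliton N, place v' z = place v z + s * speed r z.len := place_replicate v s r
  have hpos : ∀ l, (0 : ℤ) ≤ s * speed r l := fun l =>
    mul_nonneg (Int.natCast_nonneg _) (speed_nonneg _ _)
  have hrL : r ≤ L := by omega
  have hSr : ((s * r : ℕ) : ℤ) ≤ ((s * L : ℕ) : ℤ) := by
    exact_mod_cast Nat.mul_le_mul_left s hrL
  have hle : ∀ l, (s : ℤ) * speed r l ≤ ((s * r : ℕ) : ℤ) := fun l => by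
    rw [Nat.cast_mul]
    refine mul_le_mul_of_nonneg_left ?_ (Int.natCast_nonneg _)
    rw [speed]
    omega
  have hsr : s * r = s * y.len + s := Nat.mul_succ _ _
  have py : place v' y' = place v y + (s * y.len : ℕ) - 2 * y.len + k := by
    have h1 : place v' y' = place v' y - phaseShift x.label y.label := by
      simp only [place, hy', twoBody]
      ring
    rw [h1, hpl, phaseShift, hE, speed, show min r y.len = y.len by omega, Nat.cast_mul]
    ring
  have px : place v' x' = place v x + (s * r : ℕ) + 2 * y.len - k := by
    have h1 : place v' x' = place v' x + phaseShift x.label y.label := by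
      simp only [place, hx', twoBody]
      ring
    rw [h1, hpl, phaseShift, hE, speed, show min r x.len = r by omega, Nat.cast_mul]
    ring
  have hrep : ∀ j ∈ List.replicate s r, 1 ≤ j := fun j hj => by
    rw [List.eq_of_mem_replicate hj]
    omega
  have hlen : (List.replicate s r).length = s := List.length_replicate
  have free : ∀ zs : List (Soliton N), (∀ z ∈ zs, z.len ≤ L) → Spaced v M zs →
      (evolFin r)^[s] (stateOf v zs) = stateOf v' zs ∧ Spaced v' (3 * L) zs := by
    intro zs hz h
    rw [← act_replicate]
    exact ⟨act_stateOf hz hrep (h.mono (by rw [hlen]; omega)),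
      (h.mono (by rw [hlen]; omega)).add_disp hz _⟩
  obtain ⟨fu, su⟩ := free us hLu hus
  obtain ⟨fv, sv⟩ := free vs hLv hvs
  -- Starting from the gap `3L`, the final gap is `s + 3 l₂ - l₁ - 3L - 2k`. With `s = 7L`, `l₁ ≤ L`
  -- and `k ≤ l₂` it is again at least `3L`, and `s` is long enough for the collision to be over.
  have fxy : (evolFin r)^[s] (stateOf v [x, y]) = stateOf v' [y', x'] := by
    obtain ⟨α, hα⟩ : ∃ α : ℕ, place v x = α + 1 := ⟨(place v x - 1).toNat, by omega⟩
    obtain ⟨α', hα'⟩ : ∃ α' : ℕ, place v' y' = α' + 1 := ⟨(place v' y' - 1).toNat, by omega⟩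
    obtain ⟨d', hd'⟩ : ∃ d' : ℕ, place v' x' = place v' y' + y'.len + d' :=
      ⟨(place v' x' - place v' y' - y'.len).toNat, by omega⟩
    rw [stateOf_pair hα hxy, stateOf_pair hα' hd']
    exact hdyn α (3 * L) s α' d' (by omega) (by omega) (by omega) (by omega)
  constructor
  -- The state is cut in front of `x` and well beyond `y`. The distance `M` ensures that in `s`
  -- steps no letter crosses either cut, and the same cuts serve for the final state.
  · have e1 : stateOf v (us ++ x :: y :: vs) = glue (place v x - 1).toNat (stateOf v us)
        (glue (endpoint v y + s * r) (stateOf v [x, y]) (stateOf v vs)) := by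
      rw [← stateOf_append (g := 0) (xs := [x, y]) (ys := vs), ← stateOf_append hus]
      · rfl
      · intro u hu
        have := hux u hu
        have := hus.1 u hu
        rw [endpoint]
        omega
      · intro z hz
        rcases List.mem_append.1 hz with hz | hz
        · simp only [List.mem_cons, List.not_mem_nil, or_false] at hz
          rcases hz with rfl | rfl <;> omega
        · have := hyv z hz
          omega
      · simp only [spaced_cons, List.mem_cons, List.not_mem_nil, or_false, forall_eq]
        refine ⟨by omega, by omega, by omega, by simp, by simp, List.Pairwise.nil⟩
      · simp only [List.mem_cons, List.not_mem_nil, or_false, endpoint]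
        rintro z (rfl | rfl) <;> omega
      · intro z hz
        have := hyv z hz
        rw [endpoint]
        omega
    have e2 : stateOf v' (us ++ y' :: x' :: vs) = glue (place v x - 1).toNat (stateOf v' us)
        (glue (endpoint v y + s * r) (stateOf v' [y', x']) (stateOf v' vs)) := by
      rw [← stateOf_append (g := 0) (xs := [y', x']) (ys := vs), ← stateOf_append su]
      · rfl
      · intro u hu
        have := hux u hu
        have := hus.1 u hu
        have := hle u.len
        rw [endpoint, hpl]
        omega
      · intro z hz
        rcases List.mem_append.1 hz with hz | hz
        · simp only [List.mem_cons, List.not_mem_nil, or_false] at hz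
          rcases hz with rfl | rfl <;> omega
        · have := hyv z hz
          have := hpos z.len
          rw [hpl]
          omega
      · simp only [spaced_cons, List.mem_cons, List.not_mem_nil, or_false, forall_eq]
        refine ⟨by omega, by omega, by omega, by simp, by simp, List.Pairwise.nil⟩
      · simp only [List.mem_cons, List.not_mem_nil, or_false, endpoint]
        rintro z (rfl | rfl) <;> omega
      · intro z hz
        have := hyv z hz
        have := hpos z.len
        rw [endpoint, hpl]
        omega
    have e3 := iterate_evolFin_glue hn (l := r) (a := endpoint v y + s * r) (R := endpoint v y)
      (p := stateOf v [x, y]) (q := stateOf v vs)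
      (fun i hi => stateOf_of_endpoint_le (by
        simp only [List.mem_cons, List.not_mem_nil, or_false]
        simp only [endpoint] at hi
        rintro z (rfl | rfl) <;> rw [endpoint] <;> omega))
      (fun i hi => stateOf_of_lt fun z hz => by
        have := hyv z hz
        rw [endpoint] at hi
        omega) s le_rfl
    -- The letters of `us` end at least `s * r` components before the cut; the bound `hx` prevents
    -- the subtraction from truncating.
    have e4 := iterate_evolFin_glue hn (l := r) (a := (place v x - 1).toNat)
      (R := (place v x - 1).toNat - s * r) (p := stateOf v us)
      (q := glue (endpoint v y + s * r) (stateOf v [x, y]) (stateOf v vs))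
      (fun i hi => stateOf_of_endpoint_le fun u hu => by
        have := hux u hu
        have := hus.1 u hu
        rw [endpoint]
        omega)
      (fun i hi => by
        simp only [glue]
        split_ifs
        · refine stateOf_of_lt ?_
          simp only [List.mem_cons, List.not_mem_nil, or_false]
          rintro z (rfl | rfl) <;> omega
        · refine stateOf_of_lt fun z hz => ?_
          have := hyv z hz
          omega) s (by omega)
    rw [e1, e4.1, e3.1, fu, fv, fxy, e2]
  · rw [spaced_append, spaced_cons, spaced_cons, List.forall_mem_cons]
    refine ⟨su, ⟨by omega, ⟨by omega, fun z hz => ?_⟩, by omega, fun z hz => ?_, sv⟩, fun u hu => ?_⟩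
    · have := hyv z hz
      have := hpos z.len
      rw [hpl z]
      omega
    · have := hyv z hz
      have := hpos z.len
      rw [hpl z]
      omega
    · have h1 := hux u hu
      have h2 := hle u.len
      refine List.forall_mem_cons.2 ⟨?_, List.forall_mem_cons.2 ⟨?_, fun z hz => ?_⟩⟩
      · rw [hpl u]
        omega
      · rw [hpl u]
        omega
      · have := hyv z hz
        have := hpos z.len
        rw [hpl u, hpl z]
        omega

end exchange

end BoxBall

namespace BoxBall
open ColorCrystal

/-! ### Two body maps realized by flows, and the state at late times -/

section scattering

variable {N : ℕ}

theorem TwoBodyStep.perm [NeZero N] {xs zs : List (Soliton N)} (h : TwoBodyStep xs zs) :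
    (zs.map Soliton.len).Perm (xs.map Soliton.len) := by
  obtain ⟨us, vs, x, y, h⟩ := h
  simp only [List.map_append, List.map_cons]
  exact (List.Perm.swap _ _ _).append_left _

/-- Each two body scattering is realized by time evolutions and their inverses. -/
theorem TwoBodyStep.linked [NeZero N] {v : ℕ → ℤ} {L : ℕ} {xs zs : List (Soliton N)}
    (hL : ∀ l ∈ xs.map Soliton.len, 1 ≤ l ∧ l ≤ L) (hne : (xs.map Soliton.len).Nodup)
    (h : Spaced v (3 * L) xs) (hstep : TwoBodyStep xs zs) :
    ∃ v' w, Spaced v' (3 * L) zs ∧ Linked (stateOf v xs) (stateOf v' zs) w ∧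
      ∀ l ∈ xs.map Soliton.len, v' l = v l + w l := by
  obtain ⟨us, vs, x, y, hlt⟩ := hstep
  have hne' : (us ++ x :: y :: vs).Pairwise fun a b => a.len ≠ b.len := List.pairwise_map.1 hne
  have hL' : ∀ z ∈ us ++ x :: y :: vs, 1 ≤ z.len ∧ z.len ≤ L := fun z hz =>
    hL _ (List.mem_map_of_mem hz)
  -- The bound is the `M` of `iterate_evolFin_exchange` for `s = 7 * L`.
  obtain ⟨v₀, h0, hpos⟩ := exists_spaced (2 * (7 * L * L) + 2 * (7 * L) + 10 * L) hne'
  set M := 2 * (7 * L * L) + 2 * (7 * L) + 10 * L with hM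
  -- All solitons are first far apart; then `y` alone is brought to distance `3L` behind the end of
  -- `x`.
  set v₁ := Function.update v₀ y.len (place v₀ x + x.len + (3 * L : ℕ) + y.pow) with hv₁
  have py : place v₁ y = place v₀ x + x.len + (3 * L : ℕ) := by
    rw [place, hv₁, Function.update_self]
    ring
  have pz : ∀ z : Soliton N, z.len ≠ y.len → v₀ z.len = v₁ z.len := fun z hz => by
    rw [hv₁, Function.update_of_ne hz]
  have px := place_congr (pz x hlt.ne')
  rw [List.pairwise_append, List.pairwise_cons, List.pairwise_cons] at hne'
  obtain ⟨-, ⟨-, n1, -⟩, n2⟩ := hne'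
  rw [spaced_append, spaced_cons, spaced_cons] at h0
  obtain ⟨hu0, ⟨hx0, hxy0, hy0, hyv0, hv0⟩, hu1⟩ := h0
  have huy : ∀ u ∈ us, v₀ u.len = v₁ u.len := fun u hu => pz u (n2 u hu y (by simp))
  have hvy : ∀ z ∈ vs, v₀ z.len = v₁ z.len := fun z hz => pz z (n1 z hz).symm
  have hus := hu0.congr huy
  have hvs := hv0.congr hvy
  have hx : (M : ℤ) ≤ place v₁ x := px ▸ hpos x (by simp)
  have hux : ∀ u ∈ us, place v₁ u + (u.len : ℤ) + (M : ℤ) ≤ place v₁ x := fun u hu => by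
    rw [← place_congr (huy u hu), ← px]
    exact hu1 u hu x (by simp)
  have hyx := hxy0 y (by simp)
  have hyv : ∀ z ∈ vs, place v₁ y + (y.len : ℤ) + (M : ℤ) ≤ place v₁ z := fun z hz => by
    have := hyv0 z hz
    rw [← place_congr (hvy z hz), py]
    omega
  have hxy : place v₁ y = place v₁ x + x.len + (3 * L : ℕ) := by rw [py, px]
  have h1 : Spaced v₁ (3 * L) (us ++ x :: y :: vs) := by
    have hm : 3 * L ≤ M := by omega
    have lx := (hL' x (by simp)).1
    have ly := (hL' y (by simp)).1
    rw [spaced_append, spaced_cons, spaced_cons, List.forall_mem_cons]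
    refine ⟨hus.mono hm, ⟨by omega, ⟨by omega, fun z hz => ?_⟩, by omega, fun z hz => ?_,
      hvs.mono hm⟩, fun u hu => ?_⟩
    · have := hyv z hz
      omega
    · have := hyv z hz
      omega
    · have := hux u hu
      refine List.forall_mem_cons.2 ⟨by omega, List.forall_mem_cons.2 ⟨by omega, fun z hz => ?_⟩⟩
      have := hyv z hz
      omega
  obtain ⟨e1, e2⟩ := iterate_evolFin_exchange (fun z hz => (hL' z hz).2) hlt rfl hM hus hvs hx hux
    hxy hyv
  obtain ⟨w, hw1, hw2⟩ := linked_stateOf hL' (List.pairwise_map.1 hne) h h1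
  have hact := Linked.act (F := List.replicate (7 * L) (y.len + 1))
    (fun j hj => by rw [List.eq_of_mem_replicate hj]; omega) (stateOf v₁ (us ++ x :: y :: vs))
  rw [act_replicate, e1] at hact
  refine ⟨_, _, e2, hw1.trans (two_le_succ N) hact, fun l hl => ?_⟩
  obtain ⟨z, hz, rfl⟩ := List.mem_map.1 hl
  rw [Pi.add_apply, Pi.add_apply, hw2 z hz, add_assoc]

theorem perm_of_reflTransGen [NeZero N] {xs zs : List (Soliton N)}
    (h : Relation.ReflTransGen TwoBodyStep xs zs) :
    (zs.map Soliton.len).Perm (xs.map Soliton.len) := by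
  induction h with
  | refl => exact List.Perm.refl _
  | tail _ h ih => exact h.perm.trans ih

/-- The equation `v' l = v l + w l` records that the placement changes only by the displacement of
the flows used: the phase shifts are carried entirely by the exponents in `zs`. -/
theorem linked_of_reflTransGen [NeZero N] {v : ℕ → ℤ} {L : ℕ} {xs zs : List (Soliton N)}
    (hL : ∀ l ∈ xs.map Soliton.len, 1 ≤ l ∧ l ≤ L) (hne : (xs.map Soliton.len).Nodup)
    (h : Spaced v (3 * L) xs) (hstep : Relation.ReflTransGen TwoBodyStep xs zs) :
    ∃ v' w, Spaced v' (3 * L) zs ∧ Linked (stateOf v xs) (stateOf v' zs) w ∧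
      ∀ l ∈ xs.map Soliton.len, v' l = v l + w l := by
  induction hstep with
  | refl => exact ⟨v, 0, h, Linked.refl _, fun l _ => by rw [Pi.zero_apply, add_zero]⟩
  | tail hs hstep ih =>
    obtain ⟨v₁, w₁, h1, h2, h3⟩ := ih
    have hp := perm_of_reflTransGen hs
    obtain ⟨v₂, w₂, g1, g2, g3⟩ := hstep.linked (fun l hl => hL l (hp.mem_iff.1 hl))
      (hp.nodup_iff.2 hne) h1
    refine ⟨v₂, w₁ + w₂, g1, h2.trans (two_le_succ N) g2, fun l hl => ?_⟩
    rw [g3 l (hp.mem_iff.2 hl), h3 l hl, Pi.add_apply, add_assoc]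

/-! ### Free motion of sorted solitons -/

theorem Spaced.add_sorted {v : ℕ → ℤ} {g : ℕ} {ys : List (Soliton N)} (h : Spaced v g ys)
    (hs : ys.Pairwise fun a b => a.len < b.len) (k : ℕ) : Spaced (v + speed k) g ys := by
  refine ⟨fun x hx => ?_, (h.2.and hs).imp fun {a b} hab => ?_⟩
  · have := h.1 x hx
    have := speed_nonneg k x.len
    rw [place_add]
    omega
  · have h1 := hab.2
    have h2 := hab.1
    rw [place_add, place_add, speed, speed]
    omega

theorem iterate_evolFin_sorted [NeZero N] {k : ℕ} (hk : 1 ≤ k) {v : ℕ → ℤ} {L : ℕ}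
    {ys : List (Soliton N)} (hL : ∀ x ∈ ys, x.len ≤ L) (h : Spaced v L ys)
    (hs : ys.Pairwise fun a b => a.len < b.len) (t : ℕ) :
    (evolFin k)^[t] (stateOf v ys) = stateOf (v + disp (List.replicate t k)) ys := by
  induction t generalizing v with
  | zero => rw [List.replicate_zero, disp, add_zero, Function.iterate_zero, id]
  | succ t ih =>
    rw [Function.iterate_succ_apply, evolFin_stateOf hk hL h, ih (h.add_sorted hs k),
      List.replicate_succ, disp, add_assoc]

/-- If the shorter one of two lengths is below `k`, then the two speeds differ by at least one. This
is where `r > l_j` for `j ≥ 2` is needed. -/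
theorem eventually_spaced {k : ℕ} (hk : 1 ≤ k) (v : ℕ → ℤ) (g : ℕ) {ys : List (Soliton N)}
    (hL : ∀ x ∈ ys, 1 ≤ x.len) (hs : ys.Pairwise fun a b => a.len < b.len ∧ a.len < k) :
    ∀ᶠ t in Filter.atTop, Spaced (v + disp (List.replicate t k)) g ys := by
  have hp : ∀ x : Soliton N, 1 ≤ x.len → ∀ᶠ t : ℕ in Filter.atTop,
      1 ≤ place (v + disp (List.replicate t k)) x := fun x hx => by
    filter_upwards [Filter.eventually_ge_atTop (1 - place v x).toNat] with t ht
    have h1 : (1 : ℤ) ≤ speed k x.len := by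
      rw [speed]
      omega
    have h2 := mul_le_mul_of_nonneg_left h1 (Int.natCast_nonneg t)
    rw [place_replicate]
    omega
  have hg : ∀ x y : Soliton N, x.len < y.len ∧ x.len < k → ∀ᶠ t : ℕ in Filter.atTop,
      place (v + disp (List.replicate t k)) x + (x.len : ℤ) + (g : ℤ) ≤
        place (v + disp (List.replicate t k)) y := fun x y hxy => by
    filter_upwards [Filter.eventually_ge_atTop (place v x + x.len + g - place v y).toNat] with t ht
    have h1 : speed k x.len + 1 ≤ speed k y.len := by
      rw [speed, speed]
      omega
    have h2 := mul_le_mul_of_nonneg_left h1 (Int.natCast_nonneg t)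
    rw [mul_add, mul_one] at h2
    rw [place_replicate, place_replicate]
    omega
  induction ys with
  | nil => exact Filter.Eventually.of_forall fun t => ⟨by simp, List.Pairwise.nil⟩
  | cons x ys ih =>
    rw [List.forall_mem_cons] at hL
    rw [List.pairwise_cons] at hs
    have hall : ∀ᶠ t : ℕ in Filter.atTop, ∀ y ∈ ys,
        place (v + disp (List.replicate t k)) x + (x.len : ℤ) + (g : ℤ) ≤
          place (v + disp (List.replicate t k)) y :=
      (Set.Finite.eventually_all (List.finite_toSet ys)).2 fun y hy => hg x y (hs.1 y hy)
    filter_upwards [hp x hL.1, hall, ih hL.2 hs.2] with t h1 h2 h3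
    exact spaced_cons.2 ⟨h1, h2, h3⟩

/-- The state after the scattering. -/
theorem eventually_stateOf [NeZero N] {v : ℕ → ℤ} {L k : ℕ} (hk : 1 ≤ k) {xs ys : List (Soliton N)}
    (hL : ∀ l ∈ xs.map Soliton.len, 1 ≤ l ∧ l ≤ L) (hne : (xs.map Soliton.len).Nodup)
    (h : Spaced v (3 * L) xs) (hstep : Relation.ReflTransGen TwoBodyStep xs ys)
    (hs : ys.Pairwise fun a b => a.len < b.len ∧ a.len < k) (g : ℕ) :
    ∀ᶠ t in Filter.atTop, (evolFin k)^[t] (stateOf v xs) =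
      stateOf (v + disp (List.replicate t k)) ys ∧ Spaced (v + disp (List.replicate t k)) g ys := by
  have hn := two_le_succ N
  obtain ⟨v', w, h1, ⟨F, E, hF, hE, h2, hw⟩, h3⟩ := linked_of_reflTransGen hL hne h hstep
  have hp := perm_of_reflTransGen hstep
  have hLy : ∀ y ∈ ys, 1 ≤ y.len ∧ y.len ≤ L := fun y hy =>
    hL _ (hp.mem_iff.1 (List.mem_map_of_mem hy))
  have hLy1 : ∀ y ∈ ys, 1 ≤ y.len := fun y hy => (hLy y hy).1
  have hLy2 : ∀ y ∈ ys, y.len ≤ L := fun y hy => (hLy y hy).2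
  -- The time must be large enough for `E` to act by free motion on the placement from `v'`, and `F`
  -- on the one from `v`.
  filter_upwards [eventually_spaced hk v' (L + E.length * L) hLy1 hs,
    eventually_spaced hk v (L + F.length * L) hLy1 hs, eventually_spaced hk v g hLy1 hs]
    with t g1 g2 g3
  refine ⟨?_, g3⟩
  have hfin : FinState ((evolFin k)^[t] (stateOf v xs)) := by
    rw [← act_replicate]
    exact (stateOf_finState v xs).act hn _
  -- After applying `F`, the left side becomes `E` applied to freely moving `ys` placed by `v'`, the
  -- right side `F` applied to `ys` placed by `v`. They agree because `v' = v + w` on the lengths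
  -- and `w + disp E = disp F`.
  refine act_injective hn hfin (stateOf_finState _ _) (F := F) ?_
  rw [act_stateOf hLy2 hF g2, ← act_replicate, act_comm hn, h2, act_comm hn, act_replicate,
    iterate_evolFin_sorted hk hLy2 (h1.mono (by omega)) (hs.imp fun h => h.1), act_stateOf hLy2 hE g1]
  refine stateOf_congr fun y hy => ?_
  have e1 := h3 y.len (hp.mem_iff.1 (List.mem_map_of_mem hy))
  have e2 := congrFun hw y.len
  simp only [Pi.add_apply] at e2 ⊢
  omega

/-! ### A state determines its solitons -/

theorem rowWord_injective {l : ℕ} {b b' : Row N l} (h : rowWord b = rowWord b') : b = b' := by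
  have h1 := congrArg (fun w : List (Fin (N + 1)) => (w : Multiset (Fin (N + 1)))) h
  simp only [rowWord_coe] at h1
  exact Subtype.ext (Multiset.map_injective (Fin.castSucc_injective N) h1)

theorem exists_word_get (x : Soliton N) {j : ℕ} (hj : j < x.len) :
    ∃ a, x.word[j]? = some a ∧ a ≠ ⊤ := by
  have hlen : x.word.length = x.len := rowWord_length x.label
  refine ⟨x.word[j]'(by omega), List.getElem?_eq_getElem _, fun h => ?_⟩
  have : x.word[j]'(by omega) ∈ x.word := List.getElem_mem _
  rw [h, Soliton.word] at this
  obtain ⟨i, _, hi⟩ := List.mem_map.1 this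
  exact (Fin.castSucc_lt_last i).ne hi

theorem stateOf_of_mem {v : ℕ → ℤ} {g : ℕ} {xs : List (Soliton N)} (h : Spaced v g xs)
    {x : Soliton N} (hx : x ∈ xs) {i j : ℕ} (hij : (i : ℤ) + 1 = place v x + j)
    {a : Fin (N + 1)} (ha : x.word[j]? = some a) : stateOf v xs i = a := by
  have hj : j < x.len := by
    have := (List.getElem?_eq_some_iff.1 ha).1
    rwa [show x.word.length = x.len from rowWord_length x.label] at this
  induction xs with
  | nil => exact absurd hx List.not_mem_nil
  | cons y ys ih =>
    rw [spaced_cons] at h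
    simp only [stateOf, glue]
    rcases List.mem_cons.1 hx with rfl | hx
    · rw [if_pos (by rw [endpoint]; omega)]
      exact singleState_of_mem h.1 hij ha
    · have := h.2.1 x hx
      rw [if_neg (by rw [endpoint]; omega)]
      exact ih h.2.2 hx

theorem stateOf_of_outside {v : ℕ → ℤ} {xs : List (Soliton N)} {i : ℕ}
    (h0 : ∀ x ∈ xs, 1 ≤ place v x)
    (h : ∀ x ∈ xs, (i : ℤ) + 1 < place v x ∨ place v x + (x.len : ℤ) ≤ (i : ℤ) + 1) :
    stateOf v xs i = ⊤ := by
  induction xs with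
  | nil => rfl
  | cons x xs ih =>
    rw [List.forall_mem_cons] at h0 h
    simp only [stateOf, glue]
    split_ifs with hi
    · refine singleState_of_lt ?_
      have := h.1
      rw [endpoint] at hi
      omega
    · exact ih h0.2 h.2

/-- The first letter different from `n` locates the leftmost soliton, whose length is known; its
letters give the label. It is then cut off and the argument repeated. -/
theorem stateOf_injective {v : ℕ → ℤ} {g : ℕ} {ys zs : List (Soliton N)}
    (hlen : ys.map Soliton.len = zs.map Soliton.len) (hL : ∀ l ∈ ys.map Soliton.len, 1 ≤ l)
    (hy : Spaced v g ys) (hz : Spaced v g zs) (h : stateOf v ys = stateOf v zs) : ys = zs := by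
  induction ys generalizing zs with
  | nil => rw [List.map_nil, eq_comm, List.map_eq_nil_iff] at hlen; exact hlen.symm
  | cons y ys ih =>
    cases zs with
    | nil => simp at hlen
    | cons z zs =>
      simp only [List.map_cons, List.cons.injEq] at hlen
      rw [List.map_cons, List.forall_mem_cons] at hL
      have aux : ∀ {y z : Soliton N} {ys zs : List (Soliton N)}, 1 ≤ y.len →
          Spaced v g (y :: ys) → Spaced v g (z :: zs) →
          stateOf v (y :: ys) = stateOf v (z :: zs) → place v z ≤ place v y := by
        intro y z ys zs h1 hy hz h
        by_contra hlt
        obtain ⟨a, ha, hne⟩ := exists_word_get y (j := 0) h1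
        have hpy := hy.1 y (by simp)
        obtain ⟨i, hi⟩ : ∃ i : ℕ, (i : ℤ) + 1 = place v y := ⟨(place v y - 1).toNat, by omega⟩
        have e1 := stateOf_of_mem hy (by simp) (i := i) (j := 0) (by simpa using hi) ha
        rw [h, stateOf_of_lt] at e1
        · exact hne e1.symm
        · rw [spaced_cons] at hz
          refine List.forall_mem_cons.2 ⟨by omega, fun u hu => ?_⟩
          have := hz.2.1 u hu
          omega
      have hplace := le_antisymm (aux (hlen.1 ▸ hL.1) hz hy h.symm) (aux hL.1 hy hz h)
      have hword : y.word = z.word := by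
        have ly : y.word.length = y.len := rowWord_length y.label
        have lz : z.word.length = z.len := rowWord_length z.label
        refine List.ext_getElem? fun j => ?_
        rcases Nat.lt_or_ge j y.len with hj | hj
        · obtain ⟨a, ha, -⟩ := exists_word_get y hj
          obtain ⟨b, hb, -⟩ := exists_word_get z (hlen.1 ▸ hj)
          have hpy := hy.1 y (by simp)
          obtain ⟨i, hi⟩ : ∃ i : ℕ, (i : ℤ) + 1 = place v y + j :=
            ⟨(place v y + j - 1).toNat, by omega⟩
          rw [ha, hb, ← stateOf_of_mem hy (by simp) hi ha, h,
            stateOf_of_mem hz (by simp) (by omega) hb]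
        · rw [List.getElem?_eq_none (by omega), List.getElem?_eq_none (by omega)]
      have hyz : y = z := by
        obtain ⟨l, c, b⟩ := y
        obtain ⟨l', c', b'⟩ := z
        obtain ⟨h1, -⟩ := hlen
        simp only at h1
        subst h1
        have : b = b' := rowWord_injective hword
        subst this
        simp only [place] at hplace
        obtain rfl : c = c' := by omega
        rfl
      subst hyz
      rw [spaced_cons] at hy hz
      rw [ih hlen.2 hL.2 hy.2.2 hz.2.2]
      funext i
      have hi := congrFun h i
      simp only [stateOf, glue] at hi
      by_cases hc : i < endpoint v y
      · rw [stateOf_of_lt, stateOf_of_lt]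
        · intro u hu
          have := hz.2.1 u hu
          rw [endpoint] at hc
          omega
        · intro u hu
          have := hy.2.1 u hu
          rw [endpoint] at hc
          omega
      · rwa [if_neg hc, if_neg hc] at hi

end scattering

end BoxBall

namespace BoxBall
open ColorCrystal

/-! ### Scattering in terms of displayed states, sorting, and independence of the order -/

section main

variable {N : ℕ}

/-- The displacement of solitons at time `t` under `T_r`. -/
noncomputable def clock (r : ℕ∞) (t : ℕ) (l : ℕ) : ℤ := ((min r (l : ℕ∞)).toNat : ℤ) * t

theorem displays_stateOf {r : ℕ∞} {t g : ℕ} {xs : List (Soliton N)}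
    (h : Spaced (clock r t) g xs) : Displays r t g (stateOf (clock r t) xs) xs :=
  ⟨h.1, h.2, fun _ hx _ _ ha _ hi => stateOf_of_mem h hx hi ha,
    fun _ hi => stateOf_of_outside h.1 hi⟩

theorem Displays.eq_stateOf {r : ℕ∞} {t g : ℕ} {p : ℕ → Fin (N + 1)} {xs : List (Soliton N)}
    (h : Displays r t g p xs) : Spaced (clock r t) g xs ∧ p = stateOf (clock r t) xs := by
  have hs : Spaced (clock r t) g xs := ⟨h.1, h.2.1⟩
  refine ⟨hs, funext fun i => ?_⟩
  obtain ⟨h1, -, h3, h4⟩ := h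
  by_cases hi : ∀ x ∈ xs, (i : ℤ) + 1 < x.position r t ∨ x.position r t + (x.len : ℤ) ≤ (i : ℤ) + 1
  · rw [h4 i hi, stateOf_of_outside h1 hi]
  · push Not at hi
    obtain ⟨x, hx, h5, h6⟩ := hi
    obtain ⟨j, hj⟩ : ∃ j : ℕ, (i : ℤ) + 1 = x.position r t + j :=
      ⟨((i : ℤ) + 1 - x.position r t).toNat, by omega⟩
    obtain ⟨a, ha, -⟩ := exists_word_get x (j := j) (by omega)
    rw [h3 x hx j a ha i hj, stateOf_of_mem hs hx hj ha]

theorem clock_coe (k t : ℕ) : clock k t = disp (List.replicate t k) := by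
  rw [disp_replicate]
  funext l
  have : min (k : ℕ∞) (l : ℕ∞) = ((min k l : ℕ) : ℕ∞) := by
    rcases Nat.le_total k l with h | h
    · rw [min_eq_left h, min_eq_left (by exact_mod_cast h)]
    · rw [min_eq_right h, min_eq_right (by exact_mod_cast h)]
  rw [clock, this, ENat.toNat_natCast, mul_comm, speed]

theorem clock_top {k t l : ℕ} (h : l ≤ k) : clock ⊤ t l = disp (List.replicate t k) l := by
  rw [disp_replicate, clock, min_eq_right le_top, ENat.toNat_natCast, mul_comm]
  simp only [speed, min_eq_right h]

theorem clock_zero (r : ℕ∞) : clock r 0 = 0 :=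
  funext fun _ => mul_zero _

/-- All finite and infinite `r` reduce to one finite capacity `k`. The gap `3 * L` is the one needed
by `linked_single`, and does not depend on `r`. -/
theorem scatters_of_reflTransGen [NeZero N] {L : ℕ} {r : ℕ∞} (hr : 0 < r)
    {xs ys : List (Soliton N)} (hL : ∀ l ∈ xs.map Soliton.len, 1 ≤ l ∧ l ≤ L)
    (hne : (xs.map Soliton.len).Nodup) (hstep : Relation.ReflTransGen TwoBodyStep xs ys)
    (hs : ys.Pairwise fun a b => a.len < b.len ∧ (a.len : ℕ∞) < r) : Scatters r (3 * L) xs ys := by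
  intro p hp g
  obtain ⟨hsp, rfl⟩ := hp.eq_stateOf
  have hmem : ∀ y ∈ ys, y.len ≤ L := fun y hy =>
    (hL _ ((perm_of_reflTransGen hstep).mem_iff.1 (List.mem_map_of_mem hy))).2
  rw [clock_zero] at hsp ⊢
  suffices h : ∃ k : ℕ, 1 ≤ k ∧ (∀ a : Soliton N, (a.len : ℕ∞) < r → a.len ≤ L → a.len < k) ∧
      (∀ t, (evol r)^[t] (stateOf 0 xs) = (evolFin k)^[t] (stateOf 0 xs)) ∧
      ∀ t, ∀ y ∈ ys, clock r t y.len = disp (List.replicate t k) y.len by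
    obtain ⟨k, hk, h1, h2, h3⟩ := h
    have hs' : ys.Pairwise fun a b => a.len < b.len ∧ a.len < k :=
      hs.imp_of_mem fun {a b} ha _ hab => ⟨hab.1, h1 a hab.2 (hmem a ha)⟩
    filter_upwards [eventually_stateOf hk hL hne hsp hstep hs' g] with t ht
    rw [zero_add] at ht
    have hc : ∀ y ∈ ys, disp (List.replicate t k) y.len = clock r t y.len := fun y hy =>
      (h3 t y hy).symm
    rw [h2, ht.1, stateOf_congr hc]
    exact displays_stateOf (ht.2.congr hc)
  induction r using ENat.recTopCoe with
  | top =>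
    -- For `r = ∞` the capacity exceeds the number of letters different from `n`, so the evolutions
    -- agree, and also all lengths, so the speeds agree.
    obtain ⟨m, hm⟩ := (stateOf_finState 0 xs).exists_ballCount_le
    exact ⟨max (m + 1) (L + 1), by omega, fun a _ ha => by omega,
      fun t => iterate_evol_top (two_le_succ N) hm (by omega) t,
      fun t y hy => clock_top (by have := hmem y hy; omega)⟩
  | coe k =>
    exact ⟨k, by exact_mod_cast hr, fun a ha _ => by exact_mod_cast ha, fun t => rfl,
      fun t y _ => by rw [clock_coe]⟩

/-- Both results describe one and the same late state of a widely spaced `xs` under `T_{L+1}`, a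
capacity above every length, and a state determines its solitons. -/
theorem eq_of_reflTransGen [NeZero N] {xs ys zs : List (Soliton N)}
    (hL : ∀ l ∈ xs.map Soliton.len, 1 ≤ l) (hne : (xs.map Soliton.len).Nodup)
    (hy : Relation.ReflTransGen TwoBodyStep xs ys) (hz : Relation.ReflTransGen TwoBodyStep xs zs)
    (hlen : ys.map Soliton.len = zs.map Soliton.len)
    (hsort : (ys.map Soliton.len).Pairwise (· < ·)) : ys = zs := by
  set L := (xs.map Soliton.len).sum
  have hL' : ∀ l ∈ xs.map Soliton.len, 1 ≤ l ∧ l ≤ L := fun l hl =>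
    ⟨hL l hl, List.le_sum_of_mem hl⟩
  obtain ⟨v, hv, -⟩ := exists_spaced (3 * L) (List.pairwise_map.1 hne)
  have key : ∀ zs : List (Soliton N), Relation.ReflTransGen TwoBodyStep xs zs →
      (zs.map Soliton.len).Pairwise (· < ·) →
      zs.Pairwise fun a b => a.len < b.len ∧ a.len < L + 1 := fun zs hz hs =>
    (List.pairwise_map.1 hs).imp_of_mem fun {a b} ha _ hab => ⟨hab, by
      have := (hL' _ ((perm_of_reflTransGen hz).mem_iff.1 (List.mem_map_of_mem ha))).2
      omega⟩
  have e1 := eventually_stateOf (k := L + 1) (by omega) hL' hne hv hy (key ys hy hsort) 0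
  have e2 := eventually_stateOf (k := L + 1) (by omega) hL' hne hv hz (key zs hz (hlen ▸ hsort)) 0
  obtain ⟨t, ⟨h1, h2⟩, h3, h4⟩ := (e1.and e2).exists
  exact stateOf_injective hlen (fun l hl => hL l ((perm_of_reflTransGen hy).mem_iff.1 hl)) h2 h4
    (h1.symm.trans h3)

theorem TwoBodyStep.cons [NeZero N] (a : Soliton N) {xs zs : List (Soliton N)}
    (h : TwoBodyStep xs zs) : TwoBodyStep (a :: xs) (a :: zs) := by
  obtain ⟨us, vs, x, y, h⟩ := h
  exact TwoBodyStep.step (a :: us) vs x y h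

theorem reflTransGen_cons [NeZero N] (a : Soliton N) {xs zs : List (Soliton N)}
    (h : Relation.ReflTransGen TwoBodyStep xs zs) :
    Relation.ReflTransGen TwoBodyStep (a :: xs) (a :: zs) :=
  Relation.ReflTransGen.lift (fun xs => a :: xs) (fun _ _ => TwoBodyStep.cons a) _ _ h

/-- The longest soliton overtakes all others. -/
theorem exists_overtake [NeZero N] (us : List (Soliton N)) (x : Soliton N)
    (h : ∀ u ∈ us, u.len < x.len) : ∃ us' x', Relation.ReflTransGen TwoBodyStep (x :: us)
      (us' ++ [x']) ∧ us'.map Soliton.len = us.map Soliton.len ∧ x'.len = x.len := by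
  induction us generalizing x with
  | nil => exact ⟨[], x, Relation.ReflTransGen.refl, rfl, rfl⟩
  | cons u us ih =>
    rw [List.forall_mem_cons] at h
    obtain ⟨us', x', h1, h2, h3⟩ := ih (twoBody x u).2 h.2
    refine ⟨(twoBody x u).1 :: us', x', ?_, ?_, h3⟩
    · exact Relation.ReflTransGen.head (TwoBodyStep.step [] us x u h.1) (reflTransGen_cons _ h1)
    · rw [List.map_cons, List.map_cons, h2]
      rfl

/-- The tail is sorted first; then the head, the longest soliton, overtakes everything. -/
theorem exists_sorted [NeZero N] (xs : List (Soliton N))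
    (h : (xs.map Soliton.len).Pairwise (· > ·)) : ∃ ys, Relation.ReflTransGen TwoBodyStep xs ys ∧
      ys.map Soliton.len = (xs.map Soliton.len).reverse := by
  induction xs with
  | nil => exact ⟨[], Relation.ReflTransGen.refl, rfl⟩
  | cons x xs ih =>
    rw [List.map_cons, List.pairwise_cons] at h
    obtain ⟨ys, h1, h2⟩ := ih h.2
    obtain ⟨us, x', h3, h4, h5⟩ := exists_overtake ys x fun y hy => h.1 _ (by
      rw [← List.mem_reverse, ← h2]
      exact List.mem_map_of_mem hy)
    refine ⟨us ++ [x'], (reflTransGen_cons x h1).trans h3, ?_⟩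
    rw [List.map_append, h4, h2, List.map_cons, List.map_cons, List.reverse_cons, h5]
    rfl

end main

end BoxBall

/-- The box ball system has `n = N + 1 ≥ 2` letters; the solitons are labelled for `sl_N`. -/
theorem theorem4p6 (N : ℕ) [NeZero N] :
    (∀ l₁ l₂ : ℕ, 1 ≤ l₂ → l₂ < l₁ →
      ∃ D : ℕ, ∀ r : ℕ∞, (l₂ : ℕ∞) < r →
        ∀ (c₁ c₂ : ℤ) (b₁ : Row N l₁) (b₂ : Row N l₂),
          Scatters r D [⟨l₁, c₁, b₁⟩, ⟨l₂, c₂, b₂⟩]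
            [⟨l₂, c₂ + (2 * (l₂ : ℤ) + energy (b₁, b₂)), (crystalIso (b₁, b₂)).1⟩,
             ⟨l₁, c₁ - (2 * (l₂ : ℤ) + energy (b₁, b₂)), (crystalIso (b₁, b₂)).2⟩]) ∧
    (∀ ls : List ℕ, (∀ l ∈ ls, 1 ≤ l) → ls.Pairwise (· > ·) →
      ∃ D : ℕ, ∀ r : ℕ∞, 0 < r → (∀ l ∈ ls.tail, (l : ℕ∞) < r) →
        ∀ xs : List (Soliton N), xs.map Soliton.len = ls →
          ∃ ys : List (Soliton N),
            Relation.ReflTransGen TwoBodyStep xs ys ∧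
            ys.map Soliton.len = ls.reverse ∧
            (∀ zs : List (Soliton N), Relation.ReflTransGen TwoBodyStep xs zs →
              zs.map Soliton.len = ls.reverse → zs = ys) ∧
            Scatters r D xs ys) := by
  constructor
  · intro l₁ l₂ h2 hlt
    refine ⟨3 * l₁, fun r hr c₁ c₂ b₁ b₂ => ?_⟩
    have hr0 : 0 < r := lt_of_le_of_lt bot_le hr
    refine scatters_of_reflTransGen hr0 ?_ ?_
      (Relation.ReflTransGen.single (TwoBodyStep.step [] [] ⟨l₁, c₁, b₁⟩ ⟨l₂, c₂, b₂⟩ hlt)) ?_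
    · simp only [List.map_cons, List.map_nil, List.mem_cons, List.not_mem_nil, or_false]
      rintro l (rfl | rfl) <;> omega
    · simpa using hlt.ne'
    · simpa [twoBody] using ⟨hlt, hr⟩
  · intro ls hpos hls
    -- The sum of the lengths serves as a crude bound `L` for each of them.
    refine ⟨3 * ls.sum, fun r hr hr' xs hxs => ?_⟩
    subst hxs
    obtain ⟨ys, h1, h2⟩ := exists_sorted xs hls
    have hne : (xs.map Soliton.len).Nodup := hls.imp fun h => (ne_of_lt h).symm
    have hsort : (ys.map Soliton.len).Pairwise (· < ·) := by
      rw [h2, List.pairwise_reverse]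
      exact hls
    refine ⟨ys, h1, h2, fun zs h3 h4 => ?_, ?_⟩
    · exact (eq_of_reflTransGen hpos hne h1 h3 (h2.trans h4.symm) hsort).symm
    · refine scatters_of_reflTransGen hr (fun l hl => ⟨hpos l hl, List.le_sum_of_mem hl⟩) hne h1 ?_
      -- The later member of a pair lies in the tail, so only the longest soliton may have length at
      -- least `r`.
      have hspeed : (xs.map Soliton.len).Pairwise fun a b : ℕ => b < a ∧ (b : ℕ∞) < r := by
        revert hls hr'
        generalize xs.map Soliton.len = ls
        intro hls hr'
        cases ls with
        | nil => exact List.Pairwise.nil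
        | cons l ls =>
          rw [List.pairwise_cons] at hls ⊢
          exact ⟨fun a ha => ⟨hls.1 a ha, hr' a ha⟩,
            hls.2.imp_of_mem fun _ hb hab => ⟨hab, hr' _ hb⟩⟩
      rw [← List.pairwise_map (f := Soliton.len) (R := fun a b : ℕ => a < b ∧ (a : ℕ∞) < r), h2,
        List.pairwise_reverse]
      exact hspeed
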